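/- Consider a single-server queue that holds at most $K\ge 1$ packets (the one in service included). Packets arrive in a Poisson process of rate $\lambda>0$; a packet that finds $K$ packets present is rejected. Service times are independent exponential variables of rate $\mu>0$, $\mu\neq\lambda$, independent of the arrivals. Let $N_v\ge 1$ and $L_v>0$. Whenever the queue empties, and at time $0$, when the system is empty, a new running cycle begins: the server takes a vacation of length $L_v$. When a vacation ends, the server starts to work if packets are present; otherwise it takes another vacation, up to $N_v$ vacations in the cycle, after which it waits idly for the next arrival and serves it at once. The server works until the queue is empty, which ends the cycle. The M/M/1/K queue without policy is the same system without vacations: a server that finds the queue empty waits idly for the next arrival. Let $Q(t)$ be the number of packets in the system at time $t$, $\gamma(t)=\int_0^t Q(u)\,du$ the total time spent by packets in the system up to time $t$, and $\alpha(t)$ the number of packets that have arrived up to time $t$. For the $i$-th running cycle let $\Delta\gamma_i$ and $\Delta\alpha_i$ be the increments of $\gamma$ and $\alpha$ over the cycle. A mean waiting time (the time in the system, service included) is a limit of $\gamma(t)/\alpha(t)$, or the corresponding ratio for averaged cycles: it is the mean over all arriving packets, a rejected packet being counted with waiting time $0$. Let $A_i$ be the event that no packet arrives during the $N_v$ vacations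 of the $i$-th cycle, that is, within time $N_vL_v$ after its beginning. Put $\rho=\lambda/\mu$ and $$W=\frac{\rho\,\bigl(1+K\rho^{K+1}-(K+1)\rho^{K}\bigr)}{(1-\rho)(1-\rho^{K+1})}\,\lambda^{-1}.$$ Then: 1. $P(A_i)=e^{-\lambda N_vL_v}$ for every $i$. 2. Conditionally on $A_i$, the system works as the M/M/1/K queue without policy: the joint process of the queue length and the number of arrivals, from the end of the $N_v$ vacations of cycle $i$ to the end of that cycle, where it is stopped, has the law of the corresponding process of the M/M/1/K queue without policy, started empty and stopped when a service first leaves it empty. 3. For every $i$, $\Delta\gamma_i$ and $\Delta\alpha_i$ are integrable given $A_i$, and $E[\Delta\gamma_i\mid A_i]/E[\Delta\alpha_i\mid A_i]=W$. Moreover, almost surely, $$\lim_{n\to\infty}\frac{\sum_{i<n}\mathbf 1_{A_i}\Delta\gamma_i}{\sum_{i<n}\mathbf 1_{A_i}\Delta\alpha_i}=W .$$ 4. In the M/M/1/K queue without policy, started empty, $\gamma(t)/\alpha(t)\to W$ almost surely as $t\to\infty$. 5. The mean waiting time of the vacation queue is that of an averaged running cycle: for every $i$, $\Delta\gamma_i$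 and $\Delta\alpha_i$ are integrable, and almost surely $\gamma(t)/\alpha(t)\to E[\Delta\gamma_i]/E[\Delta\alpha_i]$ as $t\to\infty$. -/

import Mathlib

open MeasureTheory ProbabilityTheory Filter Topology
open scoped NNReal

noncomputable section

namespace VacationQueue

/-- A single-server queue that holds at most `K` packets (the one in service included) and whose
server takes up to `Nv` consecutive vacations, each of length `Lv`, whenever the queue empties. -/
structure Params where
  K : ℕ
  Nv : ℕ
  Lv : ℝ

/-- The queue without any vacation policy: a server that finds the queue empty stays at its
station, idle, and starts serving at the next arrival. -/
def noPolicy (K : ℕ) : Params := ⟨K, 0, 0⟩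

/-- A realization of the randomness: `gap n` is the `n`-th inter-arrival time (counted from time
`0`), `service n` is the duration of the `n`-th service. -/
structure Input where
  gap : ℕ → ℝ
  service : ℕ → ℝ

/-- The time of the `n`-th arrival, `n = 0, 1, 2, …`. -/
def Input.arrivalTime (x : Input) (n : ℕ) : ℝ := ∑ i ∈ Finset.range (n + 1), x.gap i

/-- The number of packets that arrive in `[0, t]`, whether admitted or rejected. -/
def Input.arrivals (x : Input) (t : ℝ) : ℕ := {n : ℕ | x.arrivalTime n ≤ t}.ncard

/-- What the server is doing: a vacation (`vacation j` is entered after `j` completed vacations of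
the same running cycle), waiting idly for a packet, or serving a packet. -/
inductive Mode where
  | vacation (j : ℕ)
  | idle
  | busy

/-- A maximal period in which the server takes one vacation, waits idly once, or serves one
packet. -/
structure Phase where
  mode : Mode
  /-- the time at which the phase starts -/
  start : ℝ
  /-- the number of packets in the system at the start of the phase -/
  queue : ℕ
  /-- the number of services completed before the phase -/
  served : ℕ

/-- What the server does next if the system is empty and it has completed `j` vacations in the
current running cycle. -/
def Params.emptyMode (c : Params) (j : ℕ) : Mode :=
  if j < c.Nv then Mode.vacation j else Mode.idle

/-- The number of packets in the system at time `t` if `t` lies in the phase `p`: no packet leaves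
during a phase, and an arriving packet that finds `K` packets present is rejected. -/
def Params.level (c : Params) (x : Input) (p : Phase) (t : ℝ) : ℕ :=
  min (p.queue + (x.arrivals t - x.arrivals p.start)) c.K

/-- The time at which a phase ends. An idle period ends at the first arrival after its start. -/
def Params.phaseEnd (c : Params) (x : Input) (p : Phase) : ℝ :=
  match p.mode with
  | Mode.vacation _ => p.start + c.Lv
  | Mode.idle => x.arrivalTime (x.arrivals p.start)
  | Mode.busy => p.start + x.service p.served

/-- The phase that follows the phase `p`. At the end of a service one packet leaves. -/
def Params.nextPhase (c : Params) (x : Input) (p : Phase) : Phase :=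
  let e := c.phaseEnd x p
  let q := c.level x p e
  match p.mode with
  | Mode.vacation j => ⟨if q = 0 then c.emptyMode (j + 1) else Mode.busy, e, q, p.served⟩
  | Mode.idle => ⟨Mode.busy, e, q, p.served⟩
  | Mode.busy => ⟨if q - 1 = 0 then c.emptyMode 0 else Mode.busy, e, q - 1, p.served + 1⟩

/-- The successive phases of the system, which starts empty at time `0`, at the beginning of its
first vacation (or idle, if there is no vacation policy). -/
def Params.phase (c : Params) (x : Input) : ℕ → Phase
  | 0 => ⟨c.emptyMode 0, 0, 0, 0⟩
  | m + 1 => c.nextPhase x (c.phase x m)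

/-- The index of the phase in progress at time `t`. -/
def Params.phaseIndex (c : Params) (x : Input) (t : ℝ) : ℕ :=
  {m : ℕ | (c.phase x (m + 1)).start ≤ t}.ncard

/-- The queue-length process: the number of packets in the system at time `t`. -/
def Params.queueLength (c : Params) (x : Input) (t : ℝ) : ℕ :=
  c.level x (c.phase x (c.phaseIndex x t)) t

/-- The starting time of the `i`-th running cycle, `i = 0, 1, 2, …`. A running cycle begins when a
service leaves the system empty (the first one at time `0`), and lasts until this happens again. -/
def Params.cycleStart (c : Params) (x : Input) (i : ℕ) : ℝ :=
  (c.phase x (Nat.nth (fun m => (c.phase x m).mode = c.emptyMode 0) i)).start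

/-- The time in the `i`-th running cycle at which `Nv` vacations are over. -/
def Params.vacationsEnd (c : Params) (x : Input) (i : ℕ) : ℝ :=
  c.cycleStart x i + c.Nv * c.Lv

/-- No packet arrives during the `Nv` vacations of the `i`-th running cycle. -/
def Params.NoArrival (c : Params) (x : Input) (i : ℕ) : Prop :=
  x.arrivals (c.vacationsEnd x i) = x.arrivals (c.cycleStart x i)

/-- The evolution of the `i`-th running cycle from the end of the `Nv` vacations to the end of the
cycle, where it is stopped: the number of packets in the system, and the number of packets that
have arrived since the end of the vacations. -/
def Params.activePath (c : Params) (x : Input) (i : ℕ) (t : ℝ≥0) : ℕ × ℕ :=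
  let u := min (c.vacationsEnd x i + t) (c.cycleStart x (i + 1))
  (c.queueLength x u, x.arrivals u - x.arrivals (c.vacationsEnd x i))

/-- The total time that packets spend in the system during `[0, t]`. -/
def Params.totalTime (c : Params) (x : Input) (t : ℝ) : ℝ :=
  ∫ u in (0 : ℝ)..t, (c.queueLength x u : ℝ)

/-- The total time that packets spend in the system during the `i`-th running cycle. -/
def Params.cycleTime (c : Params) (x : Input) (i : ℕ) : ℝ :=
  ∫ u in (c.cycleStart x i)..(c.cycleStart x (i + 1)), (c.queueLength x u : ℝ)

/-- The number of packets that arrive during the `i`-th running cycle. Rejected packets are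
included: they are packets that wait for no time. -/
def Params.cycleArrivals (c : Params) (x : Input) (i : ℕ) : ℝ :=
  ((x.arrivals (c.cycleStart x (i + 1)) - x.arrivals (c.cycleStart x i) : ℕ) : ℝ)

/-- `ρ (1 + K ρ ^ (K + 1) - (K + 1) ρ ^ K) / ((1 - ρ) (1 - ρ ^ (K + 1))) * λ⁻¹` with
`ρ = λ / μ`. -/
def waitingTime (lam mu : ℝ) (K : ℕ) : ℝ :=
  let ρ := lam / mu
  ρ * (1 + K * ρ ^ (K + 1) - (K + 1) * ρ ^ K) / ((1 - ρ) * (1 - ρ ^ (K + 1))) * lam⁻¹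

/-- The random input built from random inter-arrival times `X` and random service times `S`. -/
def randomInput {Ω : Type*} (X S : ℕ → Ω → ℝ) (ω : Ω) : Input :=
  ⟨fun n => X n ω, fun n => S n ω⟩

end VacationQueue

end

noncomputable section

namespace VacationQueue

open scoped ENNReal

/-! The queue is a deterministic functional of the input (gaps and service times), and everything
rests on regeneration. At the start of a phase, the input that remains (the residual gap, the later
gaps, the unused services) has the law of the original input and does not depend on what has
happened. For one phase this is memorylessness together with the independence of services and
arrivals (`splits_duration`). `splits_splitChain` passes it along the chain of phases, and
`splits_history`, taken at the random phase where the cycle ends, gives it for cycles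
(`splits_nextCycle`).

Pathwise, a system at the start of a cycle is a new system fed with the residual input
(`Params.BeginsCycle.phase_add`). Hence the totals of cycle `i` are those of cycle `0` evaluated at
the `i`-th iterate of `nextCycle`. This map preserves the law of the input and is independent of the
totals of the first cycle, so the strong law of large numbers applies to averages over cycles. Since
the total time and the number of arrivals are monotone in time, the limits pass from cycle ends to
all times. The queue without policy is the case of no vacations, so it needs no separate argument.

The event of no arrival in the vacations of a cycle says that the first gap of its input exceeds `Nv
* Lv`. By memorylessness the input after the vacations then has the original law
(`map_afterVacations`), and along each path the vacation queue fed with it agrees with the queue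
without policy until the cycle ends (`Params.phase_add_of_noArrival`,
`Params.isReturn_of_noArrival`). Conditional statements thus reduce to the first cycle of the queue
without policy.

The means of that cycle come from first-step analysis. Let `d q` be the mean reward collected while
the queue passes from `q` to `q - 1` packets. With `ρ = lam / mu`, `d q = g q + ρ * d (q + 1)`,
where `g q` is the reward up to the next arrival or departure, divided by the probability that this
event is a departure. A cycle is worth `a + d 1`, with `a` the reward of the idle period. Counting
arrivals gives `1 + ρ + ... + ρ ^ K`, counting time gives the sum of `(j + 1) * ρ ^ j / mu` over `j
< K`, and the quotient is `waitingTime`. The same potential with `g = 1` is a Lyapunov function: it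
bounds the mean number of phases in a cycle, for any vacation policy, so cycles end almost surely
and their totals are integrable. -/

/-- Positive inter-arrival and service times, and finitely many arrivals in bounded time. -/
structure Input.Regular (x : Input) : Prop where
  gap_pos : ∀ n, 0 < x.gap n
  service_pos : ∀ n, 0 < x.service n
  tendsto_arrivalTime : Tendsto x.arrivalTime atTop atTop

/-! ### Arrival times and arrival counts of a regular input -/

theorem Input.arrivalTime_zero (x : Input) : x.arrivalTime 0 = x.gap 0 := by
  simp [Input.arrivalTime]

theorem Input.arrivalTime_succ (x : Input) (n : ℕ) :
    x.arrivalTime (n + 1) = x.arrivalTime n + x.gap (n + 1) :=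
  Finset.sum_range_succ _ _

namespace Input.Regular

variable {x : Input}

theorem strictMono_arrivalTime (hx : x.Regular) : StrictMono x.arrivalTime :=
  strictMono_nat_of_lt_succ fun n => by
    rw [x.arrivalTime_succ]; linarith [hx.gap_pos (n + 1)]

theorem arrivalTime_pos (hx : x.Regular) (n : ℕ) : 0 < x.arrivalTime n := by
  have h := hx.strictMono_arrivalTime.monotone (Nat.zero_le n)
  rw [x.arrivalTime_zero] at h
  linarith [hx.gap_pos 0]

/-- Since the arrival times increase to infinity, the indices counted at time `t` form a finite
initial segment of `ℕ`. This Galois connection replaces `Set.ncard`, which would be `0` on an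
infinite set, in all later arguments. -/
theorem lt_arrivals_iff (hx : x.Regular) {n : ℕ} {t : ℝ} :
    n < x.arrivals t ↔ x.arrivalTime n ≤ t := by
  classical
  have hex : ∃ N, t < x.arrivalTime N := (hx.tendsto_arrivalTime.eventually_gt_atTop t).exists
  have hset : {n : ℕ | x.arrivalTime n ≤ t} = Finset.range (Nat.find hex) := by
    ext n
    simp only [Set.mem_ofPred_eq, Finset.coe_range, Set.mem_Iio]
    refine ⟨fun h => ?_, fun h => not_lt.1 (Nat.find_min hex h)⟩
    by_contra hn
    have := hx.strictMono_arrivalTime.monotone (not_lt.1 hn)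
    linarith [Nat.find_spec hex]
  have hcard : x.arrivals t = Nat.find hex := by
    rw [Input.arrivals, hset, Set.ncard_coe_finset, Finset.card_range]
  rw [hcard]
  have := Set.ext_iff.1 hset n
  simpa using this.symm

theorem arrivals_le_iff (hx : x.Regular) {n : ℕ} {t : ℝ} :
    x.arrivals t ≤ n ↔ t < x.arrivalTime n := by
  rw [← not_lt, hx.lt_arrivals_iff, not_le]

theorem arrivals_mono (hx : x.Regular) : Monotone x.arrivals := fun _ _ hst =>
  forall_lt_iff_le.1 fun _ hn => hx.lt_arrivals_iff.2 ((hx.lt_arrivals_iff.1 hn).trans hst)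

theorem arrivals_zero (hx : x.Regular) : x.arrivals 0 = 0 :=
  Nat.le_zero.1 (hx.arrivals_le_iff.2 (hx.arrivalTime_pos 0))

theorem arrivals_arrivalTime (hx : x.Regular) (n : ℕ) :
    x.arrivals (x.arrivalTime n) = n + 1 :=
  le_antisymm (hx.arrivals_le_iff.2 (hx.strictMono_arrivalTime n.lt_succ_self))
    (hx.lt_arrivals_iff.2 le_rfl)

theorem lt_arrivalTime_arrivals (hx : x.Regular) (t : ℝ) :
    t < x.arrivalTime (x.arrivals t) :=
  hx.arrivals_le_iff.1 le_rfl

end Input.Regular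

/-! ### The residual input -/

/-- The input that remains at time `e`, when `k` service times are used up. -/
def Input.shift (x : Input) (e : ℝ) (k : ℕ) : Input where
  gap n := match n with
    | 0 => x.arrivalTime (x.arrivals e) - e
    | n + 1 => x.gap (x.arrivals e + (n + 1))
  service n := x.service (k + n)

theorem Input.arrivalTime_shift (x : Input) (e : ℝ) (k n : ℕ) :
    (x.shift e k).arrivalTime n = x.arrivalTime (x.arrivals e + n) - e := by
  induction n with
  | zero => rw [Input.arrivalTime_zero]; rfl
  | succ n ih =>
    rw [Input.arrivalTime_succ, ih, ← Nat.add_assoc, x.arrivalTime_succ]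
    simp only [Input.shift, Nat.add_assoc]
    ring

namespace Input.Regular

variable {x : Input}

theorem shift (hx : x.Regular) (e : ℝ) (k : ℕ) : (x.shift e k).Regular where
  gap_pos n := by
    cases n with
    | zero => exact sub_pos.2 (hx.lt_arrivalTime_arrivals e)
    | succ n => exact hx.gap_pos _
  service_pos n := hx.service_pos _
  tendsto_arrivalTime := by
    simp only [funext (x.arrivalTime_shift e k), sub_eq_add_neg]
    refine tendsto_atTop_add_const_right _ _ (hx.tendsto_arrivalTime.comp ?_)
    exact tendsto_atTop_mono (fun n => Nat.le_add_left n _) tendsto_id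

theorem arrivals_shift (hx : x.Regular) (e : ℝ) (k : ℕ) (t : ℝ) :
    (x.shift e k).arrivals t = x.arrivals (e + t) - x.arrivals e := by
  refine eq_of_forall_lt_iff fun n => ?_
  rw [(hx.shift e k).lt_arrivals_iff, x.arrivalTime_shift, lt_tsub_iff_left, hx.lt_arrivals_iff,
    sub_le_iff_le_add']

theorem shift_zero (hx : x.Regular) : x.shift 0 0 = x := by
  obtain ⟨g, s⟩ := x
  simp only [Input.shift, hx.arrivals_zero, Input.mk.injEq, zero_add, and_true]
  funext n
  cases n <;> simp [Input.arrivalTime]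

/-- Shifts compose, which lets the residual input be updated phase by phase. Going forward in time,
`0 ≤ e'`, makes the truncated differences of arrival counts add up. -/
theorem shift_shift (hx : x.Regular) {e e' : ℝ} (he' : 0 ≤ e') (k k' : ℕ) :
    (x.shift e k).shift e' k' = x.shift (e + e') (k + k') := by
  have h : x.arrivals e + (x.shift e k).arrivals e' = x.arrivals (e + e') := by
    rw [hx.arrivals_shift]
    exact Nat.add_sub_of_le (hx.arrivals_mono (by linarith))
  have hg : ((x.shift e k).shift e' k').gap = (x.shift (e + e') (k + k')).gap := by
    funext n
    cases n with
    | zero =>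
      change (x.shift e k).arrivalTime ((x.shift e k).arrivals e') - e' = _
      rw [x.arrivalTime_shift, h, sub_sub]
      rfl
    | succ n =>
      change x.gap (x.arrivals e + ((x.shift e k).arrivals e' + n + 1)) = x.gap (_ + (n + 1))
      congr 1
      omega
  have hs : ((x.shift e k).shift e' k').service = (x.shift (e + e') (k + k')).service := by
    funext n
    simp [Input.shift, Nat.add_assoc]
  calc _ = Input.mk ((x.shift e k).shift e' k').gap ((x.shift e k).shift e' k').service := rfl
    _ = _ := by rw [hg, hs]

end Input.Regular

/-! ### Time homogeneity of the phase recursion -/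

/-- The phase `p`, `e` time units and `k` services later. -/
def Phase.translate (p : Phase) (e : ℝ) (k : ℕ) : Phase :=
  ⟨p.mode, e + p.start, p.queue, k + p.served⟩

/-- A phase that starts at time `0`. -/
def freshPhase (s : Mode) (q : ℕ) : Phase := ⟨s, 0, q, 0⟩

theorem freshPhase_translate (p : Phase) :
    (freshPhase p.mode p.queue).translate p.start p.served = p := by
  cases p; simp [freshPhase, Phase.translate]

theorem Params.level_translate (c : Params) {x : Input} (hx : x.Regular) (p : Phase) (e : ℝ)
    (k : ℕ) (t : ℝ) (hp : 0 ≤ p.start) :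
    c.level x (p.translate e k) (e + t) = c.level (x.shift e k) p t := by
  have h := hx.arrivals_mono (show e ≤ e + p.start by linarith)
  simp only [Params.level, Phase.translate, hx.arrivals_shift]
  congr 2
  omega

theorem Params.phaseEnd_translate (c : Params) {x : Input} (hx : x.Regular) (p : Phase) (e : ℝ)
    (k : ℕ) (hp : 0 ≤ p.start) :
    c.phaseEnd x (p.translate e k) = e + c.phaseEnd (x.shift e k) p := by
  obtain ⟨s, t, q, j⟩ := p
  have h := hx.arrivals_mono (show e ≤ e + t by simpa using hp)
  cases s with
  | vacation i => simp [Params.phaseEnd, Phase.translate, add_assoc]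
  | idle =>
    simp only [Params.phaseEnd, Phase.translate, x.arrivalTime_shift, hx.arrivals_shift,
      Nat.add_sub_of_le h]
    ring
  | busy => simp [Params.phaseEnd, Phase.translate, add_assoc, Input.shift]

/-- The recursion sees only increments of the arrival count after the start of the phase and
services not yet used, and both can be read from the shifted input. This is the deterministic half
of regeneration. -/
theorem Params.nextPhase_translate (c : Params) {x : Input} (hx : x.Regular) (p : Phase) (e : ℝ)
    (k : ℕ) (hp : 0 ≤ p.start) :
    c.nextPhase x (p.translate e k) = (c.nextPhase (x.shift e k) p).translate e k := by
  obtain ⟨s, t, q, j⟩ := p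
  have h1 := c.phaseEnd_translate hx ⟨s, t, q, j⟩ e k hp
  have h2 := c.level_translate hx ⟨s, t, q, j⟩ e k (c.phaseEnd (x.shift e k) ⟨s, t, q, j⟩) hp
  simp only [Phase.translate] at h1 h2
  cases s <;> simp [Params.nextPhase, Phase.translate, h1, h2, add_assoc]

/-! ### Admissible states -/

/-- The parameters allow at least one packet, and vacations take time. -/
structure Params.Proper (c : Params) : Prop where
  one_le_K : 1 ≤ c.K
  Lv_nonneg : 0 ≤ c.Lv
  Lv_pos : 0 < c.Nv → 0 < c.Lv

/-- The number of packets is compatible with what the server is doing. -/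
def Params.Valid (c : Params) : Mode → ℕ → Prop
  | Mode.vacation j, q => j < c.Nv ∧ q = 0
  | Mode.idle, q => q = 0
  | Mode.busy, q => 1 ≤ q ∧ q ≤ c.K

theorem Params.valid_emptyMode (c : Params) (j : ℕ) : c.Valid (c.emptyMode j) 0 := by
  unfold Params.emptyMode
  split_ifs with h
  · exact ⟨h, rfl⟩
  · rfl

theorem Params.emptyMode_ne_busy (c : Params) (j : ℕ) : c.emptyMode j ≠ Mode.busy := by
  unfold Params.emptyMode
  split_ifs <;> simp

theorem Params.Valid.queue_eq_zero {c : Params} {s : Mode} {q : ℕ} (h : c.Valid s q)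
    (hs : s ≠ Mode.busy) : q = 0 := by
  cases s with
  | vacation j => exact h.2
  | idle => exact h
  | busy => exact absurd rfl hs

theorem Params.Valid.queue_le {c : Params} {s : Mode} {q : ℕ} (h : c.Valid s q) : q ≤ c.K := by
  cases s with
  | vacation j => exact h.2.trans_le (Nat.zero_le _)
  | idle => exact (show q = 0 from h).trans_le (Nat.zero_le _)
  | busy => exact h.2

/-- Validity matters only for a vacation: `j < Nv` yields `0 < Nv`, and only then is `Lv` known to
be positive. -/
theorem Params.start_lt_phaseEnd {c : Params} (hc : c.Proper) {x : Input} (hx : x.Regular)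
    {p : Phase} (hp : c.Valid p.mode p.queue) : p.start < c.phaseEnd x p := by
  obtain ⟨s, t, q, k⟩ := p
  cases s with
  | vacation j => simpa [Params.phaseEnd] using hc.Lv_pos ((Nat.zero_le j).trans_lt hp.1)
  | idle => exact hx.lt_arrivalTime_arrivals t
  | busy => simpa [Params.phaseEnd] using hx.service_pos k

theorem Params.nextPhase_start (c : Params) (x : Input) (p : Phase) :
    (c.nextPhase x p).start = c.phaseEnd x p := by
  unfold Params.nextPhase
  obtain ⟨s, t, q, k⟩ := p
  cases s <;> rfl

theorem Params.valid_nextPhase {c : Params} (hc : c.Proper) {x : Input} (hx : x.Regular)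
    {p : Phase} (hp : c.Valid p.mode p.queue) :
    c.Valid (c.nextPhase x p).mode (c.nextPhase x p).queue := by
  have hK := hc.one_le_K
  obtain ⟨s, t, q, k⟩ := p
  cases s with
  | vacation j =>
    simp only [Params.nextPhase]
    set l := c.level x _ _ with hl
    have hl' : l ≤ c.K := min_le_right _ _
    split_ifs with h
    · rw [h]; exact c.valid_emptyMode _
    · exact ⟨Nat.one_le_iff_ne_zero.2 h, hl'⟩
  | idle =>
    obtain rfl : q = 0 := hp
    simp only [Params.nextPhase, Params.level, Params.phaseEnd, hx.arrivals_arrivalTime]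
    exact ⟨by omega, by omega⟩
  | busy =>
    simp only [Params.nextPhase]
    set l := c.level x _ _ with hl
    have hl' : l ≤ c.K := min_le_right _ _
    split_ifs with h
    · rw [h]; exact c.valid_emptyMode _
    · exact ⟨by omega, by omega⟩

/-! ### Phases and running cycles of a fixed input -/

section Phases

variable {c : Params} {x : Input}

theorem Params.valid_phase (hc : c.Proper) (hx : x.Regular) (m : ℕ) :
    c.Valid (c.phase x m).mode (c.phase x m).queue := by
  induction m with
  | zero => exact c.valid_emptyMode 0
  | succ m ih => exact c.valid_nextPhase hc hx ih

theorem Params.strictMono_start (hc : c.Proper) (hx : x.Regular) :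
    StrictMono fun m => (c.phase x m).start :=
  strictMono_nat_of_lt_succ fun m => by
    change _ < (c.nextPhase x (c.phase x m)).start
    rw [c.nextPhase_start]
    exact c.start_lt_phaseEnd hc hx (c.valid_phase hc hx m)

theorem Params.start_nonneg (hc : c.Proper) (hx : x.Regular) (m : ℕ) :
    0 ≤ (c.phase x m).start :=
  (c.strictMono_start hc hx).monotone (Nat.zero_le m)

/-- The input that remains at the start of the `m`-th phase. -/
def Params.residual (c : Params) (x : Input) (m : ℕ) : Input :=
  x.shift (c.phase x m).start (c.phase x m).served

theorem Params.phase_succ_eq_translate (hx : x.Regular) (m : ℕ) :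
    c.phase x (m + 1) = (c.nextPhase (c.residual x m)
      (freshPhase (c.phase x m).mode (c.phase x m).queue)).translate
        (c.phase x m).start (c.phase x m).served := by
  have h := c.nextPhase_translate hx (freshPhase (c.phase x m).mode (c.phase x m).queue)
    (c.phase x m).start (c.phase x m).served le_rfl
  rw [freshPhase_translate] at h
  exact h

/-- A running cycle begins with the `m`-th phase. -/
def Params.BeginsCycle (c : Params) (x : Input) (m : ℕ) : Prop :=
  (c.phase x m).mode = c.emptyMode 0

theorem Params.cycleStart_def (c : Params) (x : Input) (i : ℕ) :
    c.cycleStart x i = (c.phase x (Nat.nth (c.BeginsCycle x) i)).start := rfl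

theorem Params.BeginsCycle.queue_eq_zero (hc : c.Proper) (hx : x.Regular) {m : ℕ}
    (hm : c.BeginsCycle x m) : (c.phase x m).queue = 0 :=
  (c.valid_phase hc hx m).queue_eq_zero (hm.trans_ne (c.emptyMode_ne_busy 0))

/-- The phase that begins a cycle has the mode and the empty queue of phase `0`, so it is the
initial phase translated. Since the recursion commutes with translation, the whole future is that of
a new system fed with the residual input. -/
theorem Params.BeginsCycle.phase_add (hc : c.Proper) (hx : x.Regular) {m : ℕ}
    (hm : c.BeginsCycle x m) (n : ℕ) :
    c.phase x (m + n) =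
      (c.phase (c.residual x m) n).translate (c.phase x m).start (c.phase x m).served := by
  induction n with
  | zero =>
    conv_lhs => rw [Nat.add_zero, ← freshPhase_translate (c.phase x m), hm.queue_eq_zero hc hx,
      show (c.phase x m).mode = c.emptyMode 0 from hm]
    rfl
  | succ n ih =>
    rw [← Nat.add_assoc]
    change c.nextPhase x (c.phase x (m + n)) = _
    rw [ih]
    exact c.nextPhase_translate hx _ _ _ (c.start_nonneg hc (hx.shift _ _) n)

theorem Params.BeginsCycle.add_iff (hc : c.Proper) (hx : x.Regular) {m : ℕ}
    (hm : c.BeginsCycle x m) (n : ℕ) :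
    c.BeginsCycle x (m + n) ↔ c.BeginsCycle (c.residual x m) n := by
  unfold Params.BeginsCycle
  rw [hm.phase_add hc hx]
  rfl

/-- The first running cycle ends where the `m`-th phase starts. -/
def Params.IsReturn (c : Params) (x : Input) (m : ℕ) : Prop :=
  1 ≤ m ∧ c.BeginsCycle x m ∧ ∀ j, 1 ≤ j → j < m → ¬ c.BeginsCycle x j

theorem Params.beginsCycle_zero (c : Params) (x : Input) : c.BeginsCycle x 0 := rfl

theorem Params.nth_beginsCycle_zero (c : Params) (x : Input) :
    Nat.nth (c.BeginsCycle x) 0 = 0 :=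
  Nat.nth_zero_of_zero (c.beginsCycle_zero x)

theorem Params.cycleStart_zero (c : Params) (x : Input) : c.cycleStart x 0 = 0 := by
  rw [c.cycleStart_def, c.nth_beginsCycle_zero]
  rfl

theorem Params.IsReturn.count_eq_one {m : ℕ} (h : c.IsReturn x m)
    [DecidablePred (c.BeginsCycle x)] : Nat.count (c.BeginsCycle x) m = 1 := by
  obtain ⟨n, rfl⟩ : ∃ n, m = 1 + n := ⟨m - 1, by have := h.1; omega⟩
  rw [Nat.count_add, Nat.count_succ, Nat.count_zero, if_pos (c.beginsCycle_zero x), zero_add,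
    Nat.add_eq_left, Nat.count_iff_forall_not]
  exact fun j hj => h.2.2 _ (by omega) (by omega)

theorem Params.IsReturn.nth_eq {m : ℕ} (h : c.IsReturn x m) :
    Nat.nth (c.BeginsCycle x) 1 = m := by
  classical
  rw [← h.count_eq_one]
  exact Nat.nth_count h.2.1

/-- Before the phase on the right there is one beginning, that of phase `0`, in the first cycle, and
`i` more in the residual system; `Nat.nth_count` inverts this count. Infinitely many beginnings are
required because `Nat.nth` falls back to `0` beyond a finite number. -/
theorem Params.IsReturn.nth_succ (hc : c.Proper) (hx : x.Regular) {m : ℕ} (h : c.IsReturn x m)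
    (hinf : {n | c.BeginsCycle (c.residual x m) n}.Infinite) (i : ℕ) :
    Nat.nth (c.BeginsCycle x) (i + 1) = m + Nat.nth (c.BeginsCycle (c.residual x m)) i := by
  classical
  have h1 : c.BeginsCycle x (m + Nat.nth (c.BeginsCycle (c.residual x m)) i) :=
    (h.2.1.add_iff hc hx _).2 (Nat.nth_mem_of_infinite hinf i)
  have h2 : (fun k => c.BeginsCycle x (m + k)) = c.BeginsCycle (c.residual x m) :=
    funext fun k => propext (h.2.1.add_iff hc hx k)
  have h3 : Nat.count (c.BeginsCycle x) (m + Nat.nth (c.BeginsCycle (c.residual x m)) i) =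
      i + 1 := by
    rw [Nat.count_add, h.count_eq_one]
    simp only [h2]
    rw [Nat.count_nth_of_infinite hinf, add_comm]
  rw [← h3]
  exact Nat.nth_count h1

/-- The input that remains at the end of the first running cycle. -/
def Params.nextCycle (c : Params) (x : Input) : Input :=
  c.residual x (Nat.nth (c.BeginsCycle x) 1)

/-- A regular input for which every running cycle comes to an end. -/
def Params.Good (c : Params) (x : Input) : Prop :=
  x.Regular ∧ ∀ i, ∃ m, c.IsReturn ((c.nextCycle)^[i] x) m

theorem Params.Good.regular (h : c.Good x) : x.Regular := h.1

theorem Params.Good.exists_isReturn (h : c.Good x) : ∃ m, c.IsReturn x m := h.2 0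

theorem Params.Good.isReturn (h : c.Good x) : c.IsReturn x (Nat.nth (c.BeginsCycle x) 1) := by
  obtain ⟨m, hm⟩ := h.exists_isReturn
  rwa [hm.nth_eq]

theorem Params.Good.nextCycle (h : c.Good x) : c.Good (c.nextCycle x) :=
  ⟨h.1.shift _ _, fun i => h.2 (i + 1)⟩

theorem Params.Good.iterate (h : c.Good x) (i : ℕ) : c.Good ((c.nextCycle)^[i] x) := by
  induction i generalizing x with
  | zero => exact h
  | succ i ih => exact ih h.nextCycle

/-- A return takes at least one phase, so each passage to `nextCycle` pushes the beginnings found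
there further out by at least one index. -/
theorem Params.Good.infinite (hc : c.Proper) (h : c.Good x) :
    {n | c.BeginsCycle x n}.Infinite := by
  refine Set.infinite_of_forall_exists_gt fun a => ?_
  induction a generalizing x with
  | zero => exact ⟨_, h.isReturn.2.1, h.isReturn.1⟩
  | succ a ih =>
    obtain ⟨n, hn, han⟩ := ih h.nextCycle
    exact ⟨_, (h.isReturn.2.1.add_iff hc h.1 n).2 hn, by have := h.isReturn.1; omega⟩

theorem Params.Good.nth_succ (hc : c.Proper) (h : c.Good x) (i : ℕ) :
    Nat.nth (c.BeginsCycle x) (i + 1) =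
      Nat.nth (c.BeginsCycle x) 1 + Nat.nth (c.BeginsCycle (c.nextCycle x)) i :=
  h.isReturn.nth_succ hc h.1 (h.nextCycle.infinite hc) i

theorem Params.Good.cycleStart_succ (hc : c.Proper) (h : c.Good x) (i : ℕ) :
    c.cycleStart x (i + 1) = c.cycleStart x 1 + c.cycleStart (c.nextCycle x) i := by
  rw [c.cycleStart_def, h.nth_succ hc, h.isReturn.2.1.phase_add hc h.1]
  rfl

/-- Every packet present or served has arrived; rejected packets make this an inequality. It is the
source of the fact that each cycle contains an arrival. -/
theorem Params.queue_add_served_le (hc : c.Proper) (hx : x.Regular) (m : ℕ) :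
    (c.phase x m).queue + (c.phase x m).served ≤ x.arrivals (c.phase x m).start := by
  induction m with
  | zero => exact Nat.zero_le _
  | succ m ih =>
    have hv := c.valid_phase hc hx m
    have hlt := (c.start_lt_phaseEnd hc hx hv).le
    have hs : (c.phase x (m + 1)).start = c.phaseEnd x (c.phase x m) := c.nextPhase_start x _
    rw [hs]
    change (c.nextPhase x (c.phase x m)).queue + (c.nextPhase x (c.phase x m)).served ≤ _
    have hm := hx.arrivals_mono hlt
    revert ih hv hm
    generalize c.phase x m = p
    obtain ⟨s, t, q, k⟩ := p
    intro ih hv hm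
    cases s with
    | vacation j => simp only [Params.nextPhase, Params.level] at *; omega
    | idle => simp only [Params.nextPhase, Params.level] at *; omega
    | busy =>
      -- With `1 ≤ q` and `1 ≤ K` the level at the end of the service is positive, so the truncated
      -- subtraction really removes the packet that is then counted as served.
      have h1 : 1 ≤ q := hv.1
      have h2 := hc.one_le_K
      simp only [Params.nextPhase, Params.level] at *; omega

/-- This is what allows a cycle to be recognised by the mode alone: the end of a vacation never
leads back to the mode in which a cycle begins. -/
theorem Params.emptyMode_succ_ne (c : Params) (j : ℕ) (hj : j < c.Nv) :
    c.emptyMode (j + 1) ≠ c.emptyMode 0 := by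
  unfold Params.emptyMode
  rw [if_pos (show 0 < c.Nv by omega)]
  split_ifs <;> simp

/-- A running cycle begins at the end of a service. -/
theorem Params.BeginsCycle.busy_of_succ (hc : c.Proper) (hx : x.Regular) {m : ℕ}
    (h : c.BeginsCycle x (m + 1)) : (c.phase x m).mode = Mode.busy := by
  have hv := c.valid_phase hc hx m
  have h' : (c.nextPhase x (c.phase x m)).mode = c.emptyMode 0 := h
  revert hv h'
  generalize c.phase x m = p
  obtain ⟨s, t, q, k⟩ := p
  intro hv h
  cases s with
  | vacation j =>
    simp only [Params.nextPhase] at h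
    split_ifs at h
    · exact absurd h (c.emptyMode_succ_ne j hv.1)
    · exact absurd h.symm (c.emptyMode_ne_busy 0)
  | idle => exact absurd h.symm (c.emptyMode_ne_busy 0)
  | busy => rfl

theorem Params.IsReturn.one_le_served (hc : c.Proper) (hx : x.Regular) {m : ℕ}
    (h : c.IsReturn x m) : 1 ≤ (c.phase x m).served := by
  obtain ⟨n, rfl⟩ : ∃ n, m = n + 1 := ⟨m - 1, by have := h.1; omega⟩
  have hb := h.2.1.busy_of_succ hc hx
  change 1 ≤ (c.nextPhase x (c.phase x n)).served
  revert hb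
  generalize c.phase x n = p
  obtain ⟨s, t, q, k⟩ := p
  rintro rfl
  simp [Params.nextPhase]

theorem Params.IsReturn.one_le_arrivals (hc : c.Proper) (hx : x.Regular) {m : ℕ}
    (h : c.IsReturn x m) : 1 ≤ x.arrivals (c.phase x m).start := by
  have := c.queue_add_served_le hc hx m
  have := h.one_le_served hc hx
  omega

theorem Params.Good.one_le_arrivals (hc : c.Proper) (h : c.Good x) :
    1 ≤ x.arrivals (c.cycleStart x 1) :=
  h.isReturn.one_le_arrivals hc h.1

theorem Params.cycleStart_nonneg (hc : c.Proper) (hx : x.Regular) (i : ℕ) :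
    0 ≤ c.cycleStart x i := c.start_nonneg hc hx _

theorem Params.Good.arrivals_add (h : c.Good x) (t : ℝ) (ht : 0 ≤ t) :
    x.arrivals (c.cycleStart x 1 + t) =
      x.arrivals (c.cycleStart x 1) + (c.nextCycle x).arrivals t := by
  have h1 : (c.nextCycle x).arrivals t =
      x.arrivals (c.cycleStart x 1 + t) - x.arrivals (c.cycleStart x 1) :=
    h.1.arrivals_shift _ _ _
  have := h.1.arrivals_mono (show c.cycleStart x 1 ≤ c.cycleStart x 1 + t by linarith)
  omega

theorem Params.Good.le_arrivals_cycleStart (hc : c.Proper) (h : c.Good x) (i : ℕ) :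
    i ≤ x.arrivals (c.cycleStart x i) := by
  induction i generalizing x with
  | zero => exact Nat.zero_le _
  | succ i ih =>
    rw [h.cycleStart_succ hc, h.arrivals_add _ (c.cycleStart_nonneg hc h.nextCycle.1 i)]
    have := ih h.nextCycle
    have := h.one_le_arrivals hc
    omega

theorem Params.Good.strictMono_cycleStart (hc : c.Proper) (h : c.Good x) :
    StrictMono (c.cycleStart x) :=
  (c.strictMono_start hc h.1).comp (Nat.nth_strictMono (h.infinite hc))

/-- At least `i` packets have arrived by the start of cycle `i`, so this start is not before the
arrival of index `i - 1`, and arrival times are unbounded. In particular phases cannot accumulate at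
a finite time. -/
theorem Params.Good.tendsto_cycleStart (hc : c.Proper) (h : c.Good x) :
    Tendsto (c.cycleStart x) atTop atTop := by
  refine tendsto_atTop_mono' _ ?_ (h.1.tendsto_arrivalTime.comp (tendsto_sub_atTop_nat 1))
  filter_upwards [eventually_ge_atTop 1] with i hi
  exact h.1.lt_arrivals_iff.1 (lt_of_lt_of_le (Nat.sub_lt hi one_pos)
    (h.le_arrivals_cycleStart hc i))

theorem Params.Good.tendsto_start (hc : c.Proper) (h : c.Good x) :
    Tendsto (fun m => (c.phase x m).start) atTop atTop := by
  refine tendsto_atTop_atTop_of_monotone (c.strictMono_start hc h.1).monotone fun b => ?_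
  obtain ⟨i, hi⟩ := ((h.tendsto_cycleStart hc).eventually_ge_atTop b).exists
  exact ⟨_, hi⟩

/-! ### The queue length as a function of time -/

/-- An unbounded increasing sequence cuts the half-line into intervals. -/
theorem exists_mem_Ico_of_strictMono {u : ℕ → ℝ} (hu : Tendsto u atTop atTop) {t : ℝ}
    (ht : u 0 ≤ t) : ∃ n, t ∈ Set.Ico (u n) (u (n + 1)) := by
  classical
  have hex : ∃ n, t < u (n + 1) :=
    (((tendsto_add_atTop_iff_nat 1).2 hu).eventually_gt_atTop t).exists
  refine ⟨Nat.find hex, ?_, Nat.find_spec hex⟩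
  rcases Nat.eq_zero_or_pos (Nat.find hex) with h0 | hpos
  · rwa [h0]
  · have := Nat.find_min hex (Nat.sub_lt hpos one_pos)
    rwa [not_lt, Nat.sub_add_cancel (show 1 ≤ Nat.find hex from hpos)] at this

theorem Params.phaseIndex_eq (hc : c.Proper) (hx : x.Regular) {m : ℕ} {t : ℝ}
    (ht : t ∈ Set.Ico (c.phase x m).start (c.phase x (m + 1)).start) : c.phaseIndex x t = m := by
  have hset : {j : ℕ | (c.phase x (j + 1)).start ≤ t} = Finset.range m := by
    ext j
    simp only [Set.mem_ofPred_eq, Finset.coe_range, Set.mem_Iio]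
    constructor
    · intro h
      have := (c.strictMono_start hc hx).lt_iff_lt.1 (h.trans_lt ht.2)
      omega
    · exact fun h => ((c.strictMono_start hc hx).monotone (show j + 1 ≤ m by omega)).trans ht.1
  rw [Params.phaseIndex, hset, Set.ncard_coe_finset, Finset.card_range]

theorem Params.queueLength_eq (hc : c.Proper) (hx : x.Regular) {m : ℕ} {t : ℝ}
    (ht : t ∈ Set.Ico (c.phase x m).start (c.phase x (m + 1)).start) :
    c.queueLength x t = c.level x (c.phase x m) t := by
  rw [Params.queueLength, c.phaseIndex_eq hc hx ht]

theorem Params.Good.queueLength_add (hc : c.Proper) (h : c.Good x) {t : ℝ} (ht : 0 ≤ t) :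
    c.queueLength x (c.cycleStart x 1 + t) = c.queueLength (c.nextCycle x) t := by
  obtain ⟨n, hn⟩ := exists_mem_Ico_of_strictMono (h.nextCycle.tendsto_start hc) ht
  have hphase := h.isReturn.2.1.phase_add hc h.1
  rw [c.queueLength_eq hc h.nextCycle.1 hn, c.queueLength_eq hc h.1
    (m := Nat.nth (c.BeginsCycle x) 1 + n), hphase]
  · exact c.level_translate h.1 _ _ _ _ (c.start_nonneg hc h.nextCycle.1 n)
  · rw [Nat.add_assoc, hphase, hphase]
    exact ⟨add_le_add_right hn.1 _, add_lt_add_right hn.2 _⟩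

theorem Params.queueLength_le (c : Params) (x : Input) (t : ℝ) : c.queueLength x t ≤ c.K :=
  min_le_right _ _

theorem Params.queueLength_zero (hc : c.Proper) (hx : x.Regular) : c.queueLength x 0 = 0 := by
  have h0 : (c.phase x 0).start = 0 := rfl
  rw [c.queueLength_eq hc hx (m := 0) ⟨h0.le, h0.symm.trans_lt (c.strictMono_start hc hx one_pos)⟩]
  simp [Params.level, Params.phase]

end Phases

/-! ### Measurability of the system in the input -/

instance : MeasurableSpace Mode := ⊤

instance : DiscreteMeasurableSpace Mode := ⟨fun _ => trivial⟩

instance : Countable Mode := by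
  refine Function.Injective.countable (β := Option (Option ℕ))
    (f := fun s => match s with
      | Mode.vacation j => some (some j)
      | Mode.idle => some none
      | Mode.busy => none) ?_
  rintro (i | _ | _) (j | _ | _) h <;> simp_all

instance : MeasurableSpace Input :=
  MeasurableSpace.comap (fun x => (x.gap, x.service)) inferInstance

instance : MeasurableSpace Phase :=
  MeasurableSpace.comap (fun p => (p.mode, p.start, p.queue, p.served)) inferInstance

section Measurability

variable {α : Type*} [MeasurableSpace α]

/-- For a nonzero cardinality the set is one of countably many finite sets. The value `0` also
covers infinite sets, so it is treated as the complement of the other values. -/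
theorem measurable_ncard {p : ℕ → α → Prop} (hp : ∀ n, MeasurableSet {a | p n a}) :
    Measurable fun a => {n | p n a}.ncard := by
  have hF : ∀ F : Finset ℕ, MeasurableSet {a | {n | p n a} = (F : Set ℕ)} := fun F => by
    have : {a | {n | p n a} = (F : Set ℕ)} = ⋂ n, {a | p n a ↔ n ∈ F} := by
      ext a
      simp [Set.ext_iff]
    rw [this]
    refine MeasurableSet.iInter fun n => ?_
    by_cases h : n ∈ F
    · simpa [h] using hp n
    · simp only [h, iff_false]
      exact (hp n).compl
  have hk : ∀ k, k ≠ 0 → MeasurableSet ((fun a => {n | p n a}.ncard) ⁻¹' {k}) := fun k hk => by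
    have : (fun a => {n | p n a}.ncard) ⁻¹' {k} =
        ⋃ F : Finset ℕ, ⋃ _ : F.card = k, {a | {n | p n a} = (F : Set ℕ)} := by
      ext a
      simp only [Set.mem_preimage, Set.mem_singleton_iff, Set.mem_iUnion, Set.mem_ofPred_eq,
        exists_prop]
      constructor
      · intro h
        have hfin := Set.finite_of_ncard_ne_zero (h.trans_ne hk)
        exact ⟨hfin.toFinset, by rw [← h, Set.ncard_eq_toFinset_card _ hfin], by simp⟩
      · rintro ⟨F, hF, h⟩
        rw [h, Set.ncard_coe_finset, hF]
    rw [this]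
    exact MeasurableSet.iUnion fun F => MeasurableSet.iUnion fun _ => hF F
  refine measurable_to_countable' fun k => ?_
  by_cases h : k = 0
  · subst h
    have : (fun a => {n | p n a}.ncard) ⁻¹' {0} =
        (⋃ k, (fun a => {n | p n a}.ncard) ⁻¹' {k + 1})ᶜ := by
      ext a
      simp only [Set.mem_preimage, Set.mem_singleton_iff, Set.mem_compl_iff, Set.mem_iUnion,
        not_exists]
      exact ⟨fun h k hk => by omega,
        fun h => by_contra fun h0 => h _ (Nat.succ_pred_eq_of_ne_zero h0).symm⟩
    rw [this]
    exact (MeasurableSet.iUnion fun k => hk _ k.succ_ne_zero).compl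
  · exact hk k h

/-- A nonzero value `k` of `Nat.nth` means that `k` satisfies the predicate and that exactly `i`
smaller numbers do. The value `0`, which is also the default, is again handled by complement. -/
theorem measurable_nth {p : α → ℕ → Prop} (hp : ∀ n, MeasurableSet {a | p a n}) (i : ℕ) :
    Measurable fun a => Nat.nth (p a) i := by
  classical
  have hcount : ∀ n, Measurable fun a => Nat.count (p a) n := fun n => by
    induction n with
    | zero => simp
    | succ n ih =>
      simp only [Nat.count_succ]
      exact ih.add (Measurable.ite (hp n) measurable_const measurable_const)
  have hk : ∀ k, k ≠ 0 → MeasurableSet ((fun a => Nat.nth (p a) i) ⁻¹' {k}) := fun k hk => by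
    have : (fun a => Nat.nth (p a) i) ⁻¹' {k} =
        {a | p a k} ∩ (fun a => Nat.count (p a) k) ⁻¹' {i} := by
      ext a
      simp only [Set.mem_preimage, Set.mem_singleton_iff, Set.mem_inter_iff, Set.mem_ofPred_eq]
      constructor
      · intro h
        have h0 : ∀ hf : {n | p a n}.Finite, i < hf.toFinset.card := fun hf => by
          by_contra hlt
          exact hk (h ▸ Nat.nth_of_card_le hf (not_lt.1 hlt))
        exact ⟨h ▸ Nat.nth_mem i h0, h ▸ Nat.count_nth h0⟩
      · rintro ⟨h1, rfl⟩
        exact Nat.nth_count h1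
    rw [this]
    exact (hp k).inter (hcount k (measurableSet_singleton i))
  refine measurable_to_countable' fun k => ?_
  by_cases h : k = 0
  · subst h
    have : (fun a => Nat.nth (p a) i) ⁻¹' {0} =
        (⋃ k, (fun a => Nat.nth (p a) i) ⁻¹' {k + 1})ᶜ := by
      ext a
      simp only [Set.mem_preimage, Set.mem_singleton_iff, Set.mem_compl_iff, Set.mem_iUnion,
        not_exists]
      exact ⟨fun h k hk => by omega,
        fun h => by_contra fun h0 => h _ (Nat.succ_pred_eq_of_ne_zero h0).symm⟩
    rw [this]
    exact (MeasurableSet.iUnion fun k => hk _ k.succ_ne_zero).compl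
  · exact hk k h

theorem measurable_of_mode {β : Type*} [MeasurableSpace β] {s : α → Mode} (hs : Measurable s)
    {F : Mode → α → β} (hF : ∀ m, Measurable (F m)) : Measurable fun a => F (s a) a :=
  (measurable_from_prod_countable_right (f := fun z : Mode × α => F z.1 z.2) hF).comp
    (hs.prodMk measurable_id)

theorem measurable_index {β : Type*} [MeasurableSpace β] {n : α → ℕ} (hn : Measurable n)
    {F : ℕ → α → β} (hF : ∀ m, Measurable (F m)) : Measurable fun a => F (n a) a :=
  (measurable_from_prod_countable_right (f := fun z : ℕ × α => F z.1 z.2) hF).comp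
    (hn.prodMk measurable_id)

theorem measurable_nat_sub {f g : α → ℕ} (hf : Measurable f) (hg : Measurable g) :
    Measurable fun a => f a - g a :=
  (Measurable.of_discrete (f := fun z : ℕ × ℕ => z.1 - z.2)).comp (hf.prodMk hg)

theorem measurable_gap_service : Measurable fun x : Input => (x.gap, x.service) :=
  comap_measurable _

theorem Input.measurable_gap (n : ℕ) : Measurable fun x : Input => x.gap n :=
  (measurable_pi_apply n).comp (measurable_fst.comp measurable_gap_service)

theorem Input.measurable_service (n : ℕ) : Measurable fun x : Input => x.service n :=
  (measurable_pi_apply n).comp (measurable_snd.comp measurable_gap_service)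

theorem measurable_input_mk {g s : α → ℕ → ℝ} (hg : Measurable g) (hs : Measurable s) :
    Measurable fun a => (Input.mk (g a) (s a)) :=
  measurable_comap_iff.2 (hg.prodMk hs)

theorem measurable_phase_tuple :
    Measurable fun p : Phase => (p.mode, p.start, p.queue, p.served) :=
  comap_measurable _

theorem Phase.measurable_mode : Measurable Phase.mode := measurable_phase_tuple.fst
theorem Phase.measurable_start : Measurable Phase.start := measurable_phase_tuple.snd.fst
theorem Phase.measurable_queue : Measurable Phase.queue := measurable_phase_tuple.snd.snd.fst
theorem Phase.measurable_served : Measurable Phase.served := measurable_phase_tuple.snd.snd.snd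

theorem measurable_phase_mk {s : α → Mode} {t : α → ℝ} {q k : α → ℕ} (hs : Measurable s)
    (ht : Measurable t) (hq : Measurable q) (hk : Measurable k) :
    Measurable fun a => (Phase.mk (s a) (t a) (q a) (k a)) :=
  measurable_comap_iff.2 (hs.prodMk (ht.prodMk (hq.prodMk hk)))

theorem Input.measurable_arrivalTime (n : ℕ) : Measurable fun x : Input => x.arrivalTime n :=
  Finset.measurable_sum _ fun i _ => Input.measurable_gap i

theorem measurable_arrivalTime {x : α → Input} (hx : Measurable x) {n : α → ℕ}
    (hn : Measurable n) : Measurable fun a => (x a).arrivalTime (n a) :=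
  measurable_index hn fun m => (Input.measurable_arrivalTime m).comp hx

theorem measurable_arrivals {x : α → Input} (hx : Measurable x) {t : α → ℝ}
    (ht : Measurable t) : Measurable fun a => (x a).arrivals (t a) :=
  measurable_ncard fun n => measurableSet_le ((Input.measurable_arrivalTime n).comp hx) ht

theorem measurable_shift {x : α → Input} (hx : Measurable x) {t : α → ℝ} (ht : Measurable t)
    {k : α → ℕ} (hk : Measurable k) : Measurable fun a => (x a).shift (t a) (k a) := by
  refine measurable_input_mk (measurable_pi_iff.2 fun n => ?_) (measurable_pi_iff.2 fun n => ?_)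
  · cases n with
    | zero => exact (measurable_arrivalTime hx (measurable_arrivals hx ht)).sub ht
    | succ n =>
      exact measurable_index ((measurable_arrivals hx ht).add_const (n + 1)) fun m =>
        (Input.measurable_gap m).comp hx
  · exact measurable_index (hk.add_const n) fun m => (Input.measurable_service m).comp hx

variable (c : Params)

theorem measurable_level {x : α → Input} (hx : Measurable x) {p : α → Phase} (hp : Measurable p)
    {t : α → ℝ} (ht : Measurable t) : Measurable fun a => c.level (x a) (p a) (t a) := by
  refine Measurable.min (Measurable.add (Phase.measurable_queue.comp hp) ?_) measurable_const
  exact measurable_nat_sub (measurable_arrivals hx ht)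
    (measurable_arrivals hx (Phase.measurable_start.comp hp))

theorem measurable_phaseEnd {x : α → Input} (hx : Measurable x) {p : α → Phase}
    (hp : Measurable p) : Measurable fun a => c.phaseEnd (x a) (p a) := by
  have hs := Phase.measurable_start.comp hp
  refine measurable_of_mode (Phase.measurable_mode.comp hp) (F := fun s a => match s with
    | Mode.vacation _ => (p a).start + c.Lv
    | Mode.idle => (x a).arrivalTime ((x a).arrivals (p a).start)
    | Mode.busy => (p a).start + (x a).service (p a).served) fun m => ?_
  cases m with
  | vacation j => exact hs.add_const _
  | idle => exact measurable_arrivalTime hx (measurable_arrivals hx hs)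
  | busy =>
    exact hs.add (measurable_index (Phase.measurable_served.comp hp) fun m =>
      (Input.measurable_service m).comp hx)

theorem measurable_nextPhase {x : α → Input} (hx : Measurable x) {p : α → Phase}
    (hp : Measurable p) : Measurable fun a => c.nextPhase (x a) (p a) := by
  have he := measurable_phaseEnd c hx hp
  have hq := measurable_level c hx hp he
  have hk := Phase.measurable_served.comp hp
  refine measurable_of_mode (Phase.measurable_mode.comp hp) (F := fun s a =>
    let e := c.phaseEnd (x a) (p a)
    let q := c.level (x a) (p a) e
    match s with
    | Mode.vacation j =>
      (⟨if q = 0 then c.emptyMode (j + 1) else Mode.busy, e, q, (p a).served⟩ : Phase)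
    | Mode.idle => ⟨Mode.busy, e, q, (p a).served⟩
    | Mode.busy => ⟨if q - 1 = 0 then c.emptyMode 0 else Mode.busy, e, q - 1,
        (p a).served + 1⟩) fun m => ?_
  cases m with
  | vacation j =>
    exact measurable_phase_mk ((measurable_from_top
      (f := fun q => if q = 0 then c.emptyMode (j + 1) else Mode.busy)).comp hq) he hq hk
  | idle => exact measurable_phase_mk measurable_const he hq hk
  | busy =>
    have hq1 := measurable_nat_sub hq (measurable_const (a := 1))
    exact measurable_phase_mk ((measurable_from_top
      (f := fun q => if q = 0 then c.emptyMode 0 else Mode.busy)).comp hq1) he hq1 (hk.add_const 1)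

theorem measurable_phase (m : ℕ) : Measurable fun x => c.phase x m := by
  induction m with
  | zero => exact measurable_const
  | succ m ih => exact measurable_nextPhase c measurable_id ih

theorem measurable_queueLength {x : α → Input} (hx : Measurable x) {t : α → ℝ}
    (ht : Measurable t) : Measurable fun a => c.queueLength (x a) (t a) := by
  have hi : Measurable fun a => c.phaseIndex (x a) (t a) :=
    measurable_ncard fun n =>
      measurableSet_le (Phase.measurable_start.comp ((measurable_phase c (n + 1)).comp hx)) ht
  exact measurable_level c hx (measurable_index hi fun m => (measurable_phase c m).comp hx) ht

theorem measurableSet_beginsCycle (m : ℕ) : MeasurableSet {x | c.BeginsCycle x m} :=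
  (Phase.measurable_mode.comp (measurable_phase c m)) (measurableSet_singleton (c.emptyMode 0))

theorem measurable_nth_beginsCycle (i : ℕ) : Measurable fun x => Nat.nth (c.BeginsCycle x) i :=
  measurable_nth (measurableSet_beginsCycle c) i

theorem measurable_cycleStart (i : ℕ) : Measurable fun x => c.cycleStart x i :=
  measurable_index (measurable_nth_beginsCycle c i) fun m =>
    Phase.measurable_start.comp (measurable_phase c m)

theorem measurable_residual (m : ℕ) : Measurable fun x => c.residual x m :=
  measurable_shift measurable_id (Phase.measurable_start.comp (measurable_phase c m))
    (Phase.measurable_served.comp (measurable_phase c m))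

theorem measurable_nextCycle : Measurable c.nextCycle :=
  measurable_index (measurable_nth_beginsCycle c 1) (measurable_residual c)

theorem measurable_activePath (i : ℕ) : Measurable fun x => c.activePath x i := by
  have hv : Measurable fun x => c.vacationsEnd x i := (measurable_cycleStart c i).add_const _
  refine measurable_pi_iff.2 fun t => ?_
  have hu : Measurable fun x => min (c.vacationsEnd x i + t) (c.cycleStart x (i + 1)) :=
    (hv.add_const _).min (measurable_cycleStart c (i + 1))
  exact (measurable_queueLength c measurable_id hu).prodMk
    (measurable_nat_sub (measurable_arrivals measurable_id hu)
      (measurable_arrivals measurable_id hv))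

theorem measurable_cycleArrivals (i : ℕ) : Measurable fun x => c.cycleArrivals x i :=
  (measurable_from_top (f := fun n : ℕ => (n : ℝ))).comp (measurable_nat_sub
    (measurable_arrivals measurable_id (measurable_cycleStart c (i + 1)))
    (measurable_arrivals measurable_id (measurable_cycleStart c i)))

theorem measurable_queueLength_time (x : Input) : Measurable fun t => c.queueLength x t :=
  measurable_queueLength c measurable_const measurable_id

theorem intervalIntegrable_queueLength (x : Input) (a b : ℝ) :
    IntervalIntegrable (fun t => (c.queueLength x t : ℝ)) volume a b := by
  refine (intervalIntegrable_const (c := (c.K : ℝ))).mono_fun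
    ((measurable_from_top (f := fun n : ℕ => (n : ℝ))).comp
      (measurable_queueLength_time c x)).aestronglyMeasurable (ae_of_all _ fun t => ?_)
  simpa using c.queueLength_le x t

end Measurability

theorem integral_indicator_le {T d : ℝ} (hT : 0 < T) (hd : 0 ≤ d) :
    ∫ t in (0 : ℝ)..d, (if T ≤ t then (1 : ℝ) else 0) = max (d - T) 0 := by
  have h1 : (fun t => if T ≤ t then (1 : ℝ) else 0) = (Set.Ici T).indicator 1 := by
    funext t
    simp [Set.indicator_apply]
  have h2 : Set.Ioc 0 d ∩ Set.Ici T = Set.Icc T d := by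
    ext t
    simp only [Set.mem_inter_iff, Set.mem_Ioc, Set.mem_Ici, Set.mem_Icc]
    constructor
    · rintro ⟨⟨_, h⟩, h'⟩; exact ⟨h', h⟩
    · rintro ⟨h', h⟩; exact ⟨⟨hT.trans_le h', h⟩, h'⟩
  rw [intervalIntegral.integral_of_le hd, h1, setIntegral_indicator measurableSet_Ici, h2]
  simp [Measure.real, Real.volume_Icc, ENNReal.toReal_ofReal']

/-! ### Time in the system and arrivals, phase by phase -/

section Deterministic

variable {c : Params} {x : Input}

/-- The total time that packets spend in the system during a phase which starts, with `q` packets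
present and the server doing `s`, at time `0`. -/
def Params.phaseTime (c : Params) (s : Mode) (q : ℕ) (y : Input) : ℝ :=
  q * c.phaseEnd y (freshPhase s q) +
    ∑ n ∈ Finset.range (c.K - q), max (c.phaseEnd y (freshPhase s q) - y.arrivalTime n) 0

theorem sum_range_ite_lt (M N : ℕ) :
    ∑ n ∈ Finset.range M, (if n < N then (1 : ℝ) else 0) = (min M N : ℕ) := by
  rw [Finset.sum_ite, Finset.sum_const_zero, add_zero, Finset.sum_const, nsmul_eq_mul, mul_one]
  congr 1
  have : (Finset.range M).filter (· < N) = Finset.range (min M N) := by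
    ext n
    simp
  rw [this, Finset.card_range]

/-- The level is `q` plus the number of those among the first `K - q` arrivals that have already
occurred; later ones are rejected. Each admitted arrival contributes the time from its arrival to
`d`. -/
theorem Input.Regular.integral_level (hx : x.Regular) {q : ℕ} (hq : q ≤ c.K) (s : Mode) {d : ℝ}
    (hd : 0 ≤ d) :
    ∫ t in (0 : ℝ)..d, (c.level x (freshPhase s q) t : ℝ) =
      q * d + ∑ n ∈ Finset.range (c.K - q), max (d - x.arrivalTime n) 0 := by
  have h : ∀ t : ℝ, (c.level x (freshPhase s q) t : ℝ) =
      q + ∑ n ∈ Finset.range (c.K - q), if x.arrivalTime n ≤ t then (1 : ℝ) else 0 := fun t => by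
    simp only [← hx.lt_arrivals_iff, sum_range_ite_lt, Params.level, freshPhase, hx.arrivals_zero,
      Nat.sub_zero]
    rw [← Nat.cast_add]
    congr 1
    omega
  have hint : ∀ n, IntervalIntegrable
      (fun t => if x.arrivalTime n ≤ t then (1 : ℝ) else 0) volume 0 d := fun n => by
    refine (intervalIntegrable_const (c := (1 : ℝ))).mono_fun
      (Measurable.ite measurableSet_Ici measurable_const measurable_const).aestronglyMeasurable
      (ae_of_all _ fun t => ?_)
    simp only
    split_ifs <;> simp
  simp only [h]
  rw [intervalIntegral.integral_add intervalIntegrable_const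
    (by
      have := IntervalIntegrable.sum (Finset.range (c.K - q)) (fun n _ => hint n)
      simpa [Finset.sum_fn] using this),
    intervalIntegral.integral_finsetSum fun n _ => hint n]
  simp only [integral_indicator_le (hx.arrivalTime_pos _) hd, intervalIntegral.integral_const,
    sub_zero, smul_eq_mul]
  ring

theorem Params.start_succ (hx : x.Regular) (m : ℕ) :
    (c.phase x (m + 1)).start = (c.phase x m).start +
      c.phaseEnd (c.residual x m) (freshPhase (c.phase x m).mode (c.phase x m).queue) := by
  rw [c.phase_succ_eq_translate hx, ← c.nextPhase_start]
  rfl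

theorem Params.residual_succ (hc : c.Proper) (hx : x.Regular) (m : ℕ) :
    c.residual x (m + 1) = (c.residual x m).shift
      (c.phaseEnd (c.residual x m) (freshPhase (c.phase x m).mode (c.phase x m).queue))
      (c.nextPhase (c.residual x m)
        (freshPhase (c.phase x m).mode (c.phase x m).queue)).served := by
  have h1 := c.start_lt_phaseEnd hc (hx.shift (c.phase x m).start (c.phase x m).served)
    (p := freshPhase (c.phase x m).mode (c.phase x m).queue) (c.valid_phase hc hx m)
  rw [Params.residual, Params.residual, hx.shift_shift h1.le]
  rw [c.phase_succ_eq_translate hx, ← c.nextPhase_start]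
  rfl

theorem Params.arrivals_start_succ (hc : c.Proper) (hx : x.Regular) (m : ℕ) :
    x.arrivals (c.phase x (m + 1)).start = x.arrivals (c.phase x m).start +
      (c.residual x m).arrivals
        (c.phaseEnd (c.residual x m) (freshPhase (c.phase x m).mode (c.phase x m).queue)) := by
  have h := hx.arrivals_mono ((c.strictMono_start hc hx) m.lt_succ_self).le
  rw [Params.residual, hx.arrivals_shift, ← Params.residual, ← c.start_succ hx]
  simp only [Nat.succ_eq_add_one] at h
  omega

theorem Params.integral_phase (hc : c.Proper) (hx : x.Regular) (m : ℕ) :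
    ∫ t in (c.phase x m).start..(c.phase x (m + 1)).start, (c.queueLength x t : ℝ) =
      c.phaseTime (c.phase x m).mode (c.phase x m).queue (c.residual x m) := by
  have hlt := (c.strictMono_start hc hx) m.lt_succ_self
  simp only [Nat.succ_eq_add_one] at hlt
  have hd : 0 ≤ c.phaseEnd (c.residual x m)
      (freshPhase (c.phase x m).mode (c.phase x m).queue) := by
    have := Params.start_succ (c := c) hx m
    linarith
  have h1 : ∫ t in (c.phase x m).start..(c.phase x (m + 1)).start, (c.queueLength x t : ℝ) =
      ∫ t in (c.phase x m).start..(c.phase x (m + 1)).start, (c.level x (c.phase x m) t : ℝ) := by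
    refine intervalIntegral.integral_congr_ae ?_
    -- At the right end point the queue length already belongs to the next phase, a discrepancy on a
    -- null set.
    have : ∀ᵐ t : ℝ, t ≠ (c.phase x (m + 1)).start := by
      simp [ae_iff, measure_singleton]
    filter_upwards [this] with t ht htm
    rw [Set.uIoc_of_le hlt.le] at htm
    rw [c.queueLength_eq hc hx ⟨htm.1.le, lt_of_le_of_ne htm.2 ht⟩]
  have h3 := Input.Regular.integral_level (x := c.residual x m) (hx.shift _ _)
    (c.valid_phase hc hx m).queue_le (c.phase x m).mode hd
  rw [h1, Params.phaseTime, ← h3]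
  have h2 := intervalIntegral.integral_comp_add_left (a := 0)
    (b := c.phaseEnd (c.residual x m) (freshPhase (c.phase x m).mode (c.phase x m).queue))
    (fun t => (c.level x (c.phase x m) t : ℝ)) (c.phase x m).start
  rw [add_zero, ← c.start_succ hx] at h2
  have key : ∀ t, c.level x (c.phase x m) ((c.phase x m).start + t) =
      c.level (c.residual x m) (freshPhase (c.phase x m).mode (c.phase x m).queue) t := fun t => by
    have h4 := c.level_translate hx (freshPhase (c.phase x m).mode (c.phase x m).queue)
      (c.phase x m).start (c.phase x m).served t le_rfl
    rwa [freshPhase_translate] at h4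
  rw [← h2]
  simp only [key]

theorem Params.integral_queueLength_start (hc : c.Proper) (hx : x.Regular) (m : ℕ) :
    ∫ t in (0 : ℝ)..(c.phase x m).start, (c.queueLength x t : ℝ) =
      ∑ j ∈ Finset.range m,
        c.phaseTime (c.phase x j).mode (c.phase x j).queue (c.residual x j) := by
  rw [← Finset.sum_congr rfl fun j _ => c.integral_phase hc hx j,
    intervalIntegral.sum_integral_adjacent_intervals (a := fun j => (c.phase x j).start)
      fun j _ => intervalIntegrable_queueLength c x _ _]
  rfl

theorem Params.arrivals_start (hc : c.Proper) (hx : x.Regular) (m : ℕ) :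
    x.arrivals (c.phase x m).start = ∑ j ∈ Finset.range m, (c.residual x j).arrivals
      (c.phaseEnd (c.residual x j) (freshPhase (c.phase x j).mode (c.phase x j).queue)) := by
  induction m with
  | zero => exact hx.arrivals_zero
  | succ m ih => rw [Finset.sum_range_succ, ← ih, c.arrivals_start_succ hc hx]

/-! ### Later cycles -/

theorem Params.Good.iterate_eq {β : Type*} {f : Input → ℕ → β}
    (hf : ∀ y, c.Good y → ∀ i, f y (i + 1) = f (c.nextCycle y) i) (h : c.Good x) (i : ℕ) :
    f x i = f (c.nextCycle^[i] x) 0 := by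
  induction i generalizing x with
  | zero => rfl
  | succ i ih => rw [hf x h, ih h.nextCycle, Function.iterate_succ_apply]

theorem Params.Good.cycleTime_succ (hc : c.Proper) (h : c.Good x) (i : ℕ) :
    c.cycleTime x (i + 1) = c.cycleTime (c.nextCycle x) i := by
  have h2 := intervalIntegral.integral_comp_add_left (a := c.cycleStart (c.nextCycle x) i)
    (b := c.cycleStart (c.nextCycle x) (i + 1)) (fun t => (c.queueLength x t : ℝ))
    (c.cycleStart x 1)
  rw [Params.cycleTime, h.cycleStart_succ hc (i + 1), h.cycleStart_succ hc i, ← h2]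
  refine intervalIntegral.integral_congr fun t ht => ?_
  rw [Set.uIcc_of_le ((h.nextCycle.strictMono_cycleStart hc).monotone i.le_succ)] at ht
  rw [h.queueLength_add hc ((c.cycleStart_nonneg hc h.nextCycle.1 i).trans ht.1)]

theorem Params.Good.cycleArrivals_succ (hc : c.Proper) (h : c.Good x) (i : ℕ) :
    c.cycleArrivals x (i + 1) = c.cycleArrivals (c.nextCycle x) i := by
  rw [Params.cycleArrivals, h.cycleStart_succ hc (i + 1), h.cycleStart_succ hc i,
    h.arrivals_add _ (c.cycleStart_nonneg hc h.nextCycle.1 _),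
    h.arrivals_add _ (c.cycleStart_nonneg hc h.nextCycle.1 _), Nat.add_sub_add_left]
  rfl

theorem Params.Good.vacationsEnd_succ (hc : c.Proper) (h : c.Good x) (i : ℕ) :
    c.vacationsEnd x (i + 1) = c.cycleStart x 1 + c.vacationsEnd (c.nextCycle x) i := by
  rw [Params.vacationsEnd, h.cycleStart_succ hc i, add_assoc]
  rfl

theorem Params.Proper.vacations_nonneg (hc : c.Proper) : 0 ≤ (c.Nv : ℝ) * c.Lv :=
  mul_nonneg (Nat.cast_nonneg _) hc.Lv_nonneg

theorem Params.vacationsEnd_nonneg (hc : c.Proper) (hx : x.Regular) (i : ℕ) :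
    0 ≤ c.vacationsEnd x i :=
  add_nonneg (c.cycleStart_nonneg hc hx i) hc.vacations_nonneg

theorem Params.Good.noArrival_succ (hc : c.Proper) (h : c.Good x) (i : ℕ) :
    c.NoArrival x (i + 1) = c.NoArrival (c.nextCycle x) i := by
  rw [Params.NoArrival, h.vacationsEnd_succ hc, h.cycleStart_succ hc i,
    h.arrivals_add _ (c.cycleStart_nonneg hc h.nextCycle.1 _),
    h.arrivals_add _ (c.vacationsEnd_nonneg hc h.nextCycle.1 _), Nat.add_right_inj]
  rfl

theorem Params.Good.activePath_succ (hc : c.Proper) (h : c.Good x) (i : ℕ) :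
    c.activePath x (i + 1) = c.activePath (c.nextCycle x) i := by
  funext t
  have hv := c.vacationsEnd_nonneg hc h.nextCycle.1 i
  have hu : 0 ≤ min (c.vacationsEnd (c.nextCycle x) i + (t : ℝ))
      (c.cycleStart (c.nextCycle x) (i + 1)) :=
    le_min (add_nonneg hv t.2) (c.cycleStart_nonneg hc h.nextCycle.1 _)
  simp only [Params.activePath]
  rw [h.vacationsEnd_succ hc, h.cycleStart_succ hc (i + 1), add_assoc, min_add_add_left,
    h.queueLength_add hc hu, h.arrivals_add _ hu, h.arrivals_add _ hv, Nat.add_sub_add_left]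

/-! ### Cycles without arrivals during the vacations -/

/-- `Params.Proper` requires a positive vacation length only if there are vacations, so the general
results cover the queue without policy too. -/
theorem Params.noPolicy_proper (hK : 1 ≤ c.K) : (noPolicy c.K).Proper :=
  ⟨hK, le_rfl, fun h => absurd h (lt_irrefl 0)⟩

theorem noPolicy_emptyMode (K j : ℕ) : (noPolicy K).emptyMode j = Mode.idle := by
  simp [noPolicy, Params.emptyMode]

theorem Params.noArrival_zero_iff (hx : x.Regular) :
    c.NoArrival x 0 ↔ c.Nv * c.Lv < x.gap 0 := by
  rw [Params.NoArrival, Params.vacationsEnd, c.cycleStart_zero, zero_add, hx.arrivals_zero,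
    ← Nat.le_zero, hx.arrivals_le_iff, x.arrivalTime_zero]

theorem Params.phase_of_noArrival (hc : c.Proper) (hx : x.Regular)
    (hA : c.Nv * c.Lv < x.gap 0) {j : ℕ} (hj : j ≤ c.Nv) :
    c.phase x j = ⟨c.emptyMode j, j * c.Lv, 0, 0⟩ := by
  induction j with
  | zero => simp [Params.phase]
  | succ j ih =>
    have hL := hc.Lv_pos (by omega)
    have harr : x.arrivals (j * c.Lv + c.Lv) = 0 := by
      rw [← Nat.le_zero, hx.arrivals_le_iff, x.arrivalTime_zero]
      refine lt_of_le_of_lt ?_ hA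
      have : ((j + 1 : ℕ) : ℝ) ≤ c.Nv := Nat.cast_le.2 hj
      push_cast at this
      nlinarith
    change c.nextPhase x (c.phase x j) = _
    rw [ih (by omega), Params.emptyMode, if_pos (show j < c.Nv by omega)]
    simp only [Params.nextPhase, Params.phaseEnd, Params.level, harr]
    simp
    ring

/-- As long as the system does not become empty, the policy is irrelevant. -/
theorem Params.nextPhase_noPolicy_of_ne {p : Phase}
    (hp : p.mode = Mode.idle ∨ p.mode = Mode.busy)
    (h : ((noPolicy c.K).nextPhase x p).mode ≠ Mode.idle) :
    c.nextPhase x p = (noPolicy c.K).nextPhase x p ∧ (c.nextPhase x p).mode = Mode.busy := by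
  obtain ⟨s, t, q, k⟩ := p
  rcases hp with h' | h' <;> obtain rfl : s = _ := h'
  · simp [Params.nextPhase, Params.phaseEnd, Params.level, noPolicy]
  · simp only [Params.nextPhase, Params.phaseEnd, Params.level, noPolicy_emptyMode,
      show (noPolicy c.K).K = c.K from rfl] at h ⊢
    split_ifs at h ⊢ <;> simp_all

/-- When a service empties the system, the two queues differ only in what the server does next.
Time, queue and services used still agree, hence so do the end of the cycle and the residual input.
-/
theorem Params.nextPhase_noPolicy_of_eq {p : Phase}
    (hp : p.mode = Mode.idle ∨ p.mode = Mode.busy)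
    (h : ((noPolicy c.K).nextPhase x p).mode = Mode.idle) :
    c.nextPhase x p = { (noPolicy c.K).nextPhase x p with mode := c.emptyMode 0 } := by
  obtain ⟨s, t, q, k⟩ := p
  rcases hp with h' | h' <;> obtain rfl : s = _ := h'
  · simp [Params.nextPhase] at h
  · simp only [Params.nextPhase, Params.phaseEnd, Params.level, noPolicy_emptyMode,
      show (noPolicy c.K).K = c.K from rfl] at h ⊢
    split_ifs at h ⊢
    simp_all

theorem noPolicy_beginsCycle_iff (K m : ℕ) :
    (noPolicy K).BeginsCycle x m ↔ ((noPolicy K).phase x m).mode = Mode.idle := by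
  rw [Params.BeginsCycle, noPolicy_emptyMode]

theorem noPolicy_mode (hc : c.Proper) (hx : x.Regular) (m : ℕ) :
    ((noPolicy c.K).phase x m).mode = Mode.idle ∨
      ((noPolicy c.K).phase x m).mode = Mode.busy := by
  have hv := (noPolicy c.K).valid_phase (c.noPolicy_proper hc.one_le_K) hx m
  revert hv
  generalize (noPolicy c.K).phase x m = p
  obtain ⟨s, t, q, k⟩ := p
  intro hv
  cases s with
  | vacation j => exact absurd hv.1 (Nat.not_lt_zero j)
  | idle => exact Or.inl rfl
  | busy => exact Or.inr rfl

theorem Params.arrivals_add_of_noArrival (hx : x.Regular) (hA : c.Nv * c.Lv < x.gap 0) (t : ℝ) :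
    x.arrivals (c.Nv * c.Lv) = 0 ∧
      x.arrivals (c.Nv * c.Lv + t) = (x.shift (c.Nv * c.Lv) 0).arrivals t := by
  have h1 : x.arrivals (c.Nv * c.Lv) = 0 := by
    rw [← Nat.le_zero, hx.arrivals_le_iff, x.arrivalTime_zero]
    exact hA
  exact ⟨h1, by rw [hx.arrivals_shift, h1, Nat.sub_zero]⟩

section NoArrival

variable (hc : c.Proper) (hx : x.Regular) (hA : c.Nv * c.Lv < x.gap 0)
include hc hx hA

/-- After `Nv` vacations without an arrival the server is idle and the system empty at time `Nv *
Lv`, which is the initial phase of the queue without policy, translated. The policy plays no role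
again until that queue empties, so the phases continue to correspond. -/
theorem Params.phase_add_of_noArrival (n : ℕ)
    (h : ∀ j, 1 ≤ j → j ≤ n → ¬ (noPolicy c.K).BeginsCycle (x.shift (c.Nv * c.Lv) 0) j) :
    c.phase x (c.Nv + n) =
        ((noPolicy c.K).phase (x.shift (c.Nv * c.Lv) 0) n).translate (c.Nv * c.Lv) 0 ∧
      (1 ≤ n → (c.phase x (c.Nv + n)).mode = Mode.busy) := by
  have hp := c.noPolicy_proper hc.one_le_K
  induction n with
  | zero =>
    refine ⟨?_, fun h => absurd h (by omega)⟩
    rw [Nat.add_zero, c.phase_of_noArrival hc hx hA le_rfl]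
    simp [Params.phase, Phase.translate, Params.emptyMode, noPolicy]
  | succ n ih =>
    have h1 := h (n + 1) (by omega) le_rfl
    rw [noPolicy_beginsCycle_iff] at h1
    have h2 := c.nextPhase_noPolicy_of_ne (noPolicy_mode hc (hx.shift _ _) n) h1
    have h3 : c.phase x (c.Nv + (n + 1)) = (c.nextPhase (x.shift (c.Nv * c.Lv) 0)
        ((noPolicy c.K).phase (x.shift (c.Nv * c.Lv) 0) n)).translate (c.Nv * c.Lv) 0 := by
      rw [← Nat.add_assoc]
      change c.nextPhase x (c.phase x (c.Nv + n)) = _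
      rw [(ih fun j h1 h2 => h j h1 (by omega)).1,
        c.nextPhase_translate hx _ _ _ (Params.start_nonneg hp (hx.shift _ _) n)]
    rw [h3]
    exact ⟨by rw [h2.1]; rfl, fun _ => h2.2⟩

theorem Params.isReturn_of_noArrival {n : ℕ}
    (h : (noPolicy c.K).IsReturn (x.shift (c.Nv * c.Lv) 0) n) :
    c.IsReturn x (c.Nv + n) ∧
      (c.phase x (c.Nv + n)).start =
        c.Nv * c.Lv + ((noPolicy c.K).phase (x.shift (c.Nv * c.Lv) 0) n).start ∧
      (c.phase x (c.Nv + n)).served =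
        ((noPolicy c.K).phase (x.shift (c.Nv * c.Lv) 0) n).served := by
  have hp := c.noPolicy_proper hc.one_le_K
  obtain ⟨n, rfl⟩ : ∃ k, n = k + 1 := ⟨n - 1, by have := h.1; omega⟩
  have h0 : c.phase x (c.Nv + (n + 1)) =
      Phase.translate { (noPolicy c.K).phase (x.shift (c.Nv * c.Lv) 0) (n + 1) with
        mode := c.emptyMode 0 } (c.Nv * c.Lv) 0 := by
    rw [← Nat.add_assoc]
    change c.nextPhase x (c.phase x (c.Nv + n)) = _
    rw [(c.phase_add_of_noArrival hc hx hA n fun j h1 h2 => h.2.2 j h1 (by omega)).1,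
        c.nextPhase_translate hx _ _ _ (Params.start_nonneg hp (hx.shift _ _) n),
        c.nextPhase_noPolicy_of_eq (noPolicy_mode hc (hx.shift _ _) n)
          ((noPolicy_beginsCycle_iff _ _).1 h.2.1)]
    rfl
  refine ⟨⟨by omega, by rw [Params.BeginsCycle, h0]; rfl, fun j hj1 hj2 hj => ?_⟩, ?_, ?_⟩
  -- No earlier phase begins a cycle: up to index `Nv` the mode is `emptyMode (k + 1)`, and after
  -- that the server is busy.
  · rcases le_or_gt j c.Nv with hjN | hjN
    · rw [Params.BeginsCycle, c.phase_of_noArrival hc hx hA hjN] at hj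
      obtain ⟨k, rfl⟩ : ∃ k, j = k + 1 := ⟨j - 1, by omega⟩
      exact c.emptyMode_succ_ne k hjN hj
    · obtain ⟨k, rfl⟩ : ∃ k, j = c.Nv + k := ⟨j - c.Nv, by omega⟩
      have := (c.phase_add_of_noArrival hc hx hA k fun j h1 h2 =>
        h.2.2 j h1 (by omega)).2 (by omega)
      rw [Params.BeginsCycle, this] at hj
      exact c.emptyMode_ne_busy 0 hj.symm
  · rw [h0]; rfl
  · rw [h0]; simp [Phase.translate]

variable (hy : (noPolicy c.K).Good (x.shift (c.Nv * c.Lv) 0))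
include hy

theorem Params.cycleStart_one_of_noArrival :
    c.cycleStart x 1 =
      c.Nv * c.Lv + (noPolicy c.K).cycleStart (x.shift (c.Nv * c.Lv) 0) 1 := by
  have h := c.isReturn_of_noArrival hc hx hA hy.isReturn
  rw [c.cycleStart_def, h.1.nth_eq, h.2.1]
  rfl

theorem Params.nextCycle_of_noArrival :
    c.nextCycle x = (noPolicy c.K).nextCycle (x.shift (c.Nv * c.Lv) 0) := by
  have h := c.isReturn_of_noArrival hc hx hA hy.isReturn
  have h1 := Params.start_nonneg (c.noPolicy_proper hc.one_le_K) (hx.shift (c.Nv * c.Lv) 0)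
    (Nat.nth ((noPolicy c.K).BeginsCycle (x.shift (c.Nv * c.Lv) 0)) 1)
  rw [Params.nextCycle, h.1.nth_eq, Params.residual, h.2.1, h.2.2, Params.nextCycle,
    Params.residual, hx.shift_shift h1, Nat.zero_add]

variable (hg : c.Good x)
include hg

theorem Params.queueLength_add_of_noArrival {t : ℝ} (h0 : 0 ≤ t)
    (ht : t ≤ (noPolicy c.K).cycleStart (x.shift (c.Nv * c.Lv) 0) 1) :
    c.queueLength x (c.Nv * c.Lv + t) =
      (noPolicy c.K).queueLength (x.shift (c.Nv * c.Lv) 0) t := by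
  have hp := c.noPolicy_proper hc.one_le_K
  rcases ht.lt_or_eq with ht | rfl
  · obtain ⟨n, hn⟩ := exists_mem_Ico_of_strictMono (hy.tendsto_start hp) h0
    have hr := hy.isReturn
    have hnr : n < Nat.nth ((noPolicy c.K).BeginsCycle (x.shift (c.Nv * c.Lv) 0)) 1 :=
      (Params.strictMono_start hp hy.1).lt_iff_lt.1 (hn.1.trans_lt ht)
    have h1 := (c.phase_add_of_noArrival hc hx hA n fun j h1 h2 => hr.2.2 j h1 (by omega)).1
    have h2 : (c.phase x (c.Nv + n + 1)).start = c.Nv * c.Lv +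
        ((noPolicy c.K).phase (x.shift (c.Nv * c.Lv) 0) (n + 1)).start := by
      rcases (show n + 1 ≤ _ from hnr).lt_or_eq with h | h
      · rw [Nat.add_assoc, (c.phase_add_of_noArrival hc hx hA (n + 1) fun j h1 h2 =>
          hr.2.2 j h1 (by omega)).1]
        rfl
      · rw [Nat.add_assoc]
        exact (c.isReturn_of_noArrival hc hx hA (h ▸ hr)).2.1
    rw [Params.queueLength_eq hp hy.1 hn, c.queueLength_eq hc hx (m := c.Nv + n), h1,
      c.level_translate hx _ _ _ _ (Params.start_nonneg hp hy.1 n)]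
    · rfl
    · rw [h2, h1]
      exact ⟨add_le_add_right hn.1 _, add_lt_add_right hn.2 _⟩
  -- At the end point the phases no longer correspond, but both systems begin a new cycle there and
  -- are empty.
  · rw [← c.cycleStart_one_of_noArrival hc hx hA hy]
    have h1 := hg.queueLength_add hc le_rfl
    have h2 := hy.queueLength_add hp le_rfl
    rw [add_zero] at h1 h2
    rw [h1, h2, c.queueLength_zero hc hg.nextCycle.1, Params.queueLength_zero hp hy.nextCycle.1]

theorem Params.activePath_of_noArrival :
    c.activePath x 0 = (noPolicy c.K).activePath (x.shift (c.Nv * c.Lv) 0) 0 := by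
  have hp := c.noPolicy_proper hc.one_le_K
  funext t
  have h0 : (0 : ℝ) ≤ min (t : ℝ) ((noPolicy c.K).cycleStart (x.shift (c.Nv * c.Lv) 0) 1) :=
    le_min t.2 (Params.cycleStart_nonneg hp hy.1 1)
  have h1 := c.arrivals_add_of_noArrival hx hA
    (min (t : ℝ) ((noPolicy c.K).cycleStart (x.shift (c.Nv * c.Lv) 0) 1))
  have h2 : (noPolicy c.K).vacationsEnd (x.shift (c.Nv * c.Lv) 0) 0 = 0 := by
    simp [Params.vacationsEnd, Params.cycleStart_zero, noPolicy]
  simp only [Params.activePath, h2, zero_add]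
  rw [Params.vacationsEnd, c.cycleStart_zero, zero_add,
    c.cycleStart_one_of_noArrival hc hx hA hy, min_add_add_left,
    c.queueLength_add_of_noArrival hc hx hA hy hg h0 (min_le_right _ _), h1.1, h1.2,
    hy.1.arrivals_zero]

omit hg in
theorem Params.cycleArrivals_of_noArrival :
    c.cycleArrivals x 0 = (noPolicy c.K).cycleArrivals (x.shift (c.Nv * c.Lv) 0) 0 := by
  have hp := c.noPolicy_proper hc.one_le_K
  have h1 := c.arrivals_add_of_noArrival hx hA
    ((noPolicy c.K).cycleStart (x.shift (c.Nv * c.Lv) 0) 1)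
  rw [Params.cycleArrivals, Params.cycleArrivals, zero_add, c.cycleStart_zero,
    Params.cycleStart_zero, c.cycleStart_one_of_noArrival hc hx hA hy, h1.2, hx.arrivals_zero,
    hy.1.arrivals_zero]

omit hA hy in
theorem Params.queueLength_le_arrivals {t : ℝ} (ht : 0 ≤ t) :
    c.queueLength x t ≤ x.arrivals t := by
  obtain ⟨n, hn⟩ := exists_mem_Ico_of_strictMono (hg.tendsto_start hc) ht
  rw [c.queueLength_eq hc hx hn]
  have h1 := c.queue_add_served_le hc hx n
  have h2 := hx.arrivals_mono hn.1
  simp only [Params.level]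
  omega

theorem Params.cycleTime_of_noArrival :
    c.cycleTime x 0 = (noPolicy c.K).cycleTime (x.shift (c.Nv * c.Lv) 0) 0 := by
  have hp := c.noPolicy_proper hc.one_le_K
  have hv := hc.vacations_nonneg
  have hs := Params.cycleStart_nonneg hp hy.1 1
  rw [Params.cycleTime, Params.cycleTime, zero_add, c.cycleStart_zero, Params.cycleStart_zero,
    ← intervalIntegral.integral_add_adjacent_intervals (b := c.Nv * c.Lv)
      (intervalIntegrable_queueLength c x _ _) (intervalIntegrable_queueLength c x _ _)]
  -- The vacations contribute nothing: the queue length never exceeds the number of arrivals, which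
  -- is still zero.
  have h1 : ∫ t in (0 : ℝ)..(c.Nv * c.Lv), (c.queueLength x t : ℝ) = 0 := by
    refine (intervalIntegral.integral_congr (g := fun _ => (0 : ℝ)) fun t ht => ?_).trans (by simp)
    rw [Set.uIcc_of_le hv] at ht
    have h2 := c.queueLength_le_arrivals hc hx hg ht.1
    have h3 := hx.arrivals_mono ht.2
    rw [(c.arrivals_add_of_noArrival hx hA 0).1] at h3
    simp only [Nat.cast_eq_zero]
    omega
  have h2 := intervalIntegral.integral_comp_add_left (a := 0)
    (b := (noPolicy c.K).cycleStart (x.shift (c.Nv * c.Lv) 0) 1)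
    (fun t => (c.queueLength x t : ℝ)) (c.Nv * c.Lv)
  rw [add_zero] at h2
  rw [h1, zero_add, c.cycleStart_one_of_noArrival hc hx hA hy, ← h2]
  refine intervalIntegral.integral_congr fun t ht => ?_
  rw [Set.uIcc_of_le hs] at ht
  rw [c.queueLength_add_of_noArrival hc hx hA hy hg ht.1 ht.2]

end NoArrival

end Deterministic

/-! ### The exponential distribution -/

instance isProbabilityMeasure_exp {r : ℝ} [hr : Fact (0 < r)] :
    IsProbabilityMeasure (expMeasure r) :=
  isProbabilityMeasure_expMeasure hr.out

section Exponential

variable {r : ℝ}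

theorem measurable_exponentialPDF (r : ℝ) : Measurable (exponentialPDF r) :=
  (measurable_exponentialPDFReal r).ennreal_ofReal

theorem lintegral_expMeasure (r : ℝ) {f : ℝ → ℝ≥0∞} (hf : Measurable f) :
    ∫⁻ t, f t ∂(expMeasure r) = ∫⁻ t, exponentialPDF r t * f t := by
  change ∫⁻ t, f t ∂(volume.withDensity (exponentialPDF r)) = _
  rw [lintegral_withDensity_eq_lintegral_mul _ (measurable_exponentialPDF r) hf]
  rfl

instance : NullSingletonClass (expMeasure r) := by
  change NullSingletonClass (volume.withDensity (exponentialPDF r))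
  infer_instance

theorem ae_expMeasure_pos (r : ℝ) : ∀ᵐ t ∂(expMeasure r), 0 < t := by
  have h : ∀ᵐ t ∂(expMeasure r), 0 ≤ t := by
    rw [ae_iff]
    simp only [not_le]
    change expMeasure r (Set.Iio 0) = 0
    rw [← lintegral_indicator_one measurableSet_Iio,
      lintegral_expMeasure r (measurable_one.indicator measurableSet_Iio)]
    refine lintegral_eq_zero_of_ae_eq_zero (ae_of_all _ fun t => ?_)
    by_cases ht : t < 0
    · simp [exponentialPDF_of_neg ht]
    · simp [ht]
  have h0 : ∀ᵐ t ∂(expMeasure r), t ≠ 0 := by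
    simp [ae_iff, measure_singleton]
  filter_upwards [h, h0] with t h h0
  exact lt_of_le_of_ne h h0.symm

/-- The exponential distribution is memoryless. -/
theorem lintegral_expMeasure_memoryless {v : ℝ} (hv : 0 ≤ v) {f : ℝ → ℝ≥0∞}
    (hf : Measurable f) :
    ∫⁻ t, (Set.Ioi v).indicator (fun t => f (t - v)) t ∂(expMeasure r) =
      ENNReal.ofReal (Real.exp (-(r * v))) * ∫⁻ t, f t ∂(expMeasure r) := by
  have h1 : Measurable ((Set.Ioi v).indicator (fun t => f (t - v))) :=
    (hf.comp (measurable_id.sub_const v)).indicator measurableSet_Ioi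
  have h2 : ∫⁻ t, f t ∂(expMeasure r) =
      ∫⁻ t, (Set.Ioi 0).indicator f t ∂(expMeasure r) := by
    refine lintegral_congr_ae ?_
    filter_upwards [ae_expMeasure_pos r] with t ht
    rw [Set.indicator_of_mem (Set.mem_Ioi.2 ht)]
  have h3 : Measurable fun t => exponentialPDF r t * (Set.Ioi 0).indicator f t :=
    (measurable_exponentialPDF r).mul (hf.indicator measurableSet_Ioi)
  rw [h2, lintegral_expMeasure r h1, lintegral_expMeasure r (hf.indicator measurableSet_Ioi),
    ← lintegral_const_mul _ h3,
    ← lintegral_add_right_eq_self (fun t => exponentialPDF r t *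
      (Set.Ioi v).indicator (fun t => f (t - v)) t) v]
  refine lintegral_congr fun t => ?_
  by_cases ht : 0 < t
  · rw [Set.indicator_of_mem (by simpa using ht), Set.indicator_of_mem (by simpa using ht),
      add_sub_cancel_right, ← mul_assoc, exponentialPDF_of_nonneg (by linarith),
      exponentialPDF_of_nonneg ht.le, ← ENNReal.ofReal_mul (Real.exp_pos _).le]
    congr 2
    rw [mul_left_comm, ← Real.exp_add]
    congr 2
    ring
  · rw [Set.indicator_of_notMem (by simpa using ht), Set.indicator_of_notMem (by simpa using ht)]
    simp

theorem expMeasure_Ioi [Fact (0 < r)] {v : ℝ} (hv : 0 ≤ v) :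
    expMeasure r (Set.Ioi v) = ENNReal.ofReal (Real.exp (-(r * v))) := by
  have h := lintegral_expMeasure_memoryless (r := r) hv (f := fun _ => 1) measurable_const
  rw [lintegral_const, measure_univ, mul_one, mul_one] at h
  rw [← h, ← lintegral_indicator_one measurableSet_Ioi]
  rfl

theorem expMeasure_Ici [Fact (0 < r)] {v : ℝ} (hv : 0 ≤ v) :
    expMeasure r (Set.Ici v) = ENNReal.ofReal (Real.exp (-(r * v))) := by
  rw [← expMeasure_Ioi hv]
  exact (measure_congr Ioi_ae_eq_Ici).symm

/-- The factor `exp (-(s * t))` turns the exponential density of rate `r` into `r / (r + s)` times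
that of rate `r + s`. -/
theorem lintegral_exp_neg_expMeasure [hr : Fact (0 < r)] {s : ℝ} (hs : 0 ≤ s) :
    ∫⁻ t, ENNReal.ofReal (Real.exp (-(s * t))) ∂(expMeasure r) = ENNReal.ofReal (r / (r + s)) := by
  have hr' := hr.out
  rw [lintegral_expMeasure r (by fun_prop)]
  have h1 := lintegral_exponentialPDF_eq_one (show 0 < r + s by linarith)
  rw [← mul_one (ENNReal.ofReal (r / (r + s))), ← h1,
    ← lintegral_const_mul _ (measurable_exponentialPDF _)]
  refine lintegral_congr fun t => ?_
  rcases lt_or_ge t 0 with ht | ht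
  · rw [exponentialPDF_of_neg ht, exponentialPDF_of_neg ht, zero_mul, mul_zero]
  · rw [exponentialPDF_of_nonneg ht, exponentialPDF_of_nonneg ht,
      ← ENNReal.ofReal_mul (mul_nonneg hr'.le (Real.exp_pos _).le),
      ← ENNReal.ofReal_mul (div_nonneg hr'.le (by linarith))]
    congr 1
    rw [mul_assoc, ← Real.exp_add, ← mul_assoc, div_mul_cancel₀ _ (by linarith)]
    congr 2
    ring

/-- By the layer-cake formula the mean is the integral of the tail, and the tail is the density
divided by `r`. -/
theorem lintegral_id_expMeasure [hr : Fact (0 < r)] :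
    ∫⁻ t, ENNReal.ofReal t ∂(expMeasure r) = ENNReal.ofReal (1 / r) := by
  have hr' := hr.out
  rw [lintegral_eq_lintegral_meas_lt _
    ((ae_expMeasure_pos r).mono fun t ht => ht.le) measurable_id.aemeasurable]
  have h1 : ∫⁻ t in Set.Ioi (0 : ℝ), expMeasure r {a | t < a} =
      ∫⁻ t in Set.Ioi (0 : ℝ), ENNReal.ofReal (1 / r) * exponentialPDF r t := by
    refine setLIntegral_congr_fun measurableSet_Ioi fun t ht => ?_
    have ht' : 0 ≤ t := (Set.mem_Ioi.1 ht).le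
    rw [exponentialPDF_of_nonneg ht', ← ENNReal.ofReal_mul (by positivity), ← mul_assoc,
      one_div_mul_cancel hr'.ne', one_mul]
    exact expMeasure_Ioi ht'
  rw [h1, lintegral_const_mul _ (measurable_exponentialPDF r), ← mul_one (ENNReal.ofReal (1 / r))]
  congr 1
  rw [mul_one]
  have h2 := lintegral_expMeasure r (f := (Set.Ioi (0 : ℝ)).indicator 1)
    (measurable_one.indicator measurableSet_Ioi)
  rw [lintegral_indicator_one measurableSet_Ioi, expMeasure_Ioi le_rfl] at h2
  simp only [mul_zero, neg_zero, Real.exp_zero, ENNReal.ofReal_one] at h2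
  rw [h2, ← lintegral_indicator measurableSet_Ioi]
  refine lintegral_congr fun t => ?_
  by_cases ht : t ∈ Set.Ioi (0 : ℝ) <;> simp [ht]

end Exponential

/-! ### The law of the input -/

/-- The sequence `g`, preceded by `t`. -/
def seqCons (t : ℝ) (g : ℕ → ℝ) : ℕ → ℝ
  | 0 => t
  | n + 1 => g n

theorem measurable_seqCons {α : Type*} [MeasurableSpace α] {t : α → ℝ} {g : α → ℕ → ℝ}
    (ht : Measurable t) (hg : Measurable g) : Measurable fun a => seqCons (t a) (g a) :=
  measurable_pi_iff.2 fun n => by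
    cases n with
    | zero => exact ht
    | succ n => exact (measurable_pi_apply n).comp hg

/-- Prepending an independent coordinate preserves an i.i.d. sequence, which is what permits
conditioning on the first gap or the first service. It is checked on boxes: padding with `univ`
makes the box depend on an initial segment of coordinates, from which coordinate `0` splits off. -/
theorem map_seqCons (ν : Measure ℝ) [IsProbabilityMeasure ν] :
    (ν.prod (Measure.infinitePi fun _ : ℕ => ν)).map (fun z => seqCons z.1 z.2) =
      Measure.infinitePi fun _ : ℕ => ν := by
  classical
  refine Measure.eq_infinitePi _ fun s t ht => ?_
  obtain ⟨N, hN⟩ : ∃ N, s ⊆ Finset.range (N + 1) :=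
    ⟨s.sup id, fun n hn => Finset.mem_range_succ_iff.2 (Finset.le_sup (f := id) hn)⟩
  set t' : ℕ → Set ℝ := fun n => if n ∈ s then t n else Set.univ with ht'
  have hm : ∀ n, MeasurableSet (t' n) := fun n => by
    simp only [ht']
    split_ifs
    · exact ht n
    · exact MeasurableSet.univ
  have h1 : (fun z : ℝ × (ℕ → ℝ) => seqCons z.1 z.2) ⁻¹' (s : Set ℕ).pi t =
      t' 0 ×ˢ ((Finset.range N : Set ℕ).pi fun n => t' (n + 1)) := by
    ext z
    simp only [Set.mem_preimage, Set.mem_pi, Finset.mem_coe, Set.mem_prod, Finset.mem_range, ht']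
    constructor
    · intro h
      refine ⟨?_, fun n _ => ?_⟩
      · split_ifs with h0
        · exact h 0 h0
        · trivial
      · split_ifs with h0
        · exact h (n + 1) h0
        · trivial
    · rintro ⟨h0, h⟩ n hn
      cases n with
      | zero => rwa [if_pos hn] at h0
      | succ n =>
        have := h n (by have := Finset.mem_range.1 (hN hn); omega)
        rwa [if_pos hn] at this
  rw [Measure.map_apply (measurable_seqCons measurable_fst measurable_snd)
    (MeasurableSet.pi s.countable_toSet fun n _ => ht n), h1, Measure.prod_prod,
    Measure.infinitePi_pi _ fun n _ => hm (n + 1), mul_comm,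
    ← Finset.prod_range_succ' (fun n => ν (t' n)) N]
  have h2 : ∏ n ∈ s, ν (t n) = ∏ n ∈ s, ν (t' n) :=
    Finset.prod_congr rfl fun n hn => by simp [ht', hn]
  rw [h2]
  exact (Finset.prod_subset hN fun n _ hn => by simp [ht', hn]).symm

/-- The law of the input: independent exponential inter-arrival times of rate `lam` and service
times of rate `mu`. -/
def inputLaw (lam mu : ℝ) [Fact (0 < lam)] [Fact (0 < mu)] : Measure Input :=
  ((Measure.infinitePi fun _ : ℕ => expMeasure lam).prod
    (Measure.infinitePi fun _ : ℕ => expMeasure mu)).map fun z => ⟨z.1, z.2⟩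

theorem measurable_mk_pair : Measurable fun z : (ℕ → ℝ) × (ℕ → ℝ) => Input.mk z.1 z.2 :=
  measurable_input_mk measurable_fst measurable_snd

/-- The input `y` with an additional first inter-arrival time `t`. -/
def Input.consGap (t : ℝ) (y : Input) : Input := ⟨seqCons t y.gap, y.service⟩

/-- The input `y` with an additional first service time `s`. -/
def Input.consService (s : ℝ) (y : Input) : Input := ⟨y.gap, seqCons s y.service⟩

theorem measurable_consGap {α : Type*} [MeasurableSpace α] {t : α → ℝ} {y : α → Input}
    (ht : Measurable t) (hy : Measurable y) : Measurable fun a => (y a).consGap (t a) :=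
  measurable_input_mk (measurable_seqCons ht (measurable_gap_service.fst.comp hy))
    (measurable_gap_service.snd.comp hy)

theorem measurable_consService {α : Type*} [MeasurableSpace α] {t : α → ℝ} {y : α → Input}
    (ht : Measurable t) (hy : Measurable y) : Measurable fun a => (y a).consService (t a) :=
  measurable_input_mk (measurable_gap_service.fst.comp hy)
    (measurable_seqCons ht (measurable_gap_service.snd.comp hy))

section Law

variable {lam mu : ℝ} [hlam : Fact (0 < lam)] [hmu : Fact (0 < mu)]

instance : IsProbabilityMeasure (inputLaw lam mu) :=
  Measure.isProbabilityMeasure_map measurable_mk_pair.aemeasurable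

theorem lintegral_inputLaw {f : Input → ℝ≥0∞} (hf : Measurable f) :
    ∫⁻ x, f x ∂(inputLaw lam mu) =
      ∫⁻ g, ∫⁻ s, f ⟨g, s⟩ ∂(Measure.infinitePi fun _ : ℕ => expMeasure mu)
        ∂(Measure.infinitePi fun _ : ℕ => expMeasure lam) := by
  rw [inputLaw, lintegral_map hf measurable_mk_pair]
  exact lintegral_prod _ (hf.comp measurable_mk_pair).aemeasurable

theorem lintegral_seqCons (ν : Measure ℝ) [IsProbabilityMeasure ν] {f : (ℕ → ℝ) → ℝ≥0∞}
    (hf : Measurable f) :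
    ∫⁻ g, f g ∂(Measure.infinitePi fun _ : ℕ => ν) =
      ∫⁻ t, ∫⁻ g, f (seqCons t g) ∂(Measure.infinitePi fun _ : ℕ => ν) ∂ν := by
  have hm := measurable_seqCons (α := ℝ × (ℕ → ℝ)) measurable_fst measurable_snd
  conv_lhs => rw [← map_seqCons ν]
  rw [lintegral_map hf hm]
  exact lintegral_prod _ (hf.comp hm).aemeasurable

theorem lintegral_consGap {f : Input → ℝ≥0∞} (hf : Measurable f) :
    ∫⁻ x, f x ∂(inputLaw lam mu) =
      ∫⁻ t, ∫⁻ y, f (y.consGap t) ∂(inputLaw lam mu) ∂(expMeasure lam) := by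
  rw [lintegral_inputLaw hf, lintegral_seqCons (expMeasure lam)
    (Measurable.lintegral_prod_right' (f := fun z : (ℕ → ℝ) × (ℕ → ℝ) => f ⟨z.1, z.2⟩)
      (hf.comp measurable_mk_pair))]
  refine lintegral_congr fun t => ?_
  exact (lintegral_inputLaw (hf.comp (measurable_consGap measurable_const measurable_id))).symm

theorem lintegral_consService {f : Input → ℝ≥0∞} (hf : Measurable f) :
    ∫⁻ x, f x ∂(inputLaw lam mu) =
      ∫⁻ t, ∫⁻ y, f (y.consService t) ∂(inputLaw lam mu) ∂(expMeasure mu) := by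
  rw [lintegral_inputLaw hf]
  have h1 : ∀ g, ∫⁻ s, f ⟨g, s⟩ ∂(Measure.infinitePi fun _ : ℕ => expMeasure mu) =
      ∫⁻ t, ∫⁻ s, f ⟨g, seqCons t s⟩ ∂(Measure.infinitePi fun _ : ℕ => expMeasure mu)
        ∂(expMeasure mu) := fun g =>
    lintegral_seqCons (expMeasure mu)
      (f := fun s => f ⟨g, s⟩) (hf.comp (measurable_input_mk measurable_const measurable_id))
  simp only [h1]
  rw [lintegral_lintegral_swap]
  · refine lintegral_congr fun t => ?_
    exact (lintegral_inputLaw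
      (hf.comp (measurable_consService measurable_const measurable_id))).symm
  · refine (Measurable.lintegral_prod_right' (f := fun z : ((ℕ → ℝ) × ℝ) × (ℕ → ℝ) =>
      f ⟨z.1.1, seqCons z.1.2 z.2⟩) (hf.comp ?_)).aemeasurable
    exact measurable_input_mk measurable_fst.fst (measurable_seqCons measurable_fst.snd
      measurable_snd)

theorem Input.arrivalTime_consGap_zero (t : ℝ) (y : Input) :
    (y.consGap t).arrivalTime 0 = t := by
  rw [Input.arrivalTime_zero]; rfl

theorem Input.arrivalTime_consGap_succ (t : ℝ) (y : Input) (n : ℕ) :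
    (y.consGap t).arrivalTime (n + 1) = t + y.arrivalTime n := by
  induction n with
  | zero =>
    rw [Input.arrivalTime_succ, y.arrivalTime_consGap_zero, y.arrivalTime_zero]; rfl
  | succ n ih =>
    rw [Input.arrivalTime_succ, ih, y.arrivalTime_succ, add_assoc]; rfl

/-- The Laplace transform of a sum of `n + 1` independent exponential gaps. With `s = 1` it excludes
infinitely many arrivals in finite time; with `s = mu` it is the probability that `n + 1` packets
arrive during a service. -/
theorem lintegral_exp_neg_arrivalTime {s : ℝ} (hs : 0 ≤ s) (n : ℕ) :
    ∫⁻ x, ENNReal.ofReal (Real.exp (-(s * x.arrivalTime n))) ∂(inputLaw lam mu) =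
      ENNReal.ofReal ((lam / (lam + s)) ^ (n + 1)) := by
  have hm : ∀ n, Measurable fun x : Input =>
      ENNReal.ofReal (Real.exp (-(s * x.arrivalTime n))) := fun n =>
    (Real.measurable_exp.comp ((Input.measurable_arrivalTime n).const_mul s).neg).ennreal_ofReal
  have h0 : 0 ≤ lam / (lam + s) := div_nonneg hlam.out.le (by linarith [hlam.out])
  induction n with
  | zero =>
    rw [lintegral_consGap (hm 0)]
    simp only [Input.arrivalTime_consGap_zero, lintegral_const, measure_univ, mul_one, zero_add,
      pow_one]
    exact lintegral_exp_neg_expMeasure hs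
  | succ n ih =>
    rw [lintegral_consGap (hm (n + 1))]
    simp only [Input.arrivalTime_consGap_succ, mul_add, neg_add, Real.exp_add,
      ENNReal.ofReal_mul (Real.exp_pos _).le]
    simp only [lintegral_const_mul _ (hm n), ih]
    rw [lintegral_mul_const _ (by fun_prop), lintegral_exp_neg_expMeasure hs,
      ← ENNReal.ofReal_mul h0, ← pow_succ']

theorem map_gap (n : ℕ) : (inputLaw lam mu).map (fun x => x.gap n) = expMeasure lam := by
  rw [inputLaw, Measure.map_map (Input.measurable_gap n) measurable_mk_pair]
  have : ((fun x : Input => x.gap n) ∘ fun z : (ℕ → ℝ) × (ℕ → ℝ) => Input.mk z.1 z.2) =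
    (fun g : ℕ → ℝ => g n) ∘ Prod.fst := rfl
  rw [this, ← Measure.map_map (measurable_pi_apply n) measurable_fst, Measure.map_fst_prod,
    measure_univ, one_smul]
  exact Measure.infinitePi_map_eval _ n

theorem map_service (n : ℕ) : (inputLaw lam mu).map (fun x => x.service n) = expMeasure mu := by
  rw [inputLaw, Measure.map_map (Input.measurable_service n) measurable_mk_pair]
  have : ((fun x : Input => x.service n) ∘ fun z : (ℕ → ℝ) × (ℕ → ℝ) => Input.mk z.1 z.2) =
    (fun g : ℕ → ℝ => g n) ∘ Prod.snd := rfl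
  rw [this, ← Measure.map_map (measurable_pi_apply n) measurable_snd, Measure.map_snd_prod,
    measure_univ, one_smul]
  exact Measure.infinitePi_map_eval _ n

theorem ae_regular : ∀ᵐ x ∂(inputLaw lam mu), x.Regular := by
  have hg : ∀ᵐ x ∂(inputLaw lam mu), ∀ n, 0 < x.gap n := by
    refine ae_all_iff.2 fun n => ?_
    have h := ae_expMeasure_pos lam
    rw [← map_gap (lam := lam) (mu := mu) n] at h
    exact ae_of_ae_map (Input.measurable_gap n).aemeasurable h
  have hs : ∀ᵐ x ∂(inputLaw lam mu), ∀ n, 0 < x.service n := by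
    refine ae_all_iff.2 fun n => ?_
    have h := ae_expMeasure_pos mu
    rw [← map_service (lam := lam) (mu := mu) n] at h
    exact ae_of_ae_map (Input.measurable_service n).aemeasurable h
  have hm0 : ∀ n, Measurable fun x : Input =>
      ENNReal.ofReal (Real.exp (-(1 * Input.arrivalTime x n))) := fun n =>
    (Real.measurable_exp.comp ((Input.measurable_arrivalTime n).const_mul 1).neg).ennreal_ofReal
  -- The expectations of `exp (-T n)`, with `T n` the `n`-th arrival time, form a convergent
  -- geometric series. Hence `exp (-T n)` is almost surely summable, tends to `0`, and `T n` tends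
  -- to infinity.
  have hsum : ∫⁻ x, ∑' n, ENNReal.ofReal (Real.exp (-(1 * Input.arrivalTime x n)))
      ∂(inputLaw lam mu) ≠ ∞ := by
    rw [lintegral_tsum fun n => (hm0 n).aemeasurable]
    simp only [lintegral_exp_neg_arrivalTime zero_le_one]
    have h0 : 0 ≤ lam / (lam + 1) := div_nonneg hlam.out.le (by linarith [hlam.out])
    have h1 : lam / (lam + 1) < 1 := (div_lt_one (by linarith [hlam.out])).2 (by linarith)
    rw [← ENNReal.ofReal_tsum_of_nonneg (fun n => pow_nonneg h0 _)
      ((summable_nat_add_iff 1).2 (summable_geometric_of_lt_one h0 h1))]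
    exact ENNReal.ofReal_ne_top
  have hm : Measurable fun x : Input =>
      ∑' n, ENNReal.ofReal (Real.exp (-(1 * Input.arrivalTime x n))) :=
    Measurable.tsum hm0
  filter_upwards [hg, hs, ae_lt_top hm hsum] with x h1 h2 h3
  refine ⟨h1, h2, ?_⟩
  have h4 := ENNReal.tendsto_atTop_zero_of_tsum_ne_top h3.ne
  have h5 := (ENNReal.tendsto_toReal ENNReal.zero_ne_top).comp h4
  simp only [Function.comp_def, ENNReal.toReal_ofReal (Real.exp_pos _).le, one_mul,
    ENNReal.toReal_zero] at h5
  exact tendsto_neg_atBot_iff.1 (Real.tendsto_exp_comp_nhds_zero.1 h5)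

end Law

/-! ### Regeneration -/

section Splits

variable {Z E : Type*} [MeasurableSpace Z] [MeasurableSpace E] {M : Measure Z}

/-- Whatever the value of `f`, the map `g` has the law `M`. -/
def Splits (M : Measure Z) (f : Z → E) (g : Z → Z) : Prop :=
  ∀ F : E × Z → ℝ≥0∞, Measurable F →
    ∫⁻ x, F (f x, g x) ∂M = ∫⁻ x, ∫⁻ y, F (f x, y) ∂M ∂M

theorem Splits.comp {E' : Type*} [MeasurableSpace E'] {f : Z → E} {g : Z → Z}
    (h : Splits M f g) {φ : E → E'} (hφ : Measurable φ) : Splits M (fun x => φ (f x)) g :=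
  fun F hF => h (fun z => F (φ z.1, z.2))
    (hF.comp ((hφ.comp measurable_fst).prodMk measurable_snd))

theorem Splits.congr {f f' : Z → E} {g g' : Z → Z} (h : Splits M f g) (hf : f =ᵐ[M] f')
    (hg : g =ᵐ[M] g') : Splits M f' g' := fun F hF => by
  rw [← lintegral_congr_ae (f := fun x => F (f x, g x)), h F hF]
  · exact lintegral_congr_ae (hf.mono fun x hx => by simp only [hx])
  · filter_upwards [hf, hg] with x h1 h2
    rw [h1, h2]

theorem Splits.measurePreserving [IsProbabilityMeasure M] {f : Z → E} {g : Z → Z}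
    (h : Splits M f g) (hg : Measurable g) : MeasurePreserving g M M := by
  refine ⟨hg, Measure.ext fun B hB => ?_⟩
  have h1 := h (fun z => B.indicator 1 z.2) ((measurable_one.indicator hB).comp measurable_snd)
  simp only [lintegral_const, measure_univ, mul_one, lintegral_indicator_one hB] at h1
  rw [← lintegral_indicator_one hB, lintegral_map (measurable_one.indicator hB) hg, h1]

theorem Splits.indepFun [IsProbabilityMeasure M] {f : Z → E} {g : Z → Z} (h : Splits M f g)
    (hf : Measurable f) (hg : Measurable g) : IndepFun f g M := by
  rw [indepFun_iff_measure_inter_preimage_eq_mul]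
  intro A B hA hB
  have h1 := h (fun z => (A ×ˢ B).indicator 1 z) (measurable_one.indicator (hA.prod hB))
  have h2 : ∀ (a : E) (y : Z), (A ×ˢ B).indicator (1 : E × Z → ℝ≥0∞) (a, y) =
      A.indicator 1 a * B.indicator 1 y := fun a y => by
    by_cases h1 : a ∈ A <;> by_cases h2 : y ∈ B <;> simp [h1, h2]
  have hB' : Measurable (B.indicator (1 : Z → ℝ≥0∞)) := measurable_one.indicator hB
  simp only [h2, lintegral_const_mul _ hB', lintegral_indicator_one hB] at h1
  have h3 : ∀ x, A.indicator (1 : E → ℝ≥0∞) (f x) = (f ⁻¹' A).indicator 1 x := fun x => rfl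
  have h4 : ∀ x, B.indicator (1 : Z → ℝ≥0∞) (g x) = (g ⁻¹' B).indicator 1 x := fun x => rfl
  simp only [h3, h4] at h1
  rw [lintegral_mul_const _ (measurable_one.indicator (hf hA)), lintegral_indicator_one (hf hA),
    ← (h.measurePreserving hg).measure_preimage hB.nullMeasurableSet] at h1
  rw [← h1, ← lintegral_indicator_one ((hf hA).inter (hg hB)), Set.inter_indicator_one]
  rfl

/-- A Markov chain driven by a regenerating input: `st` gives the next state and `nx` the
remaining input. -/
def splitChain (y₀ : E) (st : E × Z → E) (nx : E × Z → Z) : ℕ → Z → E × Z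
  | 0, z => (y₀, z)
  | m + 1, z => (st (splitChain y₀ st nx m z), nx (splitChain y₀ st nx m z))

/-- The induction hypothesis replaces the remaining input by an independent copy, the hypothesis on
single steps applies with the state frozen, and the induction hypothesis read backwards restores the
chain. -/
theorem splits_splitChain [IsProbabilityMeasure M] {y₀ : E} {st : E × Z → E} {nx : E × Z → Z}
    (hst : Measurable st) (hnx : Measurable nx)
    (h : ∀ y, Splits M (fun z => st (y, z)) (fun z => nx (y, z))) (m : ℕ) :
    Splits M (fun z => (splitChain y₀ st nx m z).1) (fun z => (splitChain y₀ st nx m z).2) := by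
  induction m with
  | zero =>
    intro F _
    simp [splitChain]
  | succ m ih =>
    intro F hF
    have h1 : Measurable fun w : E × Z => F (st w, nx w) := hF.comp (hst.prodMk hnx)
    have h2 : Measurable fun w : E × Z => ∫⁻ y, F (st w, y) ∂M :=
      Measurable.lintegral_prod_right' (f := fun v : (E × Z) × Z => F (st v.1, v.2))
        (hF.comp ((hst.comp measurable_fst).prodMk measurable_snd))
    calc ∫⁻ x, F (st (splitChain y₀ st nx m x), nx (splitChain y₀ st nx m x)) ∂M
        = ∫⁻ x, ∫⁻ w, F (st ((splitChain y₀ st nx m x).1, w),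
            nx ((splitChain y₀ st nx m x).1, w)) ∂M ∂M := ih _ h1
      _ = ∫⁻ x, ∫⁻ w, ∫⁻ y, F (st ((splitChain y₀ st nx m x).1, w), y) ∂M ∂M ∂M :=
          lintegral_congr fun x => h _ F hF
      _ = ∫⁻ x, ∫⁻ y, F (st (splitChain y₀ st nx m x), y) ∂M ∂M := (ih _ h2).symm

theorem lintegral_eq_tsum_indicator {N : Z → ℕ} (hN : Measurable N) {f : Z → ℝ≥0∞}
    (hf : Measurable f) : ∫⁻ x, f x ∂M = ∑' n, ∫⁻ x, {x | N x = n}.indicator f x ∂M := by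
  have hn : ∀ n, MeasurableSet {x | N x = n} := fun n => hN (measurableSet_singleton n)
  rw [← lintegral_tsum fun n => (hf.indicator (hn n)).aemeasurable]
  refine lintegral_congr fun x => ?_
  rw [tsum_eq_single (N x) fun n hn => Set.indicator_of_notMem (fun h => hn h.symm) _]
  exact (Set.indicator_of_mem (s := {y | N y = N x}) rfl f).symm

end Splits

/-! ### The arrivals after a fixed time -/

/-- The arrival times up to time `e`. -/
def Input.gapPast (x : Input) (e : ℝ) (n : ℕ) : ℝ :=
  if x.arrivalTime n ≤ e then x.arrivalTime n else e + 1

theorem measurable_gapPast {α : Type*} [MeasurableSpace α] {x : α → Input} (hx : Measurable x)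
    {e : α → ℝ} (he : Measurable e) : Measurable fun a => (x a).gapPast (e a) :=
  measurable_pi_iff.2 fun n => Measurable.ite
    (measurableSet_le ((Input.measurable_arrivalTime n).comp hx) he)
    ((Input.measurable_arrivalTime n).comp hx) (he.add_const 1)

section ConsGap

variable {t e : ℝ} {y : Input}

theorem Input.Regular.consGap (hy : y.Regular) (ht : 0 < t) : (y.consGap t).Regular where
  gap_pos n := by
    cases n with
    | zero => exact ht
    | succ n => exact hy.gap_pos n
  service_pos n := hy.service_pos n
  tendsto_arrivalTime := by
    rw [← tendsto_add_atTop_iff_nat 1]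
    simp only [Input.arrivalTime_consGap_succ]
    exact tendsto_atTop_add_const_left _ _ hy.tendsto_arrivalTime

theorem Input.Regular.arrivals_consGap_of_lt (hy : y.Regular) (ht : 0 < t) (he : e < t) :
    (y.consGap t).arrivals e = 0 := by
  rwa [← Nat.le_zero, (hy.consGap ht).arrivals_le_iff, Input.arrivalTime_consGap_zero]

theorem Input.Regular.arrivals_consGap_of_le (hy : y.Regular) (ht : 0 < t) (he : t ≤ e) :
    (y.consGap t).arrivals e = y.arrivals (e - t) + 1 := by
  refine eq_of_forall_lt_iff fun n => ?_
  rw [(hy.consGap ht).lt_arrivals_iff]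
  cases n with
  | zero => simpa [Input.arrivalTime_consGap_zero] using he
  | succ n =>
    rw [Input.arrivalTime_consGap_succ, Nat.add_lt_add_iff_right, hy.lt_arrivals_iff,
      le_sub_iff_add_le']

theorem Input.Regular.gapPast_consGap_of_lt (hy : y.Regular) (ht : 0 < t) (he : e < t) :
    (y.consGap t).gapPast e = fun _ => e + 1 := by
  funext n
  refine if_neg (not_le.2 (he.trans_le ?_))
  have h := (hy.consGap ht).strictMono_arrivalTime.monotone n.zero_le
  rwa [y.arrivalTime_consGap_zero] at h

theorem Input.gapPast_consGap_of_le (he : t ≤ e) :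
    (y.consGap t).gapPast e = seqCons t fun n => t + y.gapPast (e - t) n := by
  funext n
  cases n with
  | zero => simp [Input.gapPast, Input.arrivalTime_consGap_zero, seqCons, he]
  | succ n =>
    simp only [Input.gapPast, Input.arrivalTime_consGap_succ, seqCons, le_sub_iff_add_le']
    split_ifs <;> ring

theorem Input.Regular.shift_consGap_of_lt (hy : y.Regular) (ht : 0 < t) (he : e < t) :
    (y.consGap t).shift e 0 = y.consGap (t - e) := by
  simp only [Input.shift, hy.arrivals_consGap_of_lt ht he, Input.arrivalTime_consGap_zero,
    zero_add]
  refine congrArg₂ Input.mk ?_ rfl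
  funext n
  cases n <;> rfl

theorem Input.Regular.shift_consGap_of_le (hy : y.Regular) (ht : 0 < t) (he : t ≤ e) :
    (y.consGap t).shift e 0 = y.shift (e - t) 0 := by
  simp only [Input.shift, hy.arrivals_consGap_of_le ht he, Input.arrivalTime_consGap_succ,
    Input.mk.injEq]
  refine ⟨?_, rfl⟩
  funext n
  cases n with
  | zero => simp only; ring
  | succ n => simp [Input.consGap, Nat.add_right_comm _ 1, seqCons]

end ConsGap

section Law

variable {lam mu : ℝ} [hlam : Fact (0 < lam)] [hmu : Fact (0 < mu)]

/-- Induction on the number of arrivals up to `e`, conditioning on the first gap `t`. With none, `t`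
exceeds `e` and by memorylessness `t - e` is a fresh first gap. Otherwise `t ≤ e`, and the claim
follows from the one for the remaining input with one arrival fewer and horizon `e - t`. -/
theorem lintegral_shift_of_arrivals_eq (n : ℕ) {e : ℝ} (he : 0 ≤ e)
    {F : (ℕ → ℝ) × Input → ℝ≥0∞} (hF : Measurable F) :
    ∫⁻ x, {x | x.arrivals e = n}.indicator (fun x => F (x.gapPast e, x.shift e 0)) x
        ∂(inputLaw lam mu) =
      ∫⁻ x, {x | x.arrivals e = n}.indicator
        (fun x => ∫⁻ y, F (x.gapPast e, y) ∂(inputLaw lam mu)) x ∂(inputLaw lam mu) := by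
  have hN : ∀ n e, MeasurableSet {x : Input | x.arrivals e = n} := fun n e =>
    measurable_arrivals measurable_id measurable_const (measurableSet_singleton n)
  have hL : ∀ (F : (ℕ → ℝ) × Input → ℝ≥0∞) (_ : Measurable F) (n : ℕ) (e : ℝ),
      Measurable ({x : Input | x.arrivals e = n}.indicator
        (fun x => F (x.gapPast e, x.shift e 0))) := fun F hF n e =>
    (hF.comp ((measurable_gapPast measurable_id measurable_const).prodMk
      (measurable_shift measurable_id measurable_const measurable_const))).indicator (hN n e)
  have hR : ∀ (F : (ℕ → ℝ) × Input → ℝ≥0∞) (_ : Measurable F) (n : ℕ) (e : ℝ),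
      Measurable ({x : Input | x.arrivals e = n}.indicator
        (fun x => ∫⁻ y, F (x.gapPast e, y) ∂(inputLaw lam mu))) := fun F hF n e =>
    ((Measurable.lintegral_prod_right' hF).comp
      (measurable_gapPast measurable_id measurable_const)).indicator (hN n e)
  induction n generalizing e F with
  | zero =>
    rw [lintegral_consGap (hL F hF 0 e), lintegral_consGap (hR F hF 0 e)]
    set f : ℝ → ℝ≥0∞ := fun u => ∫⁻ y, F (fun _ => e + 1, y.consGap u) ∂(inputLaw lam mu) with hf
    have hFm : Measurable fun y => F (fun _ => e + 1, y) :=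
      hF.comp (measurable_const.prodMk measurable_id)
    have hfm : Measurable f :=
      Measurable.lintegral_prod_right' (f := fun z : ℝ × Input => F (fun _ => e + 1, z.2.consGap z.1))
        (hFm.comp (measurable_consGap measurable_fst measurable_snd))
    have h1 := lintegral_expMeasure_memoryless (r := lam) he hfm
    have h2 := lintegral_expMeasure_memoryless (r := lam) he
      (f := fun _ => ∫⁻ u, f u ∂(expMeasure lam)) measurable_const
    rw [lintegral_const, measure_univ, mul_one] at h2
    have h3 : ∫⁻ u, f u ∂(expMeasure lam) =
        ∫⁻ y, F (fun _ => e + 1, y) ∂(inputLaw lam mu) := (lintegral_consGap hFm).symm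
    trans ∫⁻ t, (Set.Ioi e).indicator (fun t => f (t - e)) t ∂(expMeasure lam)
    · refine lintegral_congr_ae ((ae_expMeasure_pos lam).mono fun t ht => ?_)
      by_cases hte : e < t
      · rw [Set.indicator_of_mem (Set.mem_Ioi.2 hte)]
        refine lintegral_congr_ae (ae_regular.mono fun y hy => ?_)
        simp only [Set.indicator_apply, Set.mem_ofPred_eq, hy.arrivals_consGap_of_lt ht hte,
          hy.gapPast_consGap_of_lt ht hte, hy.shift_consGap_of_lt ht hte, if_true]
      · rw [Set.indicator_of_notMem (by simpa using hte)]
        refine lintegral_eq_zero_of_ae_eq_zero (ae_regular.mono fun y hy => ?_)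
        simp [hy.arrivals_consGap_of_le ht (not_lt.1 hte)]
    rw [h1, ← h2]
    refine lintegral_congr_ae ((ae_expMeasure_pos lam).mono fun t ht => ?_)
    by_cases hte : e < t
    · simp only
      rw [Set.indicator_of_mem (Set.mem_Ioi.2 hte), h3]
      have : ∫⁻ y, F (fun _ => e + 1, y) ∂(inputLaw lam mu) = ∫⁻ _ : Input,
          ∫⁻ y, F (fun _ => e + 1, y) ∂(inputLaw lam mu) ∂(inputLaw lam mu) := by
        rw [lintegral_const, measure_univ, mul_one]
      rw [this]
      refine lintegral_congr_ae (ae_regular.mono fun y hy => ?_)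
      simp only [Set.indicator_apply, Set.mem_ofPred_eq, hy.arrivals_consGap_of_lt ht hte,
        hy.gapPast_consGap_of_lt ht hte, if_true]
    · simp only
      rw [Set.indicator_of_notMem (by simpa using hte)]
      refine (lintegral_eq_zero_of_ae_eq_zero (ae_regular.mono fun y hy => ?_)).symm
      simp [hy.arrivals_consGap_of_le ht (not_lt.1 hte)]
  | succ n ih =>
    rw [lintegral_consGap (hL F hF (n + 1) e), lintegral_consGap (hR F hF (n + 1) e)]
    refine lintegral_congr_ae ((ae_expMeasure_pos lam).mono fun t ht => ?_)
    simp only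
    by_cases hte : e < t
    · rw [lintegral_eq_zero_of_ae_eq_zero (ae_regular.mono fun y hy => ?_),
        lintegral_eq_zero_of_ae_eq_zero (ae_regular.mono fun y hy => ?_)]
      · simp [hy.arrivals_consGap_of_lt ht hte]
      · simp [hy.arrivals_consGap_of_lt ht hte]
    · have hte' := not_lt.1 hte
      -- The past up to `e` is rebuilt from the past of the remaining input: its times are delayed
      -- by `t`, and `t` is prepended.
      have hFt : Measurable fun z : (ℕ → ℝ) × Input =>
          F (seqCons t fun n => t + z.1 n, z.2) :=
        hF.comp ((measurable_seqCons measurable_const (measurable_pi_iff.2 fun n =>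
          ((measurable_pi_apply n).comp measurable_fst).const_add t)).prodMk measurable_snd)
      have h1 := ih (sub_nonneg.2 hte') hFt
      rw [lintegral_congr_ae, h1]
      · refine lintegral_congr_ae (ae_regular.mono fun y hy => ?_)
        simp only [Set.indicator_apply, Set.mem_ofPred_eq, hy.arrivals_consGap_of_le ht hte',
          Input.gapPast_consGap_of_le hte', Nat.add_right_cancel_iff]
      · refine ae_regular.mono fun y hy => ?_
        simp only [Set.indicator_apply, Set.mem_ofPred_eq, hy.arrivals_consGap_of_le ht hte',
          Input.gapPast_consGap_of_le hte', hy.shift_consGap_of_le ht hte',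
          Nat.add_right_cancel_iff]

/-- The input after a fixed time has the original law, whatever happened before. -/
theorem splits_shift {e : ℝ} (he : 0 ≤ e) :
    Splits (inputLaw lam mu) (fun x => x.gapPast e) fun x => x.shift e 0 := fun F hF => by
  have hN : Measurable fun x : Input => x.arrivals e :=
    measurable_arrivals measurable_id measurable_const
  rw [lintegral_eq_tsum_indicator hN, lintegral_eq_tsum_indicator hN]
  · exact tsum_congr fun n => lintegral_shift_of_arrivals_eq n he hF
  · exact (Measurable.lintegral_prod_right' hF).comp
      (measurable_gapPast measurable_id measurable_const)
  · exact hF.comp ((measurable_gapPast measurable_id measurable_const).prodMk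
      (measurable_shift measurable_id measurable_const measurable_const))

/-! ### One phase -/

/-- The number of services in a phase. -/
def Mode.services : Mode → ℕ
  | Mode.vacation _ => 0
  | Mode.idle => 0
  | Mode.busy => 1

/-- The length of a phase. -/
def Params.duration (c : Params) (s : Mode) (x : Input) : ℝ :=
  match s with
  | Mode.vacation _ => c.Lv
  | Mode.idle => x.arrivalTime (x.arrivals 0)
  | Mode.busy => x.service 0

theorem Params.phaseEnd_freshPhase (c : Params) (s : Mode) (q : ℕ) (x : Input) :
    c.phaseEnd x (freshPhase s q) = c.duration s x := by
  cases s <;> simp [Params.phaseEnd, freshPhase, Params.duration]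

theorem Params.nextPhase_freshPhase_served (c : Params) (s : Mode) (q : ℕ) (x : Input) :
    (c.nextPhase x (freshPhase s q)).served = s.services := by
  cases s <;> simp [Params.nextPhase, freshPhase, Mode.services]

theorem measurable_duration (c : Params) {α : Type*} [MeasurableSpace α] {s : α → Mode}
    (hs : Measurable s) {x : α → Input} (hx : Measurable x) :
    Measurable fun a => c.duration (s a) (x a) := by
  refine measurable_of_mode hs (F := fun s a => c.duration s (x a)) fun s => ?_
  cases s with
  | vacation j => exact measurable_const
  | idle => exact measurable_arrivalTime hx (measurable_arrivals hx measurable_const)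
  | busy => exact (Input.measurable_service 0).comp hx

theorem Input.Regular.duration_idle {x : Input} (hx : x.Regular) (c : Params) :
    c.duration Mode.idle x = x.gap 0 := by
  rw [Params.duration, hx.arrivals_zero, x.arrivalTime_zero]

/-- A vacation has a fixed length. An idle phase lasts for the first gap, and the rest is literally
the input without that gap. A service has a length independent of the arrivals, so it can be frozen
and treated as a fixed time. -/
theorem splits_duration {c : Params} (hc : c.Proper) (s : Mode) :
    Splits (inputLaw lam mu) (fun x => (c.duration s x, x.gapPast (c.duration s x)))
      fun x => x.shift (c.duration s x) s.services := by
  cases s with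
  | vacation j =>
    exact (splits_shift hc.Lv_nonneg).comp (φ := fun h => (c.Lv, h))
      (measurable_const.prodMk measurable_id)
  | idle =>
    refine Splits.congr (f := fun x => (x.gap 0, x.gapPast (x.gap 0)))
      (g := fun x => x.shift (x.gap 0) 0) ?_
      (ae_regular.mono fun x hx => by simp only [hx.duration_idle])
      (ae_regular.mono fun x hx => by simp only [hx.duration_idle]; rfl)
    intro F hF
    have hg := Input.measurable_gap 0
    have hp := measurable_gapPast measurable_id hg
    refine (lintegral_consGap (hF.comp ((hg.prodMk hp).prodMk
        (measurable_shift measurable_id hg measurable_const)))).trans (Eq.trans ?_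
      (lintegral_consGap ((Measurable.lintegral_prod_right' hF).comp (hg.prodMk hp))).symm)
    refine lintegral_congr_ae ((ae_expMeasure_pos lam).mono fun t ht => ?_)
    -- At the first arrival the past is a function of `t` alone, all other entries being the marker
    -- `t + 1` for arrivals yet to come.
    have h1 : ∀ᵐ y ∂(inputLaw lam mu), (y.consGap t).gapPast t = seqCons t fun _ => t + 1 :=
      ae_regular.mono fun y hy => by
        funext n
        cases n with
        | zero => simp [Input.gapPast, seqCons, Input.arrivalTime_consGap_zero]
        | succ n =>
          refine if_neg ?_
          rw [Input.arrivalTime_consGap_succ]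
          linarith [hy.arrivalTime_pos n]
    trans ∫⁻ y, F ((t, seqCons t fun _ => t + 1), y) ∂(inputLaw lam mu)
    · refine lintegral_congr_ae ?_
      filter_upwards [h1, ae_regular] with y hy hr
      change F ((t, (y.consGap t).gapPast t), (y.consGap t).shift t 0) = _
      rw [hy, hr.shift_consGap_of_le ht le_rfl, sub_self, hr.shift_zero]
    · have h2 : ∀ᵐ y ∂(inputLaw lam mu),
          ∫⁻ x, F (((y.consGap t).gap 0, (y.consGap t).gapPast ((y.consGap t).gap 0)), x)
            ∂(inputLaw lam mu) =
          ∫⁻ x, F ((t, seqCons t fun _ => t + 1), x) ∂(inputLaw lam mu) :=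
        h1.mono fun y hy => by
          change ∫⁻ x, F ((t, (y.consGap t).gapPast t), x) ∂(inputLaw lam mu) = _
          rw [hy]
      refine Eq.trans ?_ (lintegral_congr_ae h2).symm
      rw [lintegral_const, measure_univ, mul_one]
  | busy =>
    intro F hF
    have hs := Input.measurable_service 0
    have hp := measurable_gapPast measurable_id hs
    refine (lintegral_consService (hF.comp ((hs.prodMk hp).prodMk
        (measurable_shift measurable_id hs measurable_const)))).trans (Eq.trans ?_
      (lintegral_consService ((Measurable.lintegral_prod_right' hF).comp (hs.prodMk hp))).symm)
    refine lintegral_congr_ae ((ae_expMeasure_pos mu).mono fun t ht => ?_)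
    have h1 := splits_shift (lam := lam) (mu := mu) ht.le (fun z => F ((t, z.1), z.2))
      (hF.comp ((measurable_const.prodMk measurable_fst).prodMk measurable_snd))
    refine Eq.trans (lintegral_congr fun y => ?_) h1
    change F ((t, y.gapPast t), (y.consService t).shift t 1) = F ((t, y.gapPast t), y.shift t 0)
    congr 2
    simp only [Input.shift, Input.consService, Input.mk.injEq]
    refine ⟨rfl, ?_⟩
    funext n
    rw [Nat.add_comm 1 n, Nat.zero_add]
    rfl

end Law

instance : DecidableEq Mode := Classical.decEq _

theorem measurable_integral_queueLength (c : Params) {α : Type*} [MeasurableSpace α]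
    {x : α → Input} (hx : Measurable x) {a b : α → ℝ} (ha : Measurable a) (hb : Measurable b) :
    Measurable fun z => ∫ t in (a z)..(b z), (c.queueLength (x z) t : ℝ) := by
  have h : ∀ {a b : α → ℝ}, Measurable a → Measurable b →
      Measurable fun z => ∫ t in Set.Ioc (a z) (b z), (c.queueLength (x z) t : ℝ) := by
    intro a b ha hb
    have h1 : Measurable fun w : α × ℝ => (Set.Ioc (a w.1) (b w.1)).indicator
        (fun t => (c.queueLength (x w.1) t : ℝ)) w.2 := by
      refine Measurable.ite (p := fun w : α × ℝ => w.2 ∈ Set.Ioc (a w.1) (b w.1)) ?_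
        ((measurable_from_top (f := fun n : ℕ => (n : ℝ))).comp
          (measurable_queueLength c (hx.comp measurable_fst) measurable_snd)) measurable_const
      exact (measurableSet_lt (ha.comp measurable_fst) measurable_snd).inter
        (measurableSet_le measurable_snd (hb.comp measurable_fst))
    have h2 := (h1.stronglyMeasurable.integral_prod_right' (ν := volume)).measurable
    simpa only [integral_indicator measurableSet_Ioc] using h2
  exact (h ha hb).sub (h hb ha)

theorem measurable_cycleTime (c : Params) (i : ℕ) : Measurable fun x => c.cycleTime x i :=
  measurable_integral_queueLength c measurable_id (measurable_cycleStart c i)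
    (measurable_cycleStart c (i + 1))

/-! ### The history at the starts of phases as a Markov chain -/

/-- The state after a phase with `N` arrivals. -/
def Params.nextState (c : Params) (s : Mode) (q N : ℕ) : Mode × ℕ :=
  let l := min (q + N) c.K
  match s with
  | Mode.vacation j => (if l = 0 then c.emptyMode (j + 1) else Mode.busy, l)
  | Mode.idle => (Mode.busy, l)
  | Mode.busy => (if l - 1 = 0 then c.emptyMode 0 else Mode.busy, l - 1)

/-- Of all the arrivals in a phase the next state depends only on their number, so it is a function
of the past that `splits_duration` separates from the remaining input. -/
theorem Params.nextState_eq (c : Params) {x : Input} (hx : x.Regular) (s : Mode) (q : ℕ) :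
    ((c.nextPhase x (freshPhase s q)).mode, (c.nextPhase x (freshPhase s q)).queue) =
      c.nextState s q (x.arrivals (c.duration s x)) := by
  rw [← c.phaseEnd_freshPhase s q x]
  have hl : ∀ e, c.level x (freshPhase s q) e = min (q + x.arrivals e) c.K := fun e => by
    simp [Params.level, freshPhase, hx.arrivals_zero]
  cases s with
  | vacation j => simp only [Params.nextPhase, Params.nextState, hl]; rfl
  | idle => simp only [Params.nextPhase, Params.nextState, hl]; rfl
  | busy => simp only [Params.nextPhase, Params.nextState, hl]; rfl

theorem Params.phaseTime_eq (c : Params) (s : Mode) (q : ℕ) (x : Input) :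
    c.phaseTime s q x = q * c.duration s x +
      ∑ n ∈ Finset.range (c.K - q), max (c.duration s x - x.arrivalTime n) 0 := by
  rw [Params.phaseTime, c.phaseEnd_freshPhase]

theorem measurable_phaseTime (c : Params) {α : Type*} [MeasurableSpace α] {s : α → Mode}
    (hs : Measurable s) {q : α → ℕ} (hq : Measurable q) {x : α → Input} (hx : Measurable x) :
    Measurable fun a => c.phaseTime (s a) (q a) (x a) := by
  refine measurable_index hq (F := fun q a => c.phaseTime (s a) q (x a)) fun q => ?_
  simp only [c.phaseTime_eq]
  have hd := measurable_duration c hs hx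
  exact (hd.const_mul _).add (Finset.measurable_sum _ fun n _ =>
    (hd.sub ((Input.measurable_arrivalTime n).comp hx)).max measurable_const)

/-- The mode, the queue, the number of cycles completed, the time spent by packets in the system
and the number of arrivals at the start of a phase. -/
abbrev History := (Mode × ℕ) × ℕ × ℝ × ℕ

/-- The history at the end of a phase of length `p.1` with the arrival times `p.2`. -/
def Params.updateHistory (c : Params) (y : History) (p : ℝ × (ℕ → ℝ)) : History :=
  let N := {n | p.2 n ≤ p.1}.ncard
  (c.nextState y.1.1 y.1.2 N,
    y.2.1 + (if (c.nextState y.1.1 y.1.2 N).1 = c.emptyMode 0 then 1 else 0),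
    y.2.2.1 + (y.1.2 * p.1 + ∑ n ∈ Finset.range (c.K - y.1.2), max (p.1 - p.2 n) 0),
    y.2.2.2 + N)

theorem measurable_updateHistory (c : Params) :
    Measurable fun z : History × (ℝ × (ℕ → ℝ)) => c.updateHistory z.1 z.2 := by
  have hp : ∀ n, Measurable fun z : History × (ℝ × (ℕ → ℝ)) => z.2.2 n := fun n =>
    (measurable_pi_apply n).comp measurable_snd.snd
  have hd : Measurable fun z : History × (ℝ × (ℕ → ℝ)) => z.2.1 := measurable_snd.fst
  have hN : Measurable fun z : History × (ℝ × (ℕ → ℝ)) => {n | z.2.2 n ≤ z.2.1}.ncard :=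
    measurable_ncard fun n => measurableSet_le (hp n) hd
  have hq : Measurable fun z : History × (ℝ × (ℕ → ℝ)) => z.1.1.2 := measurable_fst.fst.snd
  have hs : Measurable fun z : History × (ℝ × (ℕ → ℝ)) =>
      c.nextState z.1.1.1 z.1.1.2 {n | z.2.2 n ≤ z.2.1}.ncard :=
    (Measurable.of_discrete (f := fun w : Mode × ℕ × ℕ => c.nextState w.1 w.2.1 w.2.2)).comp
      (measurable_fst.fst.fst.prodMk (hq.prodMk hN))
  refine hs.prodMk ((measurable_fst.snd.fst.add ?_).prodMk
    ((measurable_fst.snd.snd.fst.add ?_).prodMk (measurable_fst.snd.snd.snd.add hN)))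
  · exact (Measurable.of_discrete
      (f := fun w : Mode => if w = c.emptyMode 0 then 1 else 0)).comp hs.fst
  · exact measurable_index hq (F := fun q (z : History × (ℝ × (ℕ → ℝ))) =>
      q * z.2.1 + ∑ n ∈ Finset.range (c.K - q), max (z.2.1 - z.2.2 n) 0) fun q =>
      (hd.const_mul _).add (Finset.measurable_sum _ fun n _ =>
        (hd.sub (hp n)).max measurable_const)

/-- The marker `d + 1` for later arrivals exceeds `d`, so it affects neither the count nor the
positive parts: the past alone determines the update. -/
theorem Params.updateHistory_gapPast (c : Params) (y : History) (x : Input) (d : ℝ) :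
    c.updateHistory y (d, x.gapPast d) =
      (c.nextState y.1.1 y.1.2 (x.arrivals d),
        y.2.1 + (if (c.nextState y.1.1 y.1.2 (x.arrivals d)).1 = c.emptyMode 0 then 1 else 0),
        y.2.2.1 + (y.1.2 * d + ∑ n ∈ Finset.range (c.K - y.1.2), max (d - x.arrivalTime n) 0),
        y.2.2.2 + x.arrivals d) := by
  have hset : {n | x.gapPast d n ≤ d} = {n | x.arrivalTime n ≤ d} := by
    ext n
    simp only [Set.mem_ofPred_eq, Input.gapPast]
    split_ifs with h
    · rfl
    · simp [h]
  have hmax : ∀ n, max (d - x.gapPast d n) 0 = max (d - x.arrivalTime n) 0 := fun n => by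
    simp only [Input.gapPast]
    split_ifs with h
    · rfl
    · rw [max_eq_right (by linarith), max_eq_right (by linarith)]
  simp only [Params.updateHistory, hset, hmax]
  rfl

/-- What has happened up to the start of the `m`-th phase. -/
def Params.history (c : Params) (x : Input) (m : ℕ) : History :=
  (((c.phase x m).mode, (c.phase x m).queue),
    ∑ j ∈ Finset.range m, (if (c.phase x (j + 1)).mode = c.emptyMode 0 then 1 else 0),
    ∫ t in (0 : ℝ)..(c.phase x m).start, (c.queueLength x t : ℝ),
    x.arrivals (c.phase x m).start)

/-- The history is driven only by the length of the phase and the arrivals within it. This puts the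
system in the form of a `splitChain`. -/
theorem Params.history_succ {c : Params} (hc : c.Proper) {x : Input} (hx : x.Regular) (m : ℕ) :
    c.history x (m + 1) = c.updateHistory (c.history x m)
      (c.duration (c.phase x m).mode (c.residual x m),
        (c.residual x m).gapPast (c.duration (c.phase x m).mode (c.residual x m))) := by
  have hr : (c.residual x m).Regular := hx.shift _ _
  have h1 : ((c.phase x (m + 1)).mode, (c.phase x (m + 1)).queue) =
      c.nextState (c.phase x m).mode (c.phase x m).queue
        ((c.residual x m).arrivals (c.duration (c.phase x m).mode (c.residual x m))) := by
    rw [← c.nextState_eq hr, c.phase_succ_eq_translate hx]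
    rfl
  have h2 : (c.phase x (m + 1)).mode = (c.nextState (c.phase x m).mode (c.phase x m).queue
        ((c.residual x m).arrivals (c.duration (c.phase x m).mode (c.residual x m)))).1 := by
    rw [← h1]
  rw [c.updateHistory_gapPast]
  simp only [Params.history]
  rw [h1, Finset.sum_range_succ, h2, c.arrivals_start_succ hc hx, c.phaseEnd_freshPhase,
    c.integral_queueLength_start hc hx, Finset.sum_range_succ,
    ← c.integral_queueLength_start hc hx, c.phaseTime_eq]
  rfl

/-- The driving Markov chain of the history. -/
def Params.historyChain (c : Params) : ℕ → Input → History × Input :=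
  splitChain ((c.emptyMode 0, 0), 0, 0, 0)
    (fun z : History × Input => c.updateHistory z.1
      (c.duration z.1.1.1 z.2, z.2.gapPast (c.duration z.1.1.1 z.2)))
    (fun z : History × Input => z.2.shift (c.duration z.1.1.1 z.2) z.1.1.1.services)

theorem Params.historyChain_eq {c : Params} (hc : c.Proper) {x : Input} (hx : x.Regular) (m : ℕ) :
    c.historyChain m x = (c.history x m, c.residual x m) := by
  induction m with
  | zero =>
    have h : (c.phase x 0).start = 0 := rfl
    have h1 : c.residual x 0 = x := hx.shift_zero
    rw [h1]
    simp [Params.historyChain, splitChain, Params.history, Params.phase, hx.arrivals_zero]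
  | succ m ih =>
    have h1 : c.historyChain (m + 1) x =
        (c.updateHistory (c.historyChain m x).1
          (c.duration (c.historyChain m x).1.1.1 (c.historyChain m x).2,
            (c.historyChain m x).2.gapPast
              (c.duration (c.historyChain m x).1.1.1 (c.historyChain m x).2)),
          (c.historyChain m x).2.shift
            (c.duration (c.historyChain m x).1.1.1 (c.historyChain m x).2)
            (c.historyChain m x).1.1.1.services) := rfl
    rw [h1, ih, c.history_succ hc hx, c.residual_succ hc hx, c.phaseEnd_freshPhase,
      c.nextPhase_freshPhase_served]
    rfl

section Law

variable {lam mu : ℝ} [hlam : Fact (0 < lam)] [hmu : Fact (0 < mu)] {c : Params}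

/-- The input that remains at the start of a phase is independent of the history. -/
theorem splits_history (hc : c.Proper) (m : ℕ) :
    Splits (inputLaw lam mu) (fun x => c.history x m) fun x => c.residual x m := by
  have hs : Measurable fun z : History × Input => z.1.1.1 := measurable_fst.fst.fst
  have hd : Measurable fun z : History × Input => c.duration z.1.1.1 z.2 :=
    measurable_duration c hs measurable_snd
  have h := splits_splitChain (M := inputLaw lam mu) (y₀ := (((c.emptyMode 0, 0), 0, 0, 0) : History))
    (st := fun z : History × Input => c.updateHistory z.1
      (c.duration z.1.1.1 z.2, z.2.gapPast (c.duration z.1.1.1 z.2)))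
    (nx := fun z : History × Input => z.2.shift (c.duration z.1.1.1 z.2) z.1.1.1.services)
    ((measurable_updateHistory c).comp (measurable_fst.prodMk
      (hd.prodMk (measurable_gapPast measurable_snd hd))))
    (measurable_shift measurable_snd hd ((Measurable.of_discrete (f := Mode.services)).comp hs))
    (fun y => (splits_duration hc y.1.1).comp
      ((measurable_updateHistory c).comp (measurable_const.prodMk measurable_id))) m
  refine h.congr (ae_regular.mono fun x hx => ?_) (ae_regular.mono fun x hx => ?_)
  · exact congrArg Prod.fst (c.historyChain_eq hc hx m)
  · exact congrArg Prod.snd (c.historyChain_eq hc hx m)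

/-! ### Expected rewards in the first cycle -/

/-- The first running cycle is not over at the start of the `m`-th phase. -/
def Params.alive (c : Params) (m : ℕ) : Set Input := {x | ∀ j < m, ¬ c.BeginsCycle x (j + 1)}

theorem measurableSet_alive (c : Params) (m : ℕ) : MeasurableSet (c.alive m) := by
  have : c.alive m = ⋂ j, ⋂ _ : j < m, {x | c.BeginsCycle x (j + 1)}ᶜ := by
    ext x
    simp [Params.alive]
  rw [this]
  exact MeasurableSet.iInter fun j => MeasurableSet.iInter fun _ =>
    (measurableSet_beginsCycle c (j + 1)).compl

theorem Params.mem_alive_iff (c : Params) {x : Input} {m : ℕ} :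
    x ∈ c.alive m ↔ (c.history x m).2.1 = 0 := by
  simp only [Params.history, Finset.sum_eq_zero_iff, Finset.mem_range, Params.alive,
    Set.mem_ofPred_eq, Params.BeginsCycle]
  refine forall₂_congr fun j _ => ?_
  split_ifs with h <;> simp [h]

theorem Params.mem_alive_succ_iff (c : Params) {x : Input} {m : ℕ} :
    x ∈ c.alive (m + 1) ↔ x ∈ c.alive m ∧ (c.phase x (m + 1)).mode ≠ c.emptyMode 0 := by
  simp only [Params.alive, Set.mem_ofPred_eq, Nat.forall_lt_succ_right]
  rfl

/-- The return is an event of the history, hence independent of the residual input. Phase `0` is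
excluded because the counter of completed cycles starts at zero. -/
theorem Params.isReturn_iff (c : Params) {x : Input} {m : ℕ} :
    c.IsReturn x m ↔ (c.history x m).2.1 = 1 ∧ (c.history x m).1.1 = c.emptyMode 0 := by
  cases m with
  | zero => simp [Params.IsReturn, Params.history]
  | succ m =>
    have h1 : c.IsReturn x (m + 1) ↔ x ∈ c.alive m ∧ c.BeginsCycle x (m + 1) := by
      simp only [Params.IsReturn, Params.alive, Set.mem_ofPred_eq]
      constructor
      · rintro ⟨-, h, h'⟩
        exact ⟨fun j hj => h' _ (by omega) (by omega), h⟩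
      · rintro ⟨h', h⟩
        refine ⟨by omega, h, fun j h1 h2 => ?_⟩
        obtain ⟨k, rfl⟩ : ∃ k, j = k + 1 := ⟨j - 1, by omega⟩
        exact h' k (by omega)
    have h2 : (c.history x (m + 1)).1.1 = (c.phase x (m + 1)).mode := rfl
    have h3 : (c.history x (m + 1)).2.1 = (c.history x m).2.1 +
        (if (c.phase x (m + 1)).mode = c.emptyMode 0 then 1 else 0) :=
      Finset.sum_range_succ _ _
    rw [h1, c.mem_alive_iff, Params.BeginsCycle, h2, h3]
    constructor
    · rintro ⟨h4, h5⟩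
      simp [h4, h5]
    · rintro ⟨h4, h5⟩
      rw [if_pos h5] at h4
      exact ⟨by omega, h5⟩

theorem Params.IsReturn.mem_alive_iff {x : Input} {m : ℕ} (h : c.IsReturn x m) {j : ℕ} :
    x ∈ c.alive j ↔ j < m := by
  simp only [Params.alive, Set.mem_ofPred_eq]
  constructor
  · intro h1
    by_contra hj
    have := h1 (m - 1) (by have := h.1; omega)
    rw [Nat.sub_add_cancel h.1] at this
    exact this h.2.1
  · intro h1 i hi
    exact h.2.2 _ (by omega) (by omega)

theorem Params.exists_isReturn_of_notMem_alive (c : Params) {x : Input} {m : ℕ}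
    (h : x ∉ c.alive m) : ∃ n, c.IsReturn x n := by
  classical
  simp only [Params.alive, Set.mem_ofPred_eq, not_forall, not_not] at h
  obtain ⟨j, _, hj⟩ := h
  have hex : ∃ j, c.BeginsCycle x (j + 1) := ⟨j, hj⟩
  refine ⟨Nat.find hex + 1, by omega, Nat.find_spec hex, fun i h1 h2 => ?_⟩
  obtain ⟨k, rfl⟩ : ∃ k, i = k + 1 := ⟨i - 1, by omega⟩
  exact Nat.find_min hex (by omega)

/-- The mode and the queue at the start of the `m`-th phase. -/
def Params.state (c : Params) (x : Input) (m : ℕ) : Mode × ℕ :=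
  ((c.phase x m).mode, (c.phase x m).queue)

theorem measurable_state (c : Params) (m : ℕ) : Measurable fun x => c.state x m :=
  (Phase.measurable_mode.comp (measurable_phase c m)).prodMk
    (Phase.measurable_queue.comp (measurable_phase c m))

/-- Survival up to phase `m` and the state there are functions of the history, so by
`splits_history` the residual input may be replaced by an independent copy. -/
theorem lintegral_alive (hc : c.Proper) (m : ℕ) {r : (Mode × ℕ) × Input → ℝ≥0∞}
    (hr : Measurable r) :
    ∫⁻ x, (c.alive m).indicator (fun x => r (c.state x m, c.residual x m)) x ∂(inputLaw lam mu) =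
      ∫⁻ x, (c.alive m).indicator
        (fun x => ∫⁻ y, r (c.state x m, y) ∂(inputLaw lam mu)) x ∂(inputLaw lam mu) := by
  have hset : MeasurableSet {z : History × Input | z.1.2.1 = 0} :=
    measurable_fst.snd.fst (measurableSet_singleton 0)
  have h := splits_history (lam := lam) (mu := mu) hc m
    ({z : History × Input | z.1.2.1 = 0}.indicator fun z => r (z.1.1, z.2))
    ((hr.comp (measurable_fst.fst.prodMk measurable_snd)).indicator hset)
  have key : ∀ x y, {z : History × Input | z.1.2.1 = 0}.indicator (fun z => r (z.1.1, z.2))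
      (c.history x m, y) = (c.alive m).indicator (fun x => r (c.state x m, y)) x := fun x y => by
    by_cases hx : x ∈ c.alive m
    · rw [Set.indicator_of_mem hx]
      exact Set.indicator_of_mem (s := {z : History × Input | z.1.2.1 = 0})
        (c.mem_alive_iff.1 hx) _
    · rw [Set.indicator_of_notMem hx]
      exact Set.indicator_of_notMem (s := {z : History × Input | z.1.2.1 = 0})
        (fun h => hx (c.mem_alive_iff.2 h)) _
  simp only [key] at h
  refine (Eq.trans (lintegral_congr fun x => ?_) h).trans (lintegral_congr fun x => ?_)
  · by_cases hx : x ∈ c.alive m <;> simp [hx]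
  · by_cases hx : x ∈ c.alive m <;> simp [hx]

/-- The state after a phase that starts in the state `s` with the input `y`. -/
def Params.stateAfter (c : Params) (s : Mode × ℕ) (y : Input) : Mode × ℕ :=
  c.nextState s.1 s.2 (y.arrivals (c.duration s.1 y))

theorem measurable_stateAfter (c : Params) :
    Measurable fun z : (Mode × ℕ) × Input => c.stateAfter z.1 z.2 :=
  (Measurable.of_discrete (f := fun w : Mode × ℕ × ℕ => c.nextState w.1 w.2.1 w.2.2)).comp
    (measurable_fst.fst.prodMk (measurable_fst.snd.prodMk (measurable_arrivals measurable_snd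
      (measurable_duration c measurable_fst.fst measurable_snd))))

theorem Params.state_succ (c : Params) {x : Input} (hx : x.Regular) (m : ℕ) :
    c.state x (m + 1) = c.stateAfter (c.state x m) (c.residual x m) := by
  have hr : (c.residual x m).Regular := hx.shift _ _
  simp only [Params.state, Params.stateAfter]
  rw [← c.nextState_eq hr, c.phase_succ_eq_translate hx]
  rfl

/-- `V`, except that it vanishes at the end of the cycle. -/
def Params.stopped (c : Params) (V : Mode × ℕ → ℝ≥0∞) (s : Mode × ℕ) : ℝ≥0∞ :=
  if s.1 = c.emptyMode 0 then 0 else V s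

/-- Among the cycles alive at phase `m`, those that end at the next phase are exactly the ones that
`stopped` annihilates. -/
theorem lintegral_alive_succ (hc : c.Proper) (m : ℕ) (V : Mode × ℕ → ℝ≥0∞) :
    ∫⁻ x, (c.alive (m + 1)).indicator (fun x => V (c.state x (m + 1))) x ∂(inputLaw lam mu) =
      ∫⁻ x, (c.alive m).indicator (fun x =>
        ∫⁻ y, c.stopped V (c.stateAfter (c.state x m) y) ∂(inputLaw lam mu)) x
          ∂(inputLaw lam mu) := by
  have hr : Measurable fun z : (Mode × ℕ) × Input => c.stopped V (c.stateAfter z.1 z.2) :=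
    (Measurable.of_discrete (f := c.stopped V)).comp (measurable_stateAfter c)
  rw [← lintegral_alive hc m hr]
  refine lintegral_congr_ae (ae_regular.mono fun x hx => ?_)
  have h1 : (c.state x (m + 1)).1 = (c.phase x (m + 1)).mode := rfl
  by_cases h2 : x ∈ c.alive m
  · rw [Set.indicator_of_mem h2, ← c.state_succ hx, Params.stopped, h1]
    by_cases h3 : (c.phase x (m + 1)).mode = c.emptyMode 0
    · rw [if_pos h3, Set.indicator_of_notMem fun h => (c.mem_alive_succ_iff.1 h).2 h3]
    · rw [if_neg h3, Set.indicator_of_mem (c.mem_alive_succ_iff.2 ⟨h2, h3⟩)]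
  · rw [Set.indicator_of_notMem h2,
      Set.indicator_of_notMem fun h => h2 (c.mem_alive_succ_iff.1 h).1]

/-- The expected reward of a phase that starts in the state `s`. -/
def meanReward (lam mu : ℝ) [Fact (0 < lam)] [Fact (0 < mu)]
    (r : (Mode × ℕ) × Input → ℝ≥0∞) (s : Mode × ℕ) : ℝ≥0∞ :=
  ∫⁻ y, r (s, y) ∂(inputLaw lam mu)

/-- The expected reward in the `m`-th phase, if it belongs to the first cycle. -/
def Params.phaseReward (c : Params) (lam mu : ℝ) [Fact (0 < lam)] [Fact (0 < mu)]
    (r : (Mode × ℕ) × Input → ℝ≥0∞) (m : ℕ) : ℝ≥0∞ :=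
  ∫⁻ x, (c.alive m).indicator (fun x => r (c.state x m, c.residual x m)) x ∂(inputLaw lam mu)

theorem phaseReward_add (hc : c.Proper) (m : ℕ) {r : (Mode × ℕ) × Input → ℝ≥0∞}
    (hr : Measurable r) (V : Mode × ℕ → ℝ≥0∞) :
    c.phaseReward lam mu r m +
      ∫⁻ x, (c.alive (m + 1)).indicator (fun x => V (c.state x (m + 1))) x ∂(inputLaw lam mu) =
    ∫⁻ x, (c.alive m).indicator (fun x => meanReward lam mu r (c.state x m) +
      ∫⁻ y, c.stopped V (c.stateAfter (c.state x m) y) ∂(inputLaw lam mu)) x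
        ∂(inputLaw lam mu) := by
  rw [Params.phaseReward, lintegral_alive hc m hr, lintegral_alive_succ hc m V,
    ← lintegral_add_left]
  · refine lintegral_congr fun x => ?_
    by_cases h : x ∈ c.alive m <;> simp [h, meanReward]
  · exact ((Measurable.lintegral_prod_right' hr).comp (measurable_state c m)).indicator
      (measurableSet_alive c m)

theorem Params.alive_zero (c : Params) : c.alive 0 = Set.univ := by
  ext x
  simp [Params.alive]

theorem lintegral_alive_zero (c : Params) (V : Mode × ℕ → ℝ≥0∞) :
    ∫⁻ x, (c.alive 0).indicator (fun x => V (c.state x 0)) x ∂(inputLaw lam mu) =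
      V (c.emptyMode 0, 0) := by
  simp only [c.alive_zero, Set.indicator_univ]
  change ∫⁻ _ : Input, V (c.emptyMode 0, 0) ∂(inputLaw lam mu) = _
  rw [lintegral_const, measure_univ, mul_one]

theorem ae_valid (hc : c.Proper) :
    ∀ᵐ x ∂(inputLaw lam mu), ∀ m, c.Valid (c.state x m).1 (c.state x m).2 :=
  ae_regular.mono fun _ hx m => c.valid_phase hc hx m

/-- A superharmonic function bounds the expected reward in a cycle. -/
theorem tsum_phaseReward_le (hc : c.Proper) {r : (Mode × ℕ) × Input → ℝ≥0∞} (hr : Measurable r)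
    {V : Mode × ℕ → ℝ≥0∞}
    (hV : ∀ s, c.Valid s.1 s.2 → meanReward lam mu r s +
      ∫⁻ y, c.stopped V (c.stateAfter s y) ∂(inputLaw lam mu) ≤ V s) :
    ∑' m, c.phaseReward lam mu r m ≤ V (c.emptyMode 0, 0) := by
  refine ENNReal.tsum_le_of_sum_range_le fun n => ?_
  -- The expected value of `V` on the cycles still alive is kept as a remainder, so that the bound
  -- passes through the induction; it is nonnegative and dropped at the end.
  suffices h : ∑ m ∈ Finset.range n, c.phaseReward lam mu r m +
      ∫⁻ x, (c.alive n).indicator (fun x => V (c.state x n)) x ∂(inputLaw lam mu) ≤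
        V (c.emptyMode 0, 0) from le_trans le_self_add h
  induction n with
  | zero => simp [lintegral_alive_zero]
  | succ n ih =>
    refine le_trans ?_ ih
    rw [Finset.sum_range_succ, add_assoc, phaseReward_add hc n hr V]
    refine add_le_add le_rfl (lintegral_mono_ae ((ae_valid hc).mono fun x hx => ?_))
    exact Set.indicator_le_indicator (hV _ (hx n))

/-- A harmonic function gives the expected reward in a cycle. -/
theorem tsum_phaseReward_eq (hc : c.Proper) {r : (Mode × ℕ) × Input → ℝ≥0∞} (hr : Measurable r)
    {V : Mode × ℕ → ℝ≥0∞}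
    (hV : ∀ s, c.Valid s.1 s.2 → meanReward lam mu r s +
      ∫⁻ y, c.stopped V (c.stateAfter s y) ∂(inputLaw lam mu) = V s)
    {C : ℝ≥0∞} (hC : C ≠ ∞) (hVC : ∀ s, c.Valid s.1 s.2 → V s ≤ C)
    (halive : Tendsto (fun m => inputLaw lam mu (c.alive m)) atTop (𝓝 0)) :
    ∑' m, c.phaseReward lam mu r m = V (c.emptyMode 0, 0) := by
  have h : ∀ n, ∑ m ∈ Finset.range n, c.phaseReward lam mu r m +
      ∫⁻ x, (c.alive n).indicator (fun x => V (c.state x n)) x ∂(inputLaw lam mu) =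
        V (c.emptyMode 0, 0) := fun n => by
    induction n with
    | zero => simp [lintegral_alive_zero]
    | succ n ih =>
      rw [← ih, Finset.sum_range_succ, add_assoc, phaseReward_add hc n hr V]
      congr 1
      refine lintegral_congr_ae ((ae_valid hc).mono fun x hx => ?_)
      by_cases hm : x ∈ c.alive n
      · rw [Set.indicator_of_mem hm, Set.indicator_of_mem hm, hV _ (hx n)]
      · rw [Set.indicator_of_notMem hm, Set.indicator_of_notMem hm]
  -- The remainder vanishes in the limit: `V` is bounded on admissible states and survival has
  -- vanishing probability. This singles out the bounded harmonic function.
  have h0 : Tendsto (fun n => ∫⁻ x, (c.alive n).indicator (fun x => V (c.state x n)) x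
      ∂(inputLaw lam mu)) atTop (𝓝 0) := by
    have h1 : Tendsto (fun n => C * inputLaw lam mu (c.alive n)) atTop (𝓝 0) := by
      simpa using ENNReal.Tendsto.const_mul halive (Or.inr hC)
    refine tendsto_of_tendsto_of_tendsto_of_le_of_le tendsto_const_nhds h1
      (fun _ => zero_le) fun n => ?_
    rw [← lintegral_indicator_const (measurableSet_alive c n)]
    refine lintegral_mono_ae ((ae_valid hc).mono fun x hx => ?_)
    exact Set.indicator_le_indicator (hVC _ (hx n))
  have h2 := (ENNReal.tendsto_nat_tsum (c.phaseReward lam mu r)).add h0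
  simp only [h, add_zero] at h2
  exact tendsto_nhds_unique h2 tendsto_const_nhds

/-- The total reward of the first cycle. -/
theorem tsum_indicator_alive {x : Input} {n : ℕ} (h : c.IsReturn x n) (f : ℕ → ℝ≥0∞) :
    ∑' m, (c.alive m).indicator (fun _ => f m) x = ∑ m ∈ Finset.range n, f m := by
  rw [tsum_eq_sum (s := Finset.range n)]
  · refine Finset.sum_congr rfl fun m hm => ?_
    rw [Set.indicator_of_mem (h.mem_alive_iff.2 (Finset.mem_range.1 hm))]
  · intro m hm
    exact Set.indicator_of_notMem (fun h' => hm (Finset.mem_range.2 (h.mem_alive_iff.1 h'))) _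

theorem measurable_indicator_alive {r : (Mode × ℕ) × Input → ℝ≥0∞} (hr : Measurable r) (m : ℕ) :
    Measurable ((c.alive m).indicator fun x => r (c.state x m, c.residual x m)) :=
  (hr.comp ((measurable_state c m).prodMk (measurable_residual c m))).indicator
    (measurableSet_alive c m)

theorem lintegral_cycleReward {r : (Mode × ℕ) × Input → ℝ≥0∞} (hr : Measurable r)
    {f : Input → ℝ≥0∞} (hf : ∀ x, x.Regular → ∀ n, c.IsReturn x n →
      f x = ∑ m ∈ Finset.range n, r (c.state x m, c.residual x m))
    (hret : ∀ᵐ x ∂(inputLaw lam mu), ∃ n, c.IsReturn x n) :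
    ∫⁻ x, f x ∂(inputLaw lam mu) = ∑' m, c.phaseReward lam mu r m := by
  simp only [Params.phaseReward]
  rw [← lintegral_tsum fun m => (measurable_indicator_alive hr m).aemeasurable]
  refine lintegral_congr_ae ?_
  filter_upwards [ae_regular, hret] with x hx ⟨n, hn⟩
  rw [hf x hx n hn, ← tsum_indicator_alive hn]
  rfl

theorem cycleTime_zero_eq {x : Input} {n : ℕ}
    (hn : c.IsReturn x n) : c.cycleTime x 0 = (c.history x n).2.2.1 := by
  rw [Params.cycleTime, c.cycleStart_zero, zero_add, c.cycleStart_def, hn.nth_eq]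
  rfl

theorem cycleArrivals_zero_eq {x : Input} (hx : x.Regular) {n : ℕ}
    (hn : c.IsReturn x n) : c.cycleArrivals x 0 = ((c.history x n).2.2.2 : ℝ) := by
  rw [Params.cycleArrivals, c.cycleStart_zero, zero_add, c.cycleStart_def, hn.nth_eq,
    hx.arrivals_zero, Nat.sub_zero]
  rfl

/-- The input that remains at the end of the first cycle is independent of the cycle. -/
theorem splits_nextCycle (hc : c.Proper)
    (hret : ∀ᵐ x ∂(inputLaw lam mu), ∃ n, c.IsReturn x n) :
    Splits (inputLaw lam mu) (fun x => (c.cycleTime x 0, c.cycleArrivals x 0)) c.nextCycle := by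
  intro F hF
  have hm := (measurable_cycleTime c 0).prodMk (measurable_cycleArrivals c 0)
  have hN := measurable_nth_beginsCycle c 1
  rw [lintegral_eq_tsum_indicator hN, lintegral_eq_tsum_indicator hN]
  rotate_left
  · exact (Measurable.lintegral_prod_right' hF).comp hm
  · exact hF.comp (hm.prodMk (measurable_nextCycle c))
  -- On a return at phase `m` the totals of the cycle are entries of the history and the next input
  -- is the residual one, so `splits_history` at the fixed index `m` applies. Inputs without any
  -- return form a null set.
  refine tsum_congr fun m => ?_
  have hset : MeasurableSet {z : History × Input | z.1.2.1 = 1 ∧ z.1.1.1 = c.emptyMode 0} :=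
    (measurable_fst.snd.fst (measurableSet_singleton 1)).inter
      (measurable_fst.fst.fst (measurableSet_singleton (c.emptyMode 0)))
  have h := splits_history (lam := lam) (mu := mu) hc m
    ({z : History × Input | z.1.2.1 = 1 ∧ z.1.1.1 = c.emptyMode 0}.indicator
      fun z => F ((z.1.2.2.1, (z.1.2.2.2 : ℝ)), z.2))
    ((hF.comp ((measurable_fst.snd.snd.fst.prodMk
      (measurable_from_top.comp measurable_fst.snd.snd.snd)).prodMk
        measurable_snd)).indicator hset)
  have hiff : ∀ x, (∃ n, c.IsReturn x n) →
      (Nat.nth (c.BeginsCycle x) 1 = m ↔ c.IsReturn x m) := fun x ⟨n, hn⟩ => by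
    constructor
    · rintro rfl
      rwa [hn.nth_eq]
    · exact fun h => h.nth_eq
  have hmem : ∀ x, c.IsReturn x m → ∀ y,
      {z : History × Input | z.1.2.1 = 1 ∧ z.1.1.1 = c.emptyMode 0}.indicator
        (fun z => F ((z.1.2.2.1, (z.1.2.2.2 : ℝ)), z.2)) (c.history x m, y) =
      F (((c.history x m).2.2.1, ((c.history x m).2.2.2 : ℝ)), y) := fun x hx y =>
    Set.indicator_of_mem (s := {z : History × Input | z.1.2.1 = 1 ∧ z.1.1.1 = c.emptyMode 0})
      (c.isReturn_iff.1 hx) _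
  have hnot : ∀ x, ¬ c.IsReturn x m → ∀ y,
      {z : History × Input | z.1.2.1 = 1 ∧ z.1.1.1 = c.emptyMode 0}.indicator
        (fun z => F ((z.1.2.2.1, (z.1.2.2.2 : ℝ)), z.2)) (c.history x m, y) = 0 := fun x hx y =>
    Set.indicator_of_notMem
      (s := {z : History × Input | z.1.2.1 = 1 ∧ z.1.1.1 = c.emptyMode 0})
      (fun h => hx (c.isReturn_iff.2 h)) _
  have hpos : ∀ x, c.IsReturn x m → ∀ f : Input → ℝ≥0∞,
      {x | Nat.nth (c.BeginsCycle x) 1 = m}.indicator f x = f x := fun x hx f =>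
    Set.indicator_of_mem (s := {x | Nat.nth (c.BeginsCycle x) 1 = m}) hx.nth_eq f
  have hneg : ∀ x, (∃ n, c.IsReturn x n) → ¬ c.IsReturn x m → ∀ f : Input → ℝ≥0∞,
      {x | Nat.nth (c.BeginsCycle x) 1 = m}.indicator f x = 0 := fun x hx h f =>
    Set.indicator_of_notMem (s := {x | Nat.nth (c.BeginsCycle x) 1 = m})
      (fun h' => h ((hiff x hx).1 h')) f
  refine Eq.trans (lintegral_congr_ae ?_) (h.trans (lintegral_congr_ae ?_))
  · filter_upwards [ae_regular, hret] with x hx hr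
    by_cases h1 : c.IsReturn x m
    · rw [hmem x h1, hpos x h1,
        cycleTime_zero_eq h1, cycleArrivals_zero_eq hx h1, Params.nextCycle, h1.nth_eq]
    · rw [hnot x h1, hneg x hr h1]
  · filter_upwards [ae_regular, hret] with x hx hr
    by_cases h1 : c.IsReturn x m
    · simp only [hmem x h1]
      rw [hpos x h1,
        cycleTime_zero_eq h1, cycleArrivals_zero_eq hx h1]
    · simp only [hnot x h1]
      rw [hneg x hr h1, lintegral_zero]

end Law

/-! ### Expected rewards of single phases -/

/-- The number of arrivals in a phase. -/
def Params.arrivalReward (c : Params) (z : (Mode × ℕ) × Input) : ℝ≥0∞ :=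
  (z.2.arrivals (c.duration z.1.1 z.2) : ℝ≥0∞)

/-- The time spent by packets in the system during a phase. -/
def Params.timeReward (c : Params) (z : (Mode × ℕ) × Input) : ℝ≥0∞ :=
  ENNReal.ofReal (c.phaseTime z.1.1 z.1.2 z.2)

theorem measurable_arrivalReward (c : Params) : Measurable c.arrivalReward :=
  measurable_from_top.comp (measurable_arrivals measurable_snd
    (measurable_duration c measurable_fst.fst measurable_snd))

theorem measurable_timeReward (c : Params) : Measurable c.timeReward :=
  (measurable_phaseTime c measurable_fst.fst measurable_fst.snd measurable_snd).ennreal_ofReal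

theorem Input.Regular.arrivals_eq_tsum {x : Input} (hx : x.Regular) (t : ℝ) :
    (x.arrivals t : ℝ≥0∞) = ∑' n, if x.arrivalTime n ≤ t then 1 else 0 := by
  rw [tsum_eq_sum (s := Finset.range (x.arrivals t))]
  · rw [Finset.sum_congr rfl fun n hn =>
      if_pos (hx.lt_arrivals_iff.1 (Finset.mem_range.1 hn))]
    simp
  · intro n hn
    exact if_neg fun h => hn (Finset.mem_range.2 (hx.lt_arrivals_iff.2 h))

section Law

variable {lam mu : ℝ} [hlam : Fact (0 < lam)] [hmu : Fact (0 < mu)] {c : Params}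

theorem lintegral_service_arrivalTime (n : ℕ) {g : ℝ × ℝ → ℝ≥0∞} (hg : Measurable g) :
    ∫⁻ x, g (x.service 0, x.arrivalTime n) ∂(inputLaw lam mu) =
      ∫⁻ y, ∫⁻ s, g (s, y.arrivalTime n) ∂(expMeasure mu) ∂(inputLaw lam mu) := by
  refine (lintegral_consService (hg.comp ((Input.measurable_service 0).prodMk
    (Input.measurable_arrivalTime n)))).trans ?_
  refine lintegral_lintegral_swap ?_
  exact (hg.comp (measurable_fst.prodMk
    ((Input.measurable_arrivalTime n).comp measurable_snd))).aemeasurable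

/-- Given the arrivals, the service outlasts the time `T` with probability `exp (-(mu * T))`; what
remains is the Laplace transform of the arrival time. -/
theorem lintegral_arrivalTime_le_service (n : ℕ) :
    ∫⁻ x, (if x.arrivalTime n ≤ x.service 0 then 1 else 0) ∂(inputLaw lam mu) =
      ENNReal.ofReal ((lam / (lam + mu)) ^ (n + 1)) := by
  rw [lintegral_service_arrivalTime n (g := fun z => if z.2 ≤ z.1 then 1 else 0)
    (Measurable.ite (measurableSet_le measurable_snd measurable_fst) measurable_const
      measurable_const), ← lintegral_exp_neg_arrivalTime (mu := mu) hmu.out.le n]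
  refine lintegral_congr_ae (ae_regular.mono fun y hy => ?_)
  simp only
  rw [← expMeasure_Ici (hy.arrivalTime_pos n).le, ← lintegral_indicator_one measurableSet_Ici]
  refine lintegral_congr fun s => ?_
  simp [Set.indicator_apply]

/-- Given that the service lasts beyond the arrival, its excess is again exponential of rate `mu`,
with mean `1 / mu`. -/
theorem lintegral_service_sub_arrivalTime (n : ℕ) :
    ∫⁻ x, ENNReal.ofReal (max (x.service 0 - x.arrivalTime n) 0) ∂(inputLaw lam mu) =
      ENNReal.ofReal ((lam / (lam + mu)) ^ (n + 1) / mu) := by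
  have h0 : 0 ≤ lam / (lam + mu) := div_nonneg hlam.out.le (add_pos hlam.out hmu.out).le
  rw [lintegral_service_arrivalTime n (g := fun z => ENNReal.ofReal (max (z.1 - z.2) 0))
    (((measurable_fst.sub measurable_snd).max measurable_const).ennreal_ofReal),
    div_eq_mul_one_div, ENNReal.ofReal_mul (pow_nonneg h0 _),
    ← lintegral_exp_neg_arrivalTime (mu := mu) hmu.out.le n, ← lintegral_mul_const]
  · refine lintegral_congr_ae (ae_regular.mono fun y hy => ?_)
    simp only
    rw [← lintegral_id_expMeasure, ← lintegral_expMeasure_memoryless (hy.arrivalTime_pos n).le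
      ENNReal.measurable_ofReal]
    refine lintegral_congr fun s => ?_
    by_cases hs : y.arrivalTime n < s
    · rw [Set.indicator_of_mem (Set.mem_Ioi.2 hs), max_eq_left (by linarith)]
    · rw [Set.indicator_of_notMem (by simpa using hs), max_eq_right (by linarith),
        ENNReal.ofReal_zero]
  · exact (Real.measurable_exp.comp
      ((Input.measurable_arrivalTime n).const_mul mu).neg).ennreal_ofReal

theorem lintegral_id_service :
    ∫⁻ x, ENNReal.ofReal (x.service 0) ∂(inputLaw lam mu) = ENNReal.ofReal (1 / mu) := by
  rw [← lintegral_id_expMeasure, ← map_service (lam := lam) (mu := mu) 0,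
    lintegral_map ENNReal.measurable_ofReal (Input.measurable_service 0)]

variable (lam mu) in
/-- The probability that an arrival comes before the end of a service. -/
def ratio : ℝ := lam / (lam + mu)

theorem ratio_nonneg : 0 ≤ ratio lam mu :=
  div_nonneg hlam.out.le (add_pos hlam.out hmu.out).le

theorem ratio_lt_one : ratio lam mu < 1 :=
  (div_lt_one (add_pos hlam.out hmu.out)).2 (by linarith [hmu.out])

/-- The odds of an arrival before the end of the service are `lam / mu`. This links the geometric
weights of a single service to the powers of `ρ` in the final formula. -/
theorem ratio_eq : ratio lam mu = (1 - ratio lam mu) * (lam / mu) := by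
  have h1 := hlam.out
  have h2 := hmu.out
  unfold ratio
  field_simp
  ring

theorem tsum_ratio : ∑' n : ℕ, ENNReal.ofReal (ratio lam mu ^ (n + 1)) =
    ENNReal.ofReal (lam / mu) := by
  have h0 := ratio_nonneg (lam := lam) (mu := mu)
  have h1 := ratio_lt_one (lam := lam) (mu := mu)
  rw [← ENNReal.ofReal_tsum_of_nonneg (fun n => pow_nonneg h0 _)
    ((summable_nat_add_iff 1).2 (summable_geometric_of_lt_one h0 h1))]
  congr 1
  simp only [pow_succ]
  rw [tsum_mul_right, tsum_geometric_of_lt_one h0 h1]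
  nth_rewrite 2 [ratio_eq]
  rw [inv_mul_cancel_left₀ (by linarith)]

theorem lintegral_arrivals_eq_tsum {f : Input → ℝ} (hf : Measurable f) :
    ∫⁻ x, (x.arrivals (f x) : ℝ≥0∞) ∂(inputLaw lam mu) =
      ∑' n, ∫⁻ x, (if x.arrivalTime n ≤ f x then 1 else 0) ∂(inputLaw lam mu) := by
  rw [← lintegral_tsum fun n => (Measurable.ite
    (measurableSet_le (Input.measurable_arrivalTime n) hf) measurable_const
      measurable_const).aemeasurable]
  exact lintegral_congr_ae (ae_regular.mono fun x hx => hx.arrivals_eq_tsum _)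

theorem meanReward_arrival_busy (c : Params) (q : ℕ) :
    meanReward lam mu c.arrivalReward (Mode.busy, q) = ENNReal.ofReal (lam / mu) := by
  rw [← tsum_ratio]
  refine (lintegral_arrivals_eq_tsum (Input.measurable_service 0)).trans ?_
  exact tsum_congr fun n => lintegral_arrivalTime_le_service n

theorem meanReward_arrival_idle (c : Params) (q : ℕ) :
    meanReward lam mu c.arrivalReward (Mode.idle, q) = 1 := by
  have h : ∀ᵐ x ∂(inputLaw lam mu), c.arrivalReward ((Mode.idle, q), x) = 1 :=
    ae_regular.mono fun x hx => by
      simp only [Params.arrivalReward]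
      rw [Params.duration, hx.arrivals_zero, hx.arrivals_arrivalTime]
      simp
  rw [meanReward, lintegral_congr_ae h, lintegral_const, measure_univ, mul_one]

/-- A Chernoff bound: the indicator of an arrival by time `t` is at most `exp t` times `exp` of
minus the arrival time, and these expectations are summable. -/
theorem lintegral_arrivals_lt_top (t : ℝ) :
    ∫⁻ x, (x.arrivals t : ℝ≥0∞) ∂(inputLaw lam mu) < ∞ := by
  rw [lintegral_arrivals_eq_tsum measurable_const]
  have h0 : 0 ≤ lam / (lam + 1) := div_nonneg hlam.out.le (by linarith [hlam.out])
  have h1 : lam / (lam + 1) < 1 := (div_lt_one (by linarith [hlam.out])).2 (by linarith)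
  have h2 : ∀ n, ∫⁻ x, (if Input.arrivalTime x n ≤ t then 1 else 0) ∂(inputLaw lam mu) ≤
      ENNReal.ofReal (Real.exp t) * ENNReal.ofReal ((lam / (lam + 1)) ^ (n + 1)) := fun n => by
    have hm : Measurable fun x : Input =>
        ENNReal.ofReal (Real.exp (-(1 * x.arrivalTime n))) :=
      (Real.measurable_exp.comp ((Input.measurable_arrivalTime n).const_mul 1).neg).ennreal_ofReal
    rw [← lintegral_exp_neg_arrivalTime (mu := mu) zero_le_one n, ← lintegral_const_mul _ hm]
    refine lintegral_mono fun x => ?_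
    rw [← ENNReal.ofReal_mul (Real.exp_pos _).le, ← Real.exp_add]
    split_ifs with h
    · rw [← ENNReal.ofReal_one]
      exact ENNReal.ofReal_le_ofReal (Real.one_le_exp (by linarith))
    · exact zero_le
  refine (ENNReal.tsum_le_tsum h2).trans_lt ?_
  rw [ENNReal.tsum_mul_left, ← ENNReal.ofReal_tsum_of_nonneg (fun n => pow_nonneg h0 _)
      ((summable_nat_add_iff 1).2 (summable_geometric_of_lt_one h0 h1))]
  exact ENNReal.mul_lt_top ENNReal.ofReal_lt_top ENNReal.ofReal_lt_top

theorem meanReward_time_busy (c : Params) (q : ℕ) :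
    meanReward lam mu c.timeReward (Mode.busy, q) = ENNReal.ofReal
      (q / mu + ∑ n ∈ Finset.range (c.K - q), ratio lam mu ^ (n + 1) / mu) := by
  have h0 := ratio_nonneg (lam := lam) (mu := mu)
  have hmu' := hmu.out
  have h1 : ∀ᵐ x ∂(inputLaw lam mu), c.timeReward ((Mode.busy, q), x) =
      ENNReal.ofReal q * ENNReal.ofReal (x.service 0) +
        ∑ n ∈ Finset.range (c.K - q),
          ENNReal.ofReal (max (x.service 0 - x.arrivalTime n) 0) :=
    ae_regular.mono fun x hx => by
      simp only [Params.timeReward, c.phaseTime_eq, Params.duration]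
      rw [ENNReal.ofReal_add (mul_nonneg (Nat.cast_nonneg _) (hx.service_pos 0).le)
        (Finset.sum_nonneg fun _ _ => le_max_right _ _),
        ENNReal.ofReal_mul (Nat.cast_nonneg _),
        ENNReal.ofReal_sum_of_nonneg fun _ _ => le_max_right _ _]
  have hm : ∀ n, Measurable fun x : Input =>
      ENNReal.ofReal (max (x.service 0 - x.arrivalTime n) 0) := fun n =>
    (((Input.measurable_service 0).sub (Input.measurable_arrivalTime n)).max
      measurable_const).ennreal_ofReal
  rw [meanReward, lintegral_congr_ae h1, lintegral_add_right _
      (Finset.measurable_sum _ fun n _ => hm n), lintegral_finsetSum _ fun n _ => hm n,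
    lintegral_const_mul _ (Input.measurable_service 0).ennreal_ofReal, lintegral_id_service,
    ENNReal.ofReal_add (by positivity) (Finset.sum_nonneg fun n _ => by positivity),
    ENNReal.ofReal_sum_of_nonneg fun n _ => by positivity, div_eq_mul_one_div (q : ℝ),
    ENNReal.ofReal_mul (Nat.cast_nonneg _)]
  congr 1
  exact Finset.sum_congr rfl fun n _ => lintegral_service_sub_arrivalTime n

theorem meanReward_time_idle (c : Params) :
    meanReward lam mu c.timeReward (Mode.idle, 0) = 0 := by
  refine lintegral_eq_zero_of_ae_eq_zero (ae_regular.mono fun x hx => ?_)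
  simp only [Params.timeReward, c.phaseTime_eq, Pi.zero_apply]
  rw [Params.duration, hx.arrivals_zero, Finset.sum_eq_zero]
  · simp
  · intro n _
    exact max_eq_right (sub_nonpos.2 (hx.strictMono_arrivalTime.monotone n.zero_le))

theorem meanReward_time_vacation_le (hc : c.Proper) (j : ℕ) :
    meanReward lam mu c.timeReward (Mode.vacation j, 0) ≤ ENNReal.ofReal (c.K * c.Lv) := by
  have h1 : ∀ᵐ x ∂(inputLaw lam mu), c.timeReward ((Mode.vacation j, 0), x) ≤
      ENNReal.ofReal (c.K * c.Lv) := ae_regular.mono fun x hx => by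
    refine ENNReal.ofReal_le_ofReal ?_
    simp only [c.phaseTime_eq, Params.duration, Nat.cast_zero, zero_mul, zero_add, Nat.sub_zero]
    refine (Finset.sum_le_card_nsmul _ _ c.Lv fun n _ => ?_).trans (by simp)
    exact max_le (by linarith [hx.arrivalTime_pos n]) hc.Lv_nonneg
  refine (lintegral_mono_ae h1).trans ?_
  rw [lintegral_const, measure_univ, mul_one]

/-! ### Harmonic functions -/

/-- The solution of `d q = g q + (lam / mu) * d (q + 1)` with `d (K + 1) = 0`. -/
def slope (K : ℕ) (ρ : ℝ) (g : ℕ → ℝ) (q : ℕ) : ℝ :=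
  ∑ j ∈ Finset.range (K + 1 - q), g (q + j) * ρ ^ j

theorem slope_eq {K q : ℕ} (hq : q ≤ K) (ρ : ℝ) (g : ℕ → ℝ) :
    slope K ρ g q = g q + ρ * slope K ρ g (q + 1) := by
  rw [slope, slope, show K + 1 - q = K + 1 - (q + 1) + 1 by omega, Finset.sum_range_succ',
    Finset.mul_sum, add_comm]
  congr 1
  · simp
  · refine Finset.sum_congr rfl fun j _ => ?_
    rw [show q + (j + 1) = q + 1 + j by omega]
    ring

theorem slope_nonneg {K : ℕ} {ρ : ℝ} (hρ : 0 ≤ ρ) {g : ℕ → ℝ} (hg : ∀ q, 0 ≤ g q) (q : ℕ) :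
    0 ≤ slope K ρ g q :=
  Finset.sum_nonneg fun _ _ => mul_nonneg (hg _) (pow_nonneg hρ _)

/-- This is harmonicity of the potential, one level at a time. The equation for `κ` looks at the
first event in a service: with probability `r` it is an arrival, and by memorylessness the service
starts anew with `q + 1` packets; `(1 - r) * g q` is the mean reward until then. Subtracting `r`
times the identity at `q + 1` from the one at `q` leaves the recursion of `slope`, since `r = (1 -
r) * ρ`; hence the downward induction. -/
theorem slope_eq_add_sum {K : ℕ} {ρ r : ℝ} (hr : r = (1 - r) * ρ) {g κ : ℕ → ℝ}
    (hK : κ K = g K) (hκ : ∀ q < K, κ q = (1 - r) * g q + r * κ (q + 1)) {q : ℕ} (hq : q ≤ K) :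
    slope K ρ g q = κ q + ∑ j ∈ Finset.range (K - q), slope K ρ g (q + j) * r ^ (j + 1) := by
  obtain ⟨i, rfl⟩ : ∃ i, K = q + i := ⟨K - q, by omega⟩
  clear hq
  induction i generalizing q with
  | zero => simpa [slope] using hK.symm
  | succ i ih =>
    have h1 := slope_eq (show q ≤ q + (i + 1) by omega) ρ g
    have h2 := ih (q := q + 1) (by rw [show q + 1 + i = q + (i + 1) by omega]; exact hK)
      (fun q' h => hκ q' (by omega))
    rw [show q + 1 + i = q + (i + 1) by omega, show q + (i + 1) - (q + 1) = i by omega] at h2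
    rw [show q + (i + 1) - q = i + 1 by omega, Finset.sum_range_succ', hκ q (by omega)]
    have h3 : ∑ k ∈ Finset.range i, slope (q + (i + 1)) ρ g (q + (k + 1)) * r ^ (k + 1 + 1) =
        r * ∑ k ∈ Finset.range i, slope (q + (i + 1)) ρ g (q + 1 + k) * r ^ (k + 1) := by
      rw [Finset.mul_sum]
      refine Finset.sum_congr rfl fun k _ => ?_
      rw [show q + (k + 1) = q + 1 + k by omega]
      ring
    rw [h3, add_zero, zero_add, pow_one]
    have h4 : (1 - r) * slope (q + (i + 1)) ρ g q =
        (1 - r) * g q + r * slope (q + (i + 1)) ρ g (q + 1) := by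
      rw [h1]
      linear_combination (-slope (q + (i + 1)) ρ g (q + 1)) * hr
    linear_combination h4 + r * h2

/-- The sum of the first `n` slopes. -/
def potential (d : ℕ → ℝ) (n : ℕ) : ℝ := ∑ i ∈ Finset.range n, d (i + 1)

theorem potential_mono {d : ℕ → ℝ} (hd : ∀ q, 0 ≤ d q) : Monotone (potential d) :=
  fun _ _ h => Finset.sum_le_sum_of_subset_of_nonneg (Finset.range_mono h) fun _ _ _ => hd _

theorem potential_nonneg {d : ℕ → ℝ} (hd : ∀ q, 0 ≤ d q) (n : ℕ) : 0 ≤ potential d n :=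
  Finset.sum_nonneg fun _ _ => hd _

theorem sum_range_min (a : ℕ → ℝ) (M N : ℕ) :
    ∑ j ∈ Finset.range (min N M), a j = ∑ j ∈ Finset.range M, a j * if j < N then 1 else 0 := by
  simp only [mul_ite, mul_one, mul_zero]
  rw [← Finset.sum_filter]
  refine Finset.sum_congr ?_ fun _ _ => rfl
  ext j
  simp [and_comm]

theorem Params.stateAfter_busy_snd (c : Params) (q : ℕ) (y : Input) :
    (c.stateAfter (Mode.busy, q) y).2 = min (q + y.arrivals (y.service 0)) c.K - 1 := rfl

/-- The service removes one packet, and each admitted arrival adds one slope. The slope of `q + j`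
counts exactly if the arrival of index `j` precedes the end of the service; arrivals of index at
least `K - q` are rejected. -/
theorem potential_stateAfter {d : ℕ → ℝ} {q : ℕ} (hq : 1 ≤ q) (hqK : q ≤ c.K) {y : Input}
    (hy : y.Regular) :
    potential d (c.stateAfter (Mode.busy, q) y).2 = potential d (q - 1) +
      ∑ j ∈ Finset.range (c.K - q),
        d (q + j) * if y.arrivalTime j ≤ y.service 0 then 1 else 0 := by
  have h1 : (c.stateAfter (Mode.busy, q) y).2 =
      (q - 1) + min (y.arrivals (y.service 0)) (c.K - q) := by
    rw [c.stateAfter_busy_snd]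
    omega
  have h2 : ∀ j, q - 1 + j + 1 = q + j := fun j => by omega
  rw [h1, potential, Finset.sum_range_add, sum_range_min]
  simp only [h2, hy.lt_arrivals_iff]
  rfl

theorem lintegral_potential_stateAfter {d : ℕ → ℝ} (hd : ∀ q, 0 ≤ d q) {q : ℕ} (hq : 1 ≤ q)
    (hqK : q ≤ c.K) :
    ∫⁻ y, ENNReal.ofReal (potential d (c.stateAfter (Mode.busy, q) y).2) ∂(inputLaw lam mu) =
      ENNReal.ofReal (potential d (q - 1) +
        ∑ j ∈ Finset.range (c.K - q), d (q + j) * ratio lam mu ^ (j + 1)) := by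
  have h0 := ratio_nonneg (lam := lam) (mu := mu)
  have h1 : ∀ᵐ y ∂(inputLaw lam mu),
      ENNReal.ofReal (potential d (c.stateAfter (Mode.busy, q) y).2) =
      ENNReal.ofReal (potential d (q - 1)) + ∑ j ∈ Finset.range (c.K - q),
        ENNReal.ofReal (d (q + j)) * if y.arrivalTime j ≤ y.service 0 then 1 else 0 :=
    ae_regular.mono fun y hy => by
      have h2 : ∀ j, 0 ≤ d (q + j) * if y.arrivalTime j ≤ y.service 0 then 1 else 0 :=
        fun j => mul_nonneg (hd _) (by split_ifs <;> norm_num)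
      rw [potential_stateAfter hq hqK hy, ENNReal.ofReal_add (potential_nonneg hd _)
        (Finset.sum_nonneg fun j _ => h2 j), ENNReal.ofReal_sum_of_nonneg fun j _ => h2 j]
      congr 1
      refine Finset.sum_congr rfl fun j _ => ?_
      rw [ENNReal.ofReal_mul (hd _)]
      split_ifs <;> simp
  have hm : ∀ j, Measurable fun y : Input =>
      (if y.arrivalTime j ≤ y.service 0 then (1 : ℝ≥0∞) else 0) := fun j =>
    Measurable.ite (measurableSet_le (Input.measurable_arrivalTime j) (Input.measurable_service 0))
      measurable_const measurable_const
  rw [lintegral_congr_ae h1, lintegral_add_left measurable_const, lintegral_const, measure_univ,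
    mul_one, lintegral_finsetSum _ fun j _ => (hm j).const_mul _,
    ENNReal.ofReal_add (potential_nonneg hd _)
      (Finset.sum_nonneg fun j _ => mul_nonneg (hd _) (pow_nonneg h0 _)),
    ENNReal.ofReal_sum_of_nonneg fun j _ => mul_nonneg (hd _) (pow_nonneg h0 _)]
  congr 1
  refine Finset.sum_congr rfl fun j _ => ?_
  rw [lintegral_const_mul _ (hm j), lintegral_arrivalTime_le_service, ENNReal.ofReal_mul (hd _)]
  rfl

/-- The potential with the slopes `slope K ρ g` is harmonic if `κ q` is the mean reward of a
service that starts with `q` packets. -/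
theorem lintegral_potential_slope {g κ : ℕ → ℝ} (hg : ∀ q, 0 ≤ g q) (hκ0 : ∀ q, 0 ≤ κ q)
    (hK : κ c.K = g c.K)
    (hκ : ∀ q < c.K, κ q = (1 - ratio lam mu) * g q + ratio lam mu * κ (q + 1))
    {q : ℕ} (hq : 1 ≤ q) (hqK : q ≤ c.K) :
    ENNReal.ofReal (κ q) + ∫⁻ y, ENNReal.ofReal (potential (slope c.K (lam / mu) g)
        (c.stateAfter (Mode.busy, q) y).2) ∂(inputLaw lam mu) =
      ENNReal.ofReal (potential (slope c.K (lam / mu) g) q) := by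
  have hd : ∀ q, 0 ≤ slope c.K (lam / mu) g q :=
    slope_nonneg (div_pos hlam.out hmu.out).le hg
  have h0 := ratio_nonneg (lam := lam) (mu := mu)
  rw [lintegral_potential_stateAfter hd hq hqK, ← ENNReal.ofReal_add (hκ0 q)
    (add_nonneg (potential_nonneg hd _)
      (Finset.sum_nonneg fun j _ => mul_nonneg (hd _) (pow_nonneg h0 _)))]
  congr 1
  have h1 := slope_eq_add_sum ratio_eq hK hκ hqK
  obtain ⟨k, rfl⟩ : ∃ k, q = k + 1 := ⟨q - 1, by omega⟩
  have h2 : potential (slope c.K (lam / mu) g) (k + 1) =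
      potential (slope c.K (lam / mu) g) k + slope c.K (lam / mu) g (k + 1) :=
    Finset.sum_range_succ _ _
  rw [h2, Nat.add_sub_cancel]
  linarith

/-- A service ends the cycle exactly when it leaves the system empty, and there `U` vanishes anyway,
so stopping changes nothing. -/
theorem stopped_stateAfter_busy {V : Mode × ℕ → ℝ≥0∞} {U : ℕ → ℝ≥0∞} (hU0 : U 0 = 0)
    (hV : ∀ n, V (Mode.busy, n) = U n) (q : ℕ) (y : Input) :
    c.stopped V (c.stateAfter (Mode.busy, q) y) = U (c.stateAfter (Mode.busy, q) y).2 := by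
  have h : c.stateAfter (Mode.busy, q) y =
      (if (c.stateAfter (Mode.busy, q) y).2 = 0 then c.emptyMode 0 else Mode.busy,
        (c.stateAfter (Mode.busy, q) y).2) := rfl
  rw [h]
  generalize (c.stateAfter (Mode.busy, q) y).2 = n
  by_cases hn : n = 0
  · subst hn
    simp [Params.stopped, hU0]
  · simp only [Params.stopped, if_neg hn]
    rw [if_neg (c.emptyMode_ne_busy 0).symm, hV]

end Law

section Law

variable {lam mu : ℝ} [hlam : Fact (0 < lam)] [hmu : Fact (0 < mu)] {c : Params}

/-! ### A running cycle is integrable -/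

/-- `C` times a bound for the expected number of phases before the end of the cycle. -/
def Params.phaseBound (c : Params) (lam mu : ℝ) (C : ℝ≥0∞) : Mode × ℕ → ℝ≥0∞
  | (Mode.busy, n) => C * ENNReal.ofReal (potential (slope c.K (lam / mu) fun _ => 1) n)
  | (Mode.idle, _) => C + C * ENNReal.ofReal (potential (slope c.K (lam / mu) fun _ => 1) c.K)
  | (Mode.vacation j, _) => C * (c.Nv - j : ℕ) +
      (C + C * ENNReal.ofReal (potential (slope c.K (lam / mu) fun _ => 1) c.K))

theorem Params.stopped_le (c : Params) (V : Mode × ℕ → ℝ≥0∞) (s : Mode × ℕ) :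
    c.stopped V s ≤ V s := by
  unfold Params.stopped
  split_ifs
  · exact zero_le
  · exact le_rfl

theorem phaseBound_busy_le (C : ℝ≥0∞) {n : ℕ} (hn : n ≤ c.K) :
    c.phaseBound lam mu C (Mode.busy, n) ≤
      C * ENNReal.ofReal (potential (slope c.K (lam / mu) fun _ => 1) c.K) :=
  mul_le_mul_right (ENNReal.ofReal_le_ofReal (potential_mono
    (slope_nonneg (div_pos hlam.out hmu.out).le fun _ => zero_le_one) hn)) _

theorem lintegral_le_of_forall_le {f : Input → ℝ≥0∞} {C : ℝ≥0∞} (h : ∀ x, f x ≤ C) :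
    ∫⁻ x, f x ∂(inputLaw lam mu) ≤ C :=
  (lintegral_mono h).trans (by rw [lintegral_const, measure_univ, mul_one])

/-- A Lyapunov argument with `phaseBound`: the potential with `g = 1` counts the services to come,
idling adds one phase, and in state `vacation j` at most `Nv - j` vacations are left. With the
constant reward `1` it also shows that cycles end. -/
theorem tsum_phaseReward_lt_top (hc : c.Proper) {r : (Mode × ℕ) × Input → ℝ≥0∞}
    (hr : Measurable r) {C : ℝ≥0∞} (hC : C ≠ ∞)
    (h : ∀ s, c.Valid s.1 s.2 → meanReward lam mu r s ≤ C) :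
    ∑' m, c.phaseReward lam mu r m < ∞ := by
  refine (tsum_phaseReward_le hc hr (V := c.phaseBound lam mu C) ?_).trans_lt ?_
  · rintro ⟨s, q⟩ hs
    cases s with
    | busy =>
      have h1 : ∀ y, c.stopped (c.phaseBound lam mu C) (c.stateAfter (Mode.busy, q) y) =
          C * ENNReal.ofReal (potential (slope c.K (lam / mu) fun _ => 1)
            (c.stateAfter (Mode.busy, q) y).2) :=
        stopped_stateAfter_busy (U := fun n => C * ENNReal.ofReal
          (potential (slope c.K (lam / mu) fun _ => 1) n)) (by simp [potential]) (fun _ => rfl) q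
      simp only [h1]
      rw [lintegral_const_mul' _ _ hC]
      refine (add_le_add (h _ hs) le_rfl).trans ?_
      change _ ≤ C * ENNReal.ofReal (potential (slope c.K (lam / mu) fun _ => 1) q)
      -- The choice `g = κ = 1` rewards each service by one.
      rw [← lintegral_potential_slope (lam := lam) (mu := mu) (κ := fun _ => 1)
        (fun _ => zero_le_one) (fun _ => zero_le_one) rfl (fun _ _ => by ring) hs.1 hs.2]
      rw [mul_add, ENNReal.ofReal_one, mul_one]
    | idle =>
      exact add_le_add (h _ hs) (lintegral_le_of_forall_le fun y =>
        (c.stopped_le _ _).trans (phaseBound_busy_le C (min_le_right _ _)))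
    | vacation j =>
      have hj : j < c.Nv := hs.1
      have h1 : ∀ y, c.stopped (c.phaseBound lam mu C) (c.stateAfter (Mode.vacation j, q) y) ≤
          C * (c.Nv - (j + 1) : ℕ) +
            (C + C * ENNReal.ofReal (potential (slope c.K (lam / mu) fun _ => 1) c.K)) := by
        intro y
        refine (c.stopped_le _ _).trans ?_
        simp only [Params.stateAfter, Params.nextState]
        split_ifs with h0
        · unfold Params.emptyMode
          split_ifs with h2
          · exact le_rfl
          · exact le_add_self
        · exact (phaseBound_busy_le C (min_le_right _ _)).trans (le_add_self.trans le_add_self)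
      refine (add_le_add (h _ hs) (lintegral_le_of_forall_le h1)).trans (le_of_eq ?_)
      change _ = C * (c.Nv - j : ℕ) + _
      rw [show c.Nv - j = c.Nv - (j + 1) + 1 by omega, Nat.cast_add, mul_add, Nat.cast_one,
        mul_one, add_comm (C * _) C, add_assoc]
  · have hfin : C + C * ENNReal.ofReal (potential (slope c.K (lam / mu) fun _ => 1) c.K) < ∞ :=
      ENNReal.add_lt_top.2 ⟨hC.lt_top, ENNReal.mul_lt_top hC.lt_top ENNReal.ofReal_lt_top⟩
    unfold Params.emptyMode
    split_ifs
    · exact ENNReal.add_lt_top.2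
        ⟨ENNReal.mul_lt_top hC.lt_top (ENNReal.natCast_lt_top _), hfin⟩
    · exact hfin

/-- The sum is the mean number of phases in the first cycle. -/
theorem tsum_measure_alive_lt_top (hc : c.Proper) : ∑' m, inputLaw lam mu (c.alive m) < ∞ := by
  refine lt_of_eq_of_lt (tsum_congr fun m => ?_) (tsum_phaseReward_lt_top (lam := lam) (mu := mu)
    hc (r := fun _ => 1) measurable_const ENNReal.one_ne_top fun s _ => ?_)
  · exact (lintegral_indicator_one (measurableSet_alive c m)).symm
  · exact lintegral_le_of_forall_le fun _ => le_rfl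

theorem tendsto_measure_alive (hc : c.Proper) :
    Tendsto (fun m => inputLaw lam mu (c.alive m)) atTop (𝓝 0) :=
  ENNReal.tendsto_atTop_zero_of_tsum_ne_top (tsum_measure_alive_lt_top hc).ne

theorem ae_exists_isReturn (hc : c.Proper) :
    ∀ᵐ x ∂(inputLaw lam mu), ∃ n, c.IsReturn x n := by
  refine measure_eq_zero_iff_ae_notMem.1 ?_ |>.mono fun x hx => not_not.1 hx
  refine le_antisymm (ge_of_tendsto' (tendsto_measure_alive (lam := lam) (mu := mu) hc) fun m => ?_) zero_le
  exact measure_mono fun x hx => by_contra fun h => hx (c.exists_isReturn_of_notMem_alive h)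

theorem measurePreserving_nextCycle (hc : c.Proper) :
    MeasurePreserving c.nextCycle (inputLaw lam mu) (inputLaw lam mu) :=
  (splits_nextCycle hc (ae_exists_isReturn hc)).measurePreserving (measurable_nextCycle c)

/-- The first cycle ends almost surely; since `nextCycle` preserves the law, so does each of the
countably many later ones. -/
theorem ae_good (hc : c.Proper) : ∀ᵐ x ∂(inputLaw lam mu), c.Good x :=
  ae_regular.and (ae_all_iff.2 fun i => ((measurePreserving_nextCycle hc).iterate i
    ).quasiMeasurePreserving.ae (ae_exists_isReturn hc))

theorem Params.phaseTime_nonneg {c : Params} (hc : c.Proper) {x : Input} (hx : x.Regular)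
    {s : Mode} {q : ℕ} (h : c.Valid s q) : 0 ≤ c.phaseTime s q x :=
  add_nonneg (mul_nonneg (Nat.cast_nonneg _)
    (Params.start_lt_phaseEnd hc hx (p := freshPhase s q) h).le)
    (Finset.sum_nonneg fun _ _ => le_max_right _ _)

theorem lintegral_cycleTime (hc : c.Proper) :
    ∫⁻ x, ENNReal.ofReal (c.cycleTime x 0) ∂(inputLaw lam mu) =
      ∑' m, c.phaseReward lam mu c.timeReward m := by
  refine lintegral_cycleReward (measurable_timeReward c) (fun x hx n hn => ?_)
    (ae_exists_isReturn hc)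
  rw [cycleTime_zero_eq hn, Params.history, c.integral_queueLength_start hc hx]
  exact ENNReal.ofReal_sum_of_nonneg (s := Finset.range n)
    (f := fun j => c.phaseTime (c.phase x j).mode (c.phase x j).queue (c.residual x j))
    fun m _ => Params.phaseTime_nonneg hc (hx.shift _ _) (c.valid_phase hc hx m)

theorem lintegral_cycleArrivals (hc : c.Proper) :
    ∫⁻ x, ENNReal.ofReal (c.cycleArrivals x 0) ∂(inputLaw lam mu) =
      ∑' m, c.phaseReward lam mu c.arrivalReward m := by
  refine lintegral_cycleReward (measurable_arrivalReward c) (fun x hx n hn => ?_)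
    (ae_exists_isReturn hc)
  rw [cycleArrivals_zero_eq hx hn, Params.history, c.arrivals_start hc hx, ENNReal.ofReal_natCast]
  simp only [c.phaseEnd_freshPhase]
  push_cast
  rfl

theorem lintegral_cycleTime_lt_top (hc : c.Proper) :
    ∫⁻ x, ENNReal.ofReal (c.cycleTime x 0) ∂(inputLaw lam mu) < ∞ := by
  rw [lintegral_cycleTime hc]
  -- At most `K` packets are present, so a vacation contributes at most `K * Lv`, a service at most
  -- `K / mu` on average, and idling nothing.
  refine tsum_phaseReward_lt_top hc (measurable_timeReward c)
    (C := ENNReal.ofReal (c.K * c.Lv) + ENNReal.ofReal (c.K / mu))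
    (ENNReal.add_lt_top.2 ⟨ENNReal.ofReal_lt_top, ENNReal.ofReal_lt_top⟩).ne ?_
  rintro ⟨s, q⟩ hs
  have hmu' := hmu.out
  cases s with
  | busy =>
    rw [meanReward_time_busy]
    refine (ENNReal.ofReal_le_ofReal ?_).trans le_add_self
    have h0 := ratio_nonneg (lam := lam) (mu := mu)
    have h1 : ∑ n ∈ Finset.range (c.K - q), ratio lam mu ^ (n + 1) / mu ≤
        (c.K - q : ℕ) • (1 / mu) := by
      refine (Finset.sum_le_card_nsmul _ _ (1 / mu) fun n _ => ?_).trans (by simp)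
      exact div_le_div_of_nonneg_right (pow_le_one₀ h0 ratio_lt_one.le) hmu'.le
    have h2 : (c.K - q : ℕ) • (1 / mu) = (c.K - q) / mu := by
      rw [nsmul_eq_mul, Nat.cast_sub hs.2]
      ring
    calc _ ≤ q / mu + (c.K - q) / mu := by rw [← h2]; linarith
      _ = c.K / mu := by ring
  | idle =>
    obtain rfl : q = 0 := hs
    rw [meanReward_time_idle]
    exact zero_le
  | vacation j =>
    obtain rfl : q = 0 := hs.2
    exact (meanReward_time_vacation_le hc j).trans le_self_add

theorem lintegral_cycleArrivals_lt_top (hc : c.Proper) :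
    ∫⁻ x, ENNReal.ofReal (c.cycleArrivals x 0) ∂(inputLaw lam mu) < ∞ := by
  rw [lintegral_cycleArrivals hc]
  have h := lintegral_arrivals_lt_top (lam := lam) (mu := mu) c.Lv
  refine tsum_phaseReward_lt_top hc (measurable_arrivalReward c)
    (C := ∫⁻ x, (x.arrivals c.Lv : ℝ≥0∞) ∂(inputLaw lam mu) + (1 + ENNReal.ofReal (lam / mu)))
    (by simp [h.ne]) ?_
  rintro ⟨s, q⟩ hs
  cases s with
  | busy =>
    rw [meanReward_arrival_busy]
    exact le_add_self.trans le_add_self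
  | idle =>
    rw [meanReward_arrival_idle]
    exact le_self_add.trans le_add_self
  | vacation j => exact le_self_add

theorem Params.Good.cycleTime_nonneg {c : Params} (hc : c.Proper) {x : Input} (h : c.Good x)
    (i : ℕ) : 0 ≤ c.cycleTime x i :=
  intervalIntegral.integral_nonneg ((h.strictMono_cycleStart hc).monotone i.le_succ)
    fun _ _ => Nat.cast_nonneg _

theorem Params.cycleArrivals_nonneg (c : Params) (x : Input) (i : ℕ) :
    0 ≤ c.cycleArrivals x i := Nat.cast_nonneg _

theorem integrable_cycleTime (hc : c.Proper) :
    Integrable (fun x => c.cycleTime x 0) (inputLaw lam mu) := by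
  refine (lintegral_ofReal_ne_top_iff_integrable
    (measurable_cycleTime c 0).aestronglyMeasurable ?_).1 (lintegral_cycleTime_lt_top hc).ne
  exact (ae_good hc).mono fun x hx => hx.cycleTime_nonneg hc 0

theorem integrable_cycleArrivals (hc : c.Proper) :
    Integrable (fun x => c.cycleArrivals x 0) (inputLaw lam mu) := by
  refine (lintegral_ofReal_ne_top_iff_integrable
    (measurable_cycleArrivals c 0).aestronglyMeasurable ?_).1
      (lintegral_cycleArrivals_lt_top hc).ne
  exact ae_of_all _ fun x => c.cycleArrivals_nonneg x 0

theorem Params.Good.one_le_cycleArrivals {c : Params} (hc : c.Proper) {x : Input} (h : c.Good x) :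
    1 ≤ c.cycleArrivals x 0 := by
  rw [Params.cycleArrivals, c.cycleStart_zero, h.regular.arrivals_zero, Nat.sub_zero]
  exact_mod_cast h.one_le_arrivals hc

/-! ### The mean running cycle of the queue without policy -/

/-- The expected reward of a running cycle of the queue without policy. -/
def noPolicyValue (K : ℕ) (lam mu a : ℝ) (g : ℕ → ℝ) : Mode × ℕ → ℝ≥0∞
  | (Mode.busy, n) => ENNReal.ofReal (potential (slope K (lam / mu) g) n)
  | (Mode.idle, _) => ENNReal.ofReal (a + slope K (lam / mu) g 1)
  | (Mode.vacation _, _) => 0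

/-- The idle phase ends with one packet present and the server busy, so its value is `a` plus the
potential at `1`, which is the first slope. With the potential itself on busy states this function
is harmonic and bounded, hence it is the expected reward. -/
theorem tsum_phaseReward_noPolicy {K : ℕ} (hK : 1 ≤ K) {r : (Mode × ℕ) × Input → ℝ≥0∞}
    (hr : Measurable r) {g κ : ℕ → ℝ} (hg : ∀ q, 0 ≤ g q) (hκ0 : ∀ q, 0 ≤ κ q) (hκK : κ K = g K)
    (hκ : ∀ q < K, κ q = (1 - ratio lam mu) * g q + ratio lam mu * κ (q + 1))
    (hbusy : ∀ q, meanReward lam mu r (Mode.busy, q) = ENNReal.ofReal (κ q))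
    {a : ℝ} (ha : 0 ≤ a) (hidle : meanReward lam mu r (Mode.idle, 0) = ENNReal.ofReal a) :
    ∑' m, (noPolicy K).phaseReward lam mu r m = ENNReal.ofReal (a + slope K (lam / mu) g 1) := by
  have hc : (noPolicy K).Proper := Params.noPolicy_proper (c := noPolicy K) hK
  have hd : ∀ q, 0 ≤ slope K (lam / mu) g q := slope_nonneg (div_pos hlam.out hmu.out).le hg
  have hV : noPolicyValue K lam mu a g ((noPolicy K).emptyMode 0, 0) =
      ENNReal.ofReal (a + slope K (lam / mu) g 1) := by
    rw [noPolicy_emptyMode]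
    rfl
  rw [← hV]
  refine tsum_phaseReward_eq hc hr ?_ (C := ENNReal.ofReal (potential (slope K (lam / mu) g) K) +
    ENNReal.ofReal (a + slope K (lam / mu) g 1)) (by simp) ?_ (tendsto_measure_alive hc)
  · rintro ⟨s, q⟩ hs
    cases s with
    | busy =>
      have h1 : ∀ y, (noPolicy K).stopped (noPolicyValue K lam mu a g)
          ((noPolicy K).stateAfter (Mode.busy, q) y) =
            ENNReal.ofReal (potential (slope K (lam / mu) g)
              ((noPolicy K).stateAfter (Mode.busy, q) y).2) :=
        stopped_stateAfter_busy (U := fun n => ENNReal.ofReal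
          (potential (slope K (lam / mu) g) n)) (by simp [potential]) (fun _ => rfl) q
      simp only [h1]
      rw [hbusy]
      exact lintegral_potential_slope (c := noPolicy K) hg hκ0 hκK hκ hs.1 hs.2
    | idle =>
      obtain rfl : q = 0 := hs
      have h1 : ∀ᵐ y ∂(inputLaw lam mu), (noPolicy K).stopped (noPolicyValue K lam mu a g)
          ((noPolicy K).stateAfter (Mode.idle, 0) y) =
            ENNReal.ofReal (slope K (lam / mu) g 1) := ae_regular.mono fun y hy => by
        have h2 : (noPolicy K).stateAfter (Mode.idle, 0) y = (Mode.busy, 1) := by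
          simp only [Params.stateAfter, Params.nextState]
          rw [Params.duration, hy.arrivals_zero, hy.arrivals_arrivalTime]
          simp [noPolicy, hK]
        rw [h2, Params.stopped, noPolicy_emptyMode, if_neg (by simp)]
        simp [noPolicyValue, potential]
      rw [lintegral_congr_ae h1, lintegral_const, measure_univ, mul_one, hidle,
        ← ENNReal.ofReal_add ha (hd 1)]
      rfl
    | vacation j => exact absurd hs.1 (Nat.not_lt_zero j)
  · rintro ⟨s, q⟩ hs
    cases s with
    | busy =>
      exact (ENNReal.ofReal_le_ofReal (potential_mono hd hs.2)).trans le_self_add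
    | idle => exact le_add_self
    | vacation j => exact zero_le

/-- Here `g = κ = ρ`, the mean number of arrivals in a service, rejected ones included, and `a = 1`
for the arrival that ends the idle period. -/
theorem integral_cycleArrivals_noPolicy {K : ℕ} (hK : 1 ≤ K) :
    ∫ x, (noPolicy K).cycleArrivals x 0 ∂(inputLaw lam mu) =
      ∑ j ∈ Finset.range (K + 1), (lam / mu) ^ j := by
  have hc : (noPolicy K).Proper := Params.noPolicy_proper (c := noPolicy K) hK
  have hρ : 0 ≤ lam / mu := (div_pos hlam.out hmu.out).le
  have h := tsum_phaseReward_noPolicy (lam := lam) (mu := mu) hK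
    (measurable_arrivalReward (noPolicy K)) (g := fun _ => lam / mu) (κ := fun _ => lam / mu)
    (fun _ => hρ) (fun _ => hρ) rfl (fun _ _ => by ring)
    (meanReward_arrival_busy _) zero_le_one
    (by rw [meanReward_arrival_idle, ENNReal.ofReal_one])
  rw [integral_eq_lintegral_of_nonneg_ae
    (ae_of_all _ fun x => (noPolicy K).cycleArrivals_nonneg x 0)
    (measurable_cycleArrivals _ 0).aestronglyMeasurable, lintegral_cycleArrivals hc, h,
    ENNReal.toReal_ofReal (add_nonneg zero_le_one (slope_nonneg hρ (fun _ => hρ) 1)),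
    Finset.sum_range_succ', slope, Nat.add_sub_cancel]
  simp only [pow_succ, pow_zero]
  rw [add_comm]
  congr 1
  exact Finset.sum_congr rfl fun j _ => mul_comm _ _

/-- Here `g q = q / mu` and `a = 0`. The function `κ` is larger than `g` below `K` because admitted
arrivals also wait during the current service. -/
theorem integral_cycleTime_noPolicy {K : ℕ} (hK : 1 ≤ K) :
    ∫ x, (noPolicy K).cycleTime x 0 ∂(inputLaw lam mu) =
      (∑ j ∈ Finset.range K, (j + 1) * (lam / mu) ^ j) / mu := by
  have hc : (noPolicy K).Proper := Params.noPolicy_proper (c := noPolicy K) hK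
  have hρ : 0 ≤ lam / mu := (div_pos hlam.out hmu.out).le
  have hmu' := hmu.out
  have h0 := ratio_nonneg (lam := lam) (mu := mu)
  have hg : ∀ q : ℕ, 0 ≤ (q : ℝ) / mu := fun q => by positivity
  have h := tsum_phaseReward_noPolicy (lam := lam) (mu := mu) hK
    (measurable_timeReward (noPolicy K)) (g := fun q => q / mu)
    (κ := fun q => q / mu + ∑ n ∈ Finset.range (K - q), ratio lam mu ^ (n + 1) / mu)
    hg (fun q => add_nonneg (hg q) (Finset.sum_nonneg fun n _ => by positivity)) (by simp)
    (fun q hq => by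
      have h1 : ∑ n ∈ Finset.range (K - (q + 1)), ratio lam mu ^ (n + 1 + 1) / mu =
          ratio lam mu * ∑ n ∈ Finset.range (K - (q + 1)), ratio lam mu ^ (n + 1) / mu := by
        rw [Finset.mul_sum]
        exact Finset.sum_congr rfl fun n _ => by ring
      rw [show K - q = K - (q + 1) + 1 by omega, Finset.sum_range_succ', h1]
      push_cast
      ring)
    (meanReward_time_busy _) le_rfl
    (by rw [meanReward_time_idle, ENNReal.ofReal_zero])
  rw [integral_eq_lintegral_of_nonneg_ae ((ae_good hc).mono fun x hx => hx.cycleTime_nonneg hc 0)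
    (measurable_cycleTime _ 0).aestronglyMeasurable, lintegral_cycleTime hc, h,
    ENNReal.toReal_ofReal (add_nonneg le_rfl (slope_nonneg hρ hg 1)), zero_add, slope,
    Nat.add_sub_cancel, Finset.sum_div]
  refine Finset.sum_congr rfl fun j _ => ?_
  push_cast
  ring

theorem sum_range_succ_mul_pow (K : ℕ) (ρ : ℝ) :
    (1 - ρ) ^ 2 * ∑ j ∈ Finset.range K, (j + 1) * ρ ^ j =
      1 + K * ρ ^ (K + 1) - (K + 1) * ρ ^ K := by
  induction K with
  | zero => simp
  | succ K ih =>
    rw [Finset.sum_range_succ, mul_add, ih]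
    push_cast
    ring

theorem integral_cycleTime_div_noPolicy (hne : lam ≠ mu) {K : ℕ} (hK : 1 ≤ K) :
    (∫ x, (noPolicy K).cycleTime x 0 ∂(inputLaw lam mu)) /
      (∫ x, (noPolicy K).cycleArrivals x 0 ∂(inputLaw lam mu)) = waitingTime lam mu K := by
  have h1 := hlam.out
  have h2 := hmu.out
  have hρ : lam / mu ≠ 1 := fun h => hne (eq_of_div_eq_one h)
  have hρ0 : 0 < lam / mu := div_pos h1 h2
  have hρ1 : 1 - lam / mu ≠ 0 := sub_ne_zero.2 hρ.symm
  have hpow : 1 - (lam / mu) ^ (K + 1) ≠ 0 := sub_ne_zero.2 fun h =>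
    hρ ((pow_eq_one_iff_of_nonneg hρ0.le (Nat.succ_ne_zero K)).1 h.symm)
  rw [integral_cycleArrivals_noPolicy hK, integral_cycleTime_noPolicy hK, geom_sum_eq hρ,
    waitingTime, ← sum_range_succ_mul_pow]
  generalize ∑ j ∈ Finset.range K, ((j : ℝ) + 1) * (lam / mu) ^ j = T
  -- The factor `ρ / lam` of `waitingTime` is the `1 / mu` of the mean cycle time.
  have h3 : mu⁻¹ = lam / mu * lam⁻¹ := by field_simp
  rw [div_eq_mul_inv T mu, h3]
  have h4 : (lam / mu) ^ (K + 1) - 1 ≠ 0 := sub_ne_zero.2 (sub_ne_zero.1 hpow).symm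
  have h5 : lam / mu - 1 ≠ 0 := sub_ne_zero.2 hρ
  generalize lam / mu = ρ at *
  field_simp
  ring

end Law

section Law

variable {lam mu : ℝ} [hlam : Fact (0 < lam)] [hmu : Fact (0 < mu)] {c : Params}

/-! ### The law of a random input -/

theorem map_inputLaw_eq_infinitePi :
    (inputLaw lam mu).map (fun x => (Sum.elim x.gap x.service : ℕ ⊕ ℕ → ℝ)) =
      Measure.infinitePi (Sum.elim (fun _ => expMeasure lam) fun _ => expMeasure mu) := by
  have : ∀ i : ℕ ⊕ ℕ, IsProbabilityMeasure
      ((Sum.elim (fun _ => expMeasure lam) fun _ => expMeasure mu : ℕ ⊕ ℕ → Measure ℝ) i) :=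
    fun i => by cases i <;> simp only [Sum.elim_inl, Sum.elim_inr] <;> infer_instance
  have hm : Measurable fun x : Input => (Sum.elim x.gap x.service : ℕ ⊕ ℕ → ℝ) :=
    measurable_pi_iff.2 fun i => by
      cases i with
      | inl n => exact Input.measurable_gap n
      | inr n => exact Input.measurable_service n
  refine Measure.eq_infinitePi _ fun s t ht => ?_
  have hpre : (fun z : (ℕ → ℝ) × (ℕ → ℝ) => Input.mk z.1 z.2) ⁻¹'
      ((fun x : Input => (Sum.elim x.gap x.service : ℕ ⊕ ℕ → ℝ)) ⁻¹' Set.pi s t) =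
      (Set.pi s.toLeft fun n => t (Sum.inl n)) ×ˢ (Set.pi s.toRight fun n => t (Sum.inr n)) := by
    ext z
    simp [Set.mem_pi, Sum.forall]
  have hpi : MeasurableSet (Set.pi s t) :=
    MeasurableSet.pi s.countable_toSet fun i _ => ht i
  rw [Measure.map_apply hm hpi, inputLaw, Measure.map_apply measurable_mk_pair (hm hpi), hpre,
    Measure.prod_prod, Measure.infinitePi_pi _ fun n _ => ht (Sum.inl n),
    Measure.infinitePi_pi _ fun n _ => ht (Sum.inr n), ← s.toLeft_disjSum_toRight,
    Finset.prod_disjSum]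
  simp

theorem measurePreserving_randomInput {Ω : Type*} [MeasurableSpace Ω] {P : Measure Ω}
    [IsProbabilityMeasure P] {X S : ℕ → Ω → ℝ} (hX : ∀ n, Measurable (X n))
    (hS : ∀ n, Measurable (S n)) (hXlaw : ∀ n, P.map (X n) = expMeasure lam)
    (hSlaw : ∀ n, P.map (S n) = expMeasure mu) (hindep : iIndepFun (Sum.elim X S) P) :
    MeasurePreserving (randomInput X S) P (inputLaw lam mu) := by
  have hm : ∀ i, Measurable (Sum.elim X S i) := fun i => by
    cases i with
    | inl n => exact hX n
    | inr n => exact hS n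
  have hx : Measurable (randomInput X S) :=
    measurable_input_mk (measurable_pi_iff.2 hX) (measurable_pi_iff.2 hS)
  have hg : Measurable fun h : ℕ ⊕ ℕ → ℝ =>
      Input.mk (fun n => h (Sum.inl n)) fun n => h (Sum.inr n) :=
    measurable_input_mk (measurable_pi_iff.2 fun n => measurable_pi_apply (Sum.inl n))
      (measurable_pi_iff.2 fun n => measurable_pi_apply (Sum.inr n))
  have h1 := hindep.map_fun_eq_infinitePi_map hm
  have h2 : (fun i => P.map (Sum.elim X S i)) =
      (Sum.elim (fun _ => expMeasure lam) fun _ => expMeasure mu : ℕ ⊕ ℕ → Measure ℝ) := by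
    funext i
    cases i with
    | inl n => exact hXlaw n
    | inr n => exact hSlaw n
  have hm' : Measurable fun x : Input => (Sum.elim x.gap x.service : ℕ ⊕ ℕ → ℝ) :=
    measurable_pi_iff.2 fun i => by
      cases i with
      | inl n => exact Input.measurable_gap n
      | inr n => exact Input.measurable_service n
  refine ⟨hx, ?_⟩
  have h3 := congrArg (Measure.map fun h : ℕ ⊕ ℕ → ℝ =>
      Input.mk (fun n => h (Sum.inl n)) fun n => h (Sum.inr n)) (map_inputLaw_eq_infinitePi
        (lam := lam) (mu := mu))
  rw [Measure.map_map hg hm'] at h3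
  have h4 : ((fun h : ℕ ⊕ ℕ → ℝ => Input.mk (fun n => h (Sum.inl n)) fun n => h (Sum.inr n)) ∘
      fun x : Input => (Sum.elim x.gap x.service : ℕ ⊕ ℕ → ℝ)) = id := rfl
  rw [h4, Measure.map_id] at h3
  rw [h3]
  simp only [← h2, ← h1]
  rw [Measure.map_map hg (measurable_pi_iff.2 hm)]
  rfl

/-! ### Cycles without an arrival during the vacations -/

/-- No packet arrives during the vacations of the first running cycle. -/
def Params.noArrivalSet (c : Params) : Set Input := {x | c.Nv * c.Lv < x.gap 0}

/-- The input that remains after the vacations of the first running cycle. -/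
def Params.afterVacations (c : Params) (x : Input) : Input := x.shift (c.Nv * c.Lv) 0

theorem measurableSet_noArrivalSet (c : Params) : MeasurableSet c.noArrivalSet :=
  measurableSet_lt measurable_const (Input.measurable_gap 0)

theorem measurable_afterVacations (c : Params) : Measurable c.afterVacations :=
  measurable_shift measurable_id measurable_const measurable_const

theorem measure_noArrivalSet (hc : c.Proper) : inputLaw lam mu c.noArrivalSet =
    ENNReal.ofReal (Real.exp (-(lam * (c.Nv * c.Lv)))) := by
  rw [← expMeasure_Ioi hc.vacations_nonneg, ← map_gap (lam := lam) (mu := mu) 0,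
    Measure.map_apply (Input.measurable_gap 0) measurableSet_Ioi]
  rfl

theorem measure_noArrivalSet_ne_zero (hc : c.Proper) : inputLaw lam mu c.noArrivalSet ≠ 0 := by
  rw [measure_noArrivalSet hc]
  exact (ENNReal.ofReal_pos.2 (Real.exp_pos _)).ne'

/-- The arrivals after the vacations have the law of all the arrivals. -/
theorem map_afterVacations (hc : c.Proper) :
    ((inputLaw lam mu).restrict c.noArrivalSet).map c.afterVacations =
      inputLaw lam mu c.noArrivalSet • inputLaw lam mu := by
  have hv := hc.vacations_nonneg
  refine Measure.ext_of_lintegral _ fun F hF => ?_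
  rw [lintegral_map hF (measurable_afterVacations c), lintegral_smul_measure,
    ← lintegral_indicator (measurableSet_noArrivalSet c), measure_noArrivalSet hc,
    lintegral_consGap (f := c.noArrivalSet.indicator fun a => F (c.afterVacations a))
      ((hF.comp (measurable_afterVacations c)).indicator (measurableSet_noArrivalSet c)), lintegral_consGap hF, smul_eq_mul,
    ← lintegral_expMeasure_memoryless hv (Measurable.lintegral_prod_right'
      (f := fun z : ℝ × Input => F (z.2.consGap z.1))
      (hF.comp (measurable_consGap measurable_fst measurable_snd)))]
  -- Only the first gap is affected by the vacations: on the event it is shortened by `Nv * Lv`,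
  -- while the other gaps and the services stay as they are.
  refine lintegral_congr_ae ((ae_expMeasure_pos lam).mono fun t ht => ?_)
  by_cases h : c.Nv * c.Lv < t
  · simp only [Set.indicator_of_mem (Set.mem_Ioi.2 h)]
    refine lintegral_congr_ae (ae_regular.mono fun y hy => ?_)
    have h1 : y.consGap t ∈ c.noArrivalSet := h
    simp only [Set.indicator_of_mem h1, Params.afterVacations]
    rw [hy.shift_consGap_of_lt ht h]
  · rw [Set.indicator_of_notMem (fun h' => h (Set.mem_Ioi.1 h'))]
    refine lintegral_eq_zero_of_ae_eq_zero (ae_of_all _ fun y => ?_)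
    exact Set.indicator_of_notMem (s := c.noArrivalSet) (show y.consGap t ∉ _ from h) _

theorem measurePreserving_afterVacations (hc : c.Proper) :
    MeasurePreserving c.afterVacations (cond (inputLaw lam mu) c.noArrivalSet)
      (inputLaw lam mu) := by
  refine ⟨measurable_afterVacations c, ?_⟩
  rw [ProbabilityTheory.cond, Measure.map_smul, map_afterVacations hc, smul_smul,
    ENNReal.inv_mul_cancel (measure_noArrivalSet_ne_zero hc) (measure_ne_top _ _), one_smul]

theorem ae_afterVacations (hc : c.Proper) {p : Input → Prop} (hp : ∀ᵐ x ∂(inputLaw lam mu), p x) :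
    ∀ᵐ x ∂(inputLaw lam mu), x ∈ c.noArrivalSet → p (c.afterVacations x) := by
  refine ae_imp_of_ae_restrict (ae_of_ae_map (measurable_afterVacations c).aemeasurable ?_)
  rw [map_afterVacations hc]
  exact Measure.ae_smul_measure hp _

theorem ae_good_afterVacations (hc : c.Proper) :
    ∀ᵐ x ∂(inputLaw lam mu), x ∈ c.noArrivalSet → (noPolicy c.K).Good (c.afterVacations x) :=
  ae_afterVacations hc (ae_good (c.noPolicy_proper hc.one_le_K))

theorem ae_cycle_of_noArrival (hc : c.Proper) :
    ∀ᵐ x ∂(inputLaw lam mu), x ∈ c.noArrivalSet →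
      c.nextCycle x = (noPolicy c.K).nextCycle (c.afterVacations x) ∧
      c.cycleTime x 0 = (noPolicy c.K).cycleTime (c.afterVacations x) 0 ∧
      c.cycleArrivals x 0 = (noPolicy c.K).cycleArrivals (c.afterVacations x) 0 ∧
      c.activePath x 0 = (noPolicy c.K).activePath (c.afterVacations x) 0 := by
  filter_upwards [ae_good hc, ae_good_afterVacations hc] with x hx h hA
  exact ⟨c.nextCycle_of_noArrival hc hx.1 hA (h hA), c.cycleTime_of_noArrival hc hx.1 hA (h hA) hx,
    c.cycleArrivals_of_noArrival hc hx.1 hA (h hA),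
    c.activePath_of_noArrival hc hx.1 hA (h hA) hx⟩

theorem integral_indicator_noArrivalSet (hc : c.Proper) {f f₀ : Input → ℝ}
    (hf₀ : Measurable f₀)
    (h : ∀ᵐ x ∂(inputLaw lam mu), x ∈ c.noArrivalSet → f x = f₀ (c.afterVacations x)) :
    ∫ x, c.noArrivalSet.indicator f x ∂(inputLaw lam mu) =
      (inputLaw lam mu).real c.noArrivalSet * ∫ x, f₀ x ∂(inputLaw lam mu) := by
  rw [integral_indicator (measurableSet_noArrivalSet c),
    setIntegral_congr_ae (measurableSet_noArrivalSet c) h,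
    ← integral_map (f := f₀) (measurable_afterVacations c).aemeasurable
      hf₀.aestronglyMeasurable, map_afterVacations hc, integral_smul_measure]
  rfl

/-- `splits_nextCycle` does not record whether packets arrived during the vacations, so independence
with the indicator needs an argument. On the event, `f` and the next input are those of the queue
without policy after the vacations, where independence is given. Off the event the indicator is `0`,
and only the law of the next input there is needed. -/
theorem indepFun_indicator_noArrivalSet (hc : c.Proper) {f f₀ : Input → ℝ}
    (hf₀ : Measurable f₀)
    (h : ∀ᵐ x ∂(inputLaw lam mu), x ∈ c.noArrivalSet → f x = f₀ (c.afterVacations x))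
    (hi : IndepFun f₀ (noPolicy c.K).nextCycle (inputLaw lam mu)) :
    IndepFun (c.noArrivalSet.indicator f) c.nextCycle (inputLaw lam mu) := by
  set M := inputLaw lam mu
  set A := c.noArrivalSet
  have hA : MeasurableSet A := measurableSet_noArrivalSet c
  have hR := measurable_nextCycle c
  have hR₀ := measurable_nextCycle (noPolicy c.K)
  have hMR : ∀ {C : Set Input}, MeasurableSet C → M.real (c.nextCycle ⁻¹' C) = M.real C :=
    fun hC => (measurePreserving_nextCycle hc).measureReal_preimage hC.nullMeasurableSet
  have hMR₀ : ∀ {C : Set Input}, MeasurableSet C →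
      M.real ((noPolicy c.K).nextCycle ⁻¹' C) = M.real C := fun hC =>
    (measurePreserving_nextCycle (c.noPolicy_proper hc.one_le_K)).measureReal_preimage
      hC.nullMeasurableSet
  -- the part of an event in `A`
  have hpart : ∀ {B : Set ℝ} {C : Set Input}, MeasurableSet B → MeasurableSet C →
      M.real (A.indicator f ⁻¹' B ∩ c.nextCycle ⁻¹' C ∩ A) =
        M.real A * (M.real (f₀ ⁻¹' B) * M.real C) := by
    intro B C hB hC
    have h1 : (A.indicator f ⁻¹' B ∩ c.nextCycle ⁻¹' C ∩ A : Set Input) =ᵐ[M]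
        (c.afterVacations ⁻¹' (f₀ ⁻¹' B ∩ (noPolicy c.K).nextCycle ⁻¹' C) ∩ A : Set Input) := by
      filter_upwards [h, ae_cycle_of_noArrival hc] with x hx hx'
      refine propext (and_congr_left fun hxA : x ∈ A => ?_)
      change A.indicator f x ∈ B ∧ c.nextCycle x ∈ C ↔ _ ∈ B ∧ _ ∈ C
      rw [Set.indicator_of_mem hxA, hx hxA, (hx' hxA).1]
    have h2 : MeasurableSet (f₀ ⁻¹' B ∩ (noPolicy c.K).nextCycle ⁻¹' C) :=
      (hf₀ hB).inter (hR₀ hC)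
    have h3 := congrArg (fun ν : Measure Input =>
      ν.real (f₀ ⁻¹' B ∩ (noPolicy c.K).nextCycle ⁻¹' C)) (map_afterVacations
        (lam := lam) (mu := mu) hc)
    rw [measureReal_congr h1, ← hMR₀ hC]
    rw [map_measureReal_apply (measurable_afterVacations c) h2,
      measureReal_restrict_apply (measurable_afterVacations c h2),
      measureReal_ennreal_smul_apply] at h3
    rw [h3]
    have h4 := hi.measure_inter_preimage_eq_mul _ _ hB hC
    rw [measureReal_def M (_ ∩ _), h4, ENNReal.toReal_mul]
    rfl
  have hcompl : ∀ {B : Set ℝ} {C : Set Input}, MeasurableSet C →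
      M.real ((A.indicator f ⁻¹' B ∩ c.nextCycle ⁻¹' C) \ A) =
        B.indicator 1 (0 : ℝ) * ((1 - M.real A) * M.real C) := by
    intro B C hC
    -- By subtraction: `nextCycle` preserves the law, and the part inside `A` is known from `hpart`
    -- with `B = univ`.
    have h1 : M.real (c.nextCycle ⁻¹' C \ A) = (1 - M.real A) * M.real C := by
      have h2 := measureReal_inter_add_sdiff (μ := M) (s := c.nextCycle ⁻¹' C) hA
      have h3 := hpart (B := Set.univ) MeasurableSet.univ hC
      rw [Set.preimage_univ, Set.univ_inter, Set.preimage_univ, probReal_univ, one_mul] at h3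
      rw [h3, hMR hC] at h2
      linarith
    by_cases hB : (0 : ℝ) ∈ B
    · rw [Set.indicator_of_mem hB, Pi.one_apply, one_mul, ← h1]
      congr 1
      ext x
      refine and_congr_left fun hx : x ∉ A => ?_
      change A.indicator f x ∈ B ∧ _ ↔ _
      rw [Set.indicator_of_notMem hx]
      simp [hB]
    · rw [Set.indicator_of_notMem hB, zero_mul]
      have : (A.indicator f ⁻¹' B ∩ c.nextCycle ⁻¹' C) \ A = ∅ := by
        refine Set.eq_empty_of_forall_notMem fun x hx => ?_
        have h2 : A.indicator f x ∈ B := hx.1.1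
        rw [Set.indicator_of_notMem hx.2] at h2
        exact hB h2
      rw [this, measureReal_empty]
  have htot : ∀ {B : Set ℝ} {C : Set Input}, MeasurableSet B → MeasurableSet C →
      M.real (A.indicator f ⁻¹' B ∩ c.nextCycle ⁻¹' C) =
        (M.real A * M.real (f₀ ⁻¹' B) + B.indicator 1 (0 : ℝ) * (1 - M.real A)) * M.real C := by
    intro B C hB hC
    rw [← measureReal_inter_add_sdiff (μ := M) hA, hpart hB hC, hcompl hC]
    ring
  rw [indepFun_iff_measure_inter_preimage_eq_mul]
  intro B C hB hC
  have h1 := htot hB hC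
  have h2 := htot hB MeasurableSet.univ
  rw [Set.preimage_univ, Set.inter_univ, probReal_univ, mul_one] at h2
  rw [← h2, ← hMR hC] at h1
  rw [← ENNReal.toReal_eq_toReal_iff' (measure_ne_top _ _)
    (ENNReal.mul_ne_top (measure_ne_top _ _) (measure_ne_top _ _)), ENNReal.toReal_mul]
  exact h1

end Law

/-! ### Limits of averages over the cycles -/

theorem indepFun_comp_of_measurePreserving {Z E F : Type*} [MeasurableSpace Z]
    [MeasurableSpace E] [MeasurableSpace F] {M : Measure Z} {T : Z → Z}
    (hT : MeasurePreserving T M M) {f : Z → E} {g : Z → F} (hf : Measurable f) (hg : Measurable g)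
    (h : IndepFun f g M) : IndepFun (f ∘ T) (g ∘ T) M := by
  rw [indepFun_iff_measure_inter_preimage_eq_mul] at h ⊢
  intro A B hA hB
  simp only [Set.preimage_comp, ← Set.preimage_inter]
  rw [hT.measure_preimage ((hf hA).inter (hg hB)).nullMeasurableSet,
    hT.measure_preimage (hf hA).nullMeasurableSet, hT.measure_preimage (hg hB).nullMeasurableSet,
    h A B hA hB]

/-- The strong law of large numbers for a transformation `R` that renews the system. -/
theorem strong_law_iterate {Z : Type*} [MeasurableSpace Z] {M : Measure Z} {R : Z → Z}
    (hR : MeasurePreserving R M M) {φ : Z → ℝ} (hφ : Measurable φ) (hint : Integrable φ M)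
    (hind : IndepFun φ R M) :
    ∀ᵐ x ∂M, Tendsto (fun n : ℕ => (∑ i ∈ Finset.range n, φ (R^[i] x)) / n) atTop
      (𝓝 (∫ x, φ x ∂M)) := by
  -- A later term is a function of `R` composed with `R^[i]`, so it is independent of the term `i`
  -- by invariance. Pairwise independence is all that the strong law requires.
  have hlt : ∀ i k : ℕ, IndepFun (φ ∘ R^[i]) (φ ∘ R^[i + 1 + k]) M := fun i k => by
    have h1 : IndepFun φ ((φ ∘ R^[k]) ∘ R) M :=
      hind.comp measurable_id (hφ.comp (hR.iterate k).measurable)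
    have h2 := indepFun_comp_of_measurePreserving (hR.iterate i) hφ
      ((hφ.comp (hR.iterate k).measurable).comp hR.measurable) h1
    have h3 : φ ∘ R^[i + 1 + k] = ((φ ∘ R^[k]) ∘ R) ∘ R^[i] := by
      funext x
      simp only [Function.comp_apply]
      rw [← Function.iterate_succ_apply' R i x, ← Function.iterate_add_apply]
      congr 2
      omega
    rw [h3]
    exact h2
  refine strong_law_ae_real (fun i => φ ∘ R^[i]) hint (fun i j hij => ?_) fun i => ?_
  · rcases Nat.lt_or_gt_of_ne hij with h | h
    · obtain ⟨k, rfl⟩ := Nat.exists_eq_add_of_le (Nat.succ_le_of_lt h)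
      exact hlt i k
    · obtain ⟨k, rfl⟩ := Nat.exists_eq_add_of_le (Nat.succ_le_of_lt h)
      exact (hlt j k).symm
  · refine ⟨(hφ.comp (hR.iterate i).measurable).aemeasurable, hφ.aemeasurable, ?_⟩
    rw [← Measure.map_map hφ (hR.iterate i).measurable, (hR.iterate i).map_eq]
    rfl

/-- The limit of a function that is interpolated by the averages of a sequence. -/
theorem tendsto_div_of_interpolates {u : ℕ → ℝ} {l : ℝ}
    (hu : Tendsto (fun n : ℕ => u n / n) atTop (𝓝 l)) {N : ℝ → ℕ} (hN : Tendsto N atTop atTop)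
    {f : ℝ → ℝ} (hf : ∀ t, 0 ≤ t → u (N t) ≤ f t ∧ f t ≤ u (N t + 1)) :
    Tendsto (fun t => f t / N t) atTop (𝓝 l) := by
  have h1 : Tendsto (fun n : ℕ => u (n + 1) / n) atTop (𝓝 l) := by
    have h2 : Tendsto (fun n : ℕ => ((n + 1 : ℕ) : ℝ) / n) atTop (𝓝 1) := by
      simpa using (tendsto_natCast_div_add_atTop (1 : ℝ)).inv₀ one_ne_zero
    have h3 := ((tendsto_add_atTop_iff_nat 1).2 hu).mul h2
    rw [mul_one] at h3
    refine h3.congr fun n => ?_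
    have : ((n + 1 : ℕ) : ℝ) ≠ 0 := Nat.cast_ne_zero.2 n.succ_ne_zero
    exact div_mul_div_cancel₀ this
  refine tendsto_of_tendsto_of_tendsto_of_le_of_le' (hu.comp hN) (h1.comp hN) ?_ ?_
  · filter_upwards [eventually_ge_atTop 0] with t ht
    exact div_le_div_of_nonneg_right (hf t ht).1 (Nat.cast_nonneg _)
  · filter_upwards [eventually_ge_atTop 0] with t ht
    exact div_le_div_of_nonneg_right (hf t ht).2 (Nat.cast_nonneg _)

section Renewal

variable {c : Params} {x : Input}

theorem Params.totalTime_mono (c : Params) (x : Input) {s t : ℝ} (h : s ≤ t) :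
    c.totalTime x s ≤ c.totalTime x t := by
  rw [Params.totalTime, Params.totalTime, ← intervalIntegral.integral_add_adjacent_intervals
    (intervalIntegrable_queueLength c x 0 s) (intervalIntegrable_queueLength c x s t)]
  exact le_add_of_nonneg_right (intervalIntegral.integral_nonneg h fun _ _ => Nat.cast_nonneg _)

theorem Params.totalTime_cycleStart (c : Params) (x : Input) (n : ℕ) :
    c.totalTime x (c.cycleStart x n) = ∑ i ∈ Finset.range n, c.cycleTime x i := by
  rw [Params.totalTime, ← c.cycleStart_zero x]
  exact (intervalIntegral.sum_integral_adjacent_intervals fun i _ =>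
    intervalIntegrable_queueLength c x _ _).symm

theorem Params.Good.arrivals_cycleStart (hc : c.Proper) (h : c.Good x) (n : ℕ) :
    (x.arrivals (c.cycleStart x n) : ℝ) = ∑ i ∈ Finset.range n, c.cycleArrivals x i := by
  induction n with
  | zero => simp [c.cycleStart_zero, h.regular.arrivals_zero]
  | succ n ih =>
    rw [Finset.sum_range_succ, ← ih, Params.cycleArrivals, Nat.cast_sub
      (h.regular.arrivals_mono ((h.strictMono_cycleStart hc).monotone n.le_succ))]
    ring

/-- Total time and arrivals are monotone in `t`, hence trapped between their values at the two ends
of the current cycle. Both are divided by the number of completed cycles, which cancels in the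
quotient. -/
theorem Params.Good.tendsto_totalTime_div (hc : c.Proper) (h : c.Good x) {G A : ℝ} (hA : A ≠ 0)
    (hG : Tendsto (fun n : ℕ => (∑ i ∈ Finset.range n, c.cycleTime x i) / n) atTop (𝓝 G))
    (hA' : Tendsto (fun n : ℕ => (∑ i ∈ Finset.range n, c.cycleArrivals x i) / n) atTop (𝓝 A)) :
    Tendsto (fun t => c.totalTime x t / (x.arrivals t : ℝ)) atTop (𝓝 (G / A)) := by
  -- Only nonnegative times lie in a cycle; for negative `t` the index is arbitrary.
  have hex : ∀ t : ℝ, ∃ n, 0 ≤ t → t ∈ Set.Ico (c.cycleStart x n) (c.cycleStart x (n + 1)) :=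
    fun t => by
      by_cases ht : 0 ≤ t
      · obtain ⟨n, hn⟩ := exists_mem_Ico_of_strictMono (h.tendsto_cycleStart hc)
          ((c.cycleStart_zero x).trans_le ht)
        exact ⟨n, fun _ => hn⟩
      · exact ⟨0, fun h => absurd h ht⟩
  choose N hN using hex
  have hNtop : Tendsto N atTop atTop := by
    refine tendsto_atTop.2 fun m => ?_
    filter_upwards [eventually_ge_atTop 0, eventually_ge_atTop (c.cycleStart x m)] with t h0 ht
    have := (h.strictMono_cycleStart hc).lt_iff_lt.1 (ht.trans_lt (hN t h0).2)
    omega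
  simp only [← c.totalTime_cycleStart] at hG
  simp only [← h.arrivals_cycleStart hc] at hA'
  have h1 := tendsto_div_of_interpolates hG hNtop (f := c.totalTime x) fun t ht =>
    ⟨c.totalTime_mono x (hN t ht).1, c.totalTime_mono x (hN t ht).2.le⟩
  have h2 := tendsto_div_of_interpolates hA' hNtop (f := fun t => (x.arrivals t : ℝ)) fun t ht =>
    ⟨Nat.cast_le.2 (h.regular.arrivals_mono (hN t ht).1),
      Nat.cast_le.2 (h.regular.arrivals_mono (hN t ht).2.le)⟩
  refine (h1.div h2 hA).congr' ?_
  filter_upwards [hNtop.eventually_ge_atTop 1] with t ht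
  have : (N t : ℝ) ≠ 0 := Nat.cast_ne_zero.2 (by omega)
  exact div_div_div_cancel_right₀ this _ _

theorem Params.Good.cycleTime_eq (hc : c.Proper) (h : c.Good x) (i : ℕ) :
    c.cycleTime x i = c.cycleTime (c.nextCycle^[i] x) 0 :=
  Params.Good.iterate_eq (f := c.cycleTime) (fun _ hy j => hy.cycleTime_succ hc j) h i

theorem Params.Good.cycleArrivals_eq (hc : c.Proper) (h : c.Good x) (i : ℕ) :
    c.cycleArrivals x i = c.cycleArrivals (c.nextCycle^[i] x) 0 :=
  Params.Good.iterate_eq (f := c.cycleArrivals) (fun _ hy j => hy.cycleArrivals_succ hc j) h i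

theorem Params.Good.activePath_eq (hc : c.Proper) (h : c.Good x) (i : ℕ) :
    c.activePath x i = c.activePath (c.nextCycle^[i] x) 0 :=
  Params.Good.iterate_eq (f := c.activePath) (fun _ hy j => hy.activePath_succ hc j) h i

theorem Params.Good.noArrival_iff (hc : c.Proper) (h : c.Good x) (i : ℕ) :
    c.NoArrival x i ↔ c.nextCycle^[i] x ∈ c.noArrivalSet := by
  rw [Params.Good.iterate_eq (f := c.NoArrival) (fun _ hy j => hy.noArrival_succ hc j) h i]
  exact c.noArrival_zero_iff (h.iterate i).regular

end Renewal

section Law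

variable {lam mu : ℝ} [hlam : Fact (0 < lam)] [hmu : Fact (0 < mu)] {c : Params}

theorem indepFun_cycleTime (hc : c.Proper) :
    IndepFun (fun x => c.cycleTime x 0) c.nextCycle (inputLaw lam mu) :=
  ((splits_nextCycle hc (ae_exists_isReturn hc)).comp measurable_fst).indepFun
    (measurable_cycleTime c 0) (measurable_nextCycle c)

theorem indepFun_cycleArrivals (hc : c.Proper) :
    IndepFun (fun x => c.cycleArrivals x 0) c.nextCycle (inputLaw lam mu) :=
  ((splits_nextCycle hc (ae_exists_isReturn hc)).comp measurable_snd).indepFun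
    (measurable_cycleArrivals c 0) (measurable_nextCycle c)

theorem integral_cycleArrivals_pos (hc : c.Proper) :
    0 < ∫ x, c.cycleArrivals x 0 ∂(inputLaw lam mu) := by
  have h := integral_mono_ae (integrable_const (1 : ℝ)) (integrable_cycleArrivals hc)
    ((ae_good (lam := lam) (mu := mu) hc).mono fun x hx => hx.one_le_cycleArrivals hc)
  simp only [integral_const, probReal_univ, one_smul] at h
  linarith

theorem ae_tendsto_totalTime_div (hc : c.Proper) :
    ∀ᵐ x ∂(inputLaw lam mu), Tendsto (fun t => c.totalTime x t / (x.arrivals t : ℝ)) atTop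
      (𝓝 ((∫ x, c.cycleTime x 0 ∂(inputLaw lam mu)) /
        ∫ x, c.cycleArrivals x 0 ∂(inputLaw lam mu))) := by
  have hR := measurePreserving_nextCycle (lam := lam) (mu := mu) hc
  filter_upwards [ae_good hc,
    strong_law_iterate hR (measurable_cycleTime c 0) (integrable_cycleTime hc)
      (indepFun_cycleTime hc),
    strong_law_iterate hR (measurable_cycleArrivals c 0) (integrable_cycleArrivals hc)
      (indepFun_cycleArrivals hc)] with x hx h1 h2
  simp only [← hx.cycleTime_eq hc] at h1
  simp only [← hx.cycleArrivals_eq hc] at h2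
  exact hx.tendsto_totalTime_div hc (integral_cycleArrivals_pos hc).ne' h1 h2

theorem ae_tendsto_sum_indicator_div (hc : c.Proper) :
    ∀ᵐ x ∂(inputLaw lam mu), Tendsto (fun n : ℕ =>
      (∑ i ∈ Finset.range n,
        c.noArrivalSet.indicator (fun x => c.cycleTime x 0) (c.nextCycle^[i] x)) /
      ∑ i ∈ Finset.range n,
        c.noArrivalSet.indicator (fun x => c.cycleArrivals x 0) (c.nextCycle^[i] x)) atTop
      (𝓝 ((∫ x, (noPolicy c.K).cycleTime x 0 ∂(inputLaw lam mu)) /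
        ∫ x, (noPolicy c.K).cycleArrivals x 0 ∂(inputLaw lam mu))) := by
  have hp := c.noPolicy_proper hc.one_le_K
  have hR := measurePreserving_nextCycle (lam := lam) (mu := mu) hc
  have hA := measurableSet_noArrivalSet c
  have ht : ∀ᵐ x ∂(inputLaw lam mu), x ∈ c.noArrivalSet →
      c.cycleTime x 0 = (noPolicy c.K).cycleTime (c.afterVacations x) 0 :=
    (ae_cycle_of_noArrival hc).mono fun x hx h => (hx h).2.1
  have ha : ∀ᵐ x ∂(inputLaw lam mu), x ∈ c.noArrivalSet →
      c.cycleArrivals x 0 = (noPolicy c.K).cycleArrivals (c.afterVacations x) 0 :=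
    (ae_cycle_of_noArrival hc).mono fun x hx h => (hx h).2.2.1
  have hA0 : (inputLaw lam mu).real c.noArrivalSet ≠ 0 :=
    ENNReal.toReal_ne_zero.2 ⟨measure_noArrivalSet_ne_zero hc, measure_ne_top _ _⟩
  filter_upwards [
    strong_law_iterate hR ((measurable_cycleTime c 0).indicator hA)
      ((integrable_cycleTime hc).indicator hA)
      (indepFun_indicator_noArrivalSet hc (measurable_cycleTime _ 0) ht (indepFun_cycleTime hp)),
    strong_law_iterate hR ((measurable_cycleArrivals c 0).indicator hA)
      ((integrable_cycleArrivals hc).indicator hA)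
      (indepFun_indicator_noArrivalSet hc (measurable_cycleArrivals _ 0) ha
        (indepFun_cycleArrivals hp))] with x h1 h2
  rw [integral_indicator_noArrivalSet hc (measurable_cycleTime _ 0) ht] at h1
  rw [integral_indicator_noArrivalSet hc (measurable_cycleArrivals _ 0) ha] at h2
  have h3 := h1.div h2 (mul_ne_zero hA0 (integral_cycleArrivals_pos hp).ne')
  rw [mul_div_mul_left _ _ hA0] at h3
  refine h3.congr' ?_
  filter_upwards [eventually_ge_atTop 1] with n hn
  have : (n : ℝ) ≠ 0 := Nat.cast_ne_zero.2 (by omega)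
  exact div_div_div_cancel_right₀ this _ _

end Law

/-! ### Transfer to the underlying probability space -/

theorem integrable_comp_of_measurePreserving {Ω Z : Type*} [MeasurableSpace Ω]
    [MeasurableSpace Z] {P : Measure Ω} {M : Measure Z} {T : Ω → Z} (hT : MeasurePreserving T P M)
    {f : Z → ℝ} (hf : Integrable f M) {g : Ω → ℝ} (hg : g =ᵐ[P] f ∘ T) :
    Integrable g P ∧ ∫ ω, g ω ∂P = ∫ z, f z ∂M := by
  refine ⟨(hT.integrable_comp_of_integrable hf).congr hg.symm, ?_⟩
  rw [integral_congr_ae hg, ← hT.map_eq, integral_map hT.measurable.aemeasurable]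
  · rfl
  · rw [hT.map_eq]
    exact hf.aestronglyMeasurable

theorem cond_congr_ae {Ω : Type*} [MeasurableSpace Ω] {P : Measure Ω} {s t : Set Ω}
    (h : s =ᵐ[P] t) : cond P s = cond P t := by
  rw [ProbabilityTheory.cond, ProbabilityTheory.cond, measure_congr h, Measure.restrict_congr_set h]

theorem measurePreserving_cond {Ω Z : Type*} [MeasurableSpace Ω] [MeasurableSpace Z]
    {P : Measure Ω} {M : Measure Z} {T : Ω → Z} (hT : MeasurePreserving T P M) {s : Set Z}
    (hs : MeasurableSet s) : MeasurePreserving T (cond P (T ⁻¹' s)) (cond M s) := by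
  refine ⟨hT.measurable, ?_⟩
  rw [ProbabilityTheory.cond, ProbabilityTheory.cond, hT.measure_preimage hs.nullMeasurableSet,
    Measure.map_smul, (hT.restrict_preimage hs).map_eq]

section Transfer

variable {lam mu : ℝ} [hlam : Fact (0 < lam)] [hmu : Fact (0 < mu)] {c : Params} {Ω : Type*}
  [MeasurableSpace Ω] {P : Measure Ω} {x : Ω → Input}

theorem noArrival_ae_eq (hc : c.Proper) (hx : MeasurePreserving x P (inputLaw lam mu)) (i : ℕ) :
    {ω | c.NoArrival (x ω) i} =ᵐ[P] (c.nextCycle^[i] ∘ x) ⁻¹' c.noArrivalSet := by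
  filter_upwards [hx.quasiMeasurePreserving.ae (ae_good hc)] with ω hω
  exact propext (hω.noArrival_iff hc i)

theorem measurePreserving_iterate (hc : c.Proper)
    (hx : MeasurePreserving x P (inputLaw lam mu)) (i : ℕ) :
    MeasurePreserving (c.nextCycle^[i] ∘ x) P (inputLaw lam mu) :=
  ((measurePreserving_nextCycle hc).iterate i).comp hx

/-- The input that remains after the vacations of a cycle without an arrival in them. -/
theorem measurePreserving_cond_noArrival (hc : c.Proper)
    (hx : MeasurePreserving x P (inputLaw lam mu)) (i : ℕ) :
    MeasurePreserving (c.afterVacations ∘ c.nextCycle^[i] ∘ x)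
      (cond P {ω | c.NoArrival (x ω) i}) (inputLaw lam mu) := by
  rw [cond_congr_ae (noArrival_ae_eq hc hx i)]
  exact (measurePreserving_afterVacations hc).comp (measurePreserving_cond
    (measurePreserving_iterate hc hx i) (measurableSet_noArrivalSet c))

theorem ae_cond_noArrival (hc : c.Proper) (hx : MeasurePreserving x P (inputLaw lam mu)) (i : ℕ) :
    ∀ᵐ ω ∂(cond P {ω | c.NoArrival (x ω) i}),
      c.cycleTime (x ω) i =
        (noPolicy c.K).cycleTime (c.afterVacations (c.nextCycle^[i] (x ω))) 0 ∧
      c.cycleArrivals (x ω) i =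
        (noPolicy c.K).cycleArrivals (c.afterVacations (c.nextCycle^[i] (x ω))) 0 ∧
      c.activePath (x ω) i =
        (noPolicy c.K).activePath (c.afterVacations (c.nextCycle^[i] (x ω))) 0 := by
  have hy := measurePreserving_iterate hc hx i
  rw [cond_congr_ae (noArrival_ae_eq hc hx i)]
  have h1 := hx.quasiMeasurePreserving.ae (ae_good hc)
  have h2 := hy.quasiMeasurePreserving.ae (ae_cycle_of_noArrival hc)
  filter_upwards [cond_absolutelyContinuous.ae_le h1, cond_absolutelyContinuous.ae_le h2,
    ae_cond_mem (hy.measurable (measurableSet_noArrivalSet c))] with ω h1 h2 h3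
  rw [h1.cycleTime_eq hc, h1.cycleArrivals_eq hc, h1.activePath_eq hc]
  exact (h2 h3).2

end Transfer

end VacationQueue

end

theorem mainTheorem2 {Ω : Type*} [MeasurableSpace Ω] (P : Measure Ω) [IsProbabilityMeasure P]
    (lam mu Lv : ℝ) (hlam : 0 < lam) (hmu : 0 < mu) (hne : lam ≠ mu) (hLv : 0 < Lv)
    (K Nv : ℕ) (hK : 1 ≤ K) (hNv : 1 ≤ Nv)
    -- Poisson arrivals of rate `lam`, independent exponential services of rate `mu`
    (X S : ℕ → Ω → ℝ) (hX : ∀ n, Measurable (X n)) (hS : ∀ n, Measurable (S n))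
    (hXlaw : ∀ n, P.map (X n) = expMeasure lam) (hSlaw : ∀ n, P.map (S n) = expMeasure mu)
    (hindep : iIndepFun (Sum.elim X S) P)
    -- the bounded multi-vacation queue, and its events `A i`, one for each running cycle `i`
    (c : VacationQueue.Params) (hc : c = ⟨K, Nv, Lv⟩)
    (x : Ω → VacationQueue.Input) (hx : x = VacationQueue.randomInput X S)
    (A : ℕ → Set Ω) (hA : A = fun i => {ω | c.NoArrival (x ω) i}) :
    -- the events have the probability `exp (-lam * Nv * Lv)`
    (∀ i, P (A i) = ENNReal.ofReal (Real.exp (-(lam * (Nv * Lv))))) ∧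
    -- conditionally on `A i`, the system works as the M/M/1/K queue without any policy
    (∀ i, IdentDistrib (fun ω => c.activePath (x ω) i)
      (fun ω => (VacationQueue.noPolicy K).activePath (x ω) 0) (cond P (A i)) P) ∧
    -- the mean waiting time in an averaged running cycle, conditionally on `A i`
    (∀ i, Integrable (fun ω => c.cycleTime (x ω) i) (cond P (A i)) ∧
      Integrable (fun ω => c.cycleArrivals (x ω) i) (cond P (A i)) ∧
      (∫ ω, c.cycleTime (x ω) i ∂(cond P (A i))) / (∫ ω, c.cycleArrivals (x ω) i ∂(cond P (A i))) =
        VacationQueue.waitingTime lam mu K) ∧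
    -- the long-run mean waiting time over the running cycles in which the event occurs
    (∀ᵐ ω ∂P, Tendsto (fun n : ℕ =>
        (∑ i ∈ Finset.range n, (A i).indicator (fun ω => c.cycleTime (x ω) i) ω) /
          (∑ i ∈ Finset.range n, (A i).indicator (fun ω => c.cycleArrivals (x ω) i) ω))
      atTop (𝓝 (VacationQueue.waitingTime lam mu K))) ∧
    -- the long-run mean waiting time of the M/M/1/K queue without any policy
    (∀ᵐ ω ∂P, Tendsto (fun t : ℝ =>
        (VacationQueue.noPolicy K).totalTime (x ω) t / ((x ω).arrivals t : ℝ))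
      atTop (𝓝 (VacationQueue.waitingTime lam mu K))) ∧
    -- the long-run mean waiting time of the vacation queue is that of an averaged running cycle
    (∀ i, Integrable (fun ω => c.cycleTime (x ω) i) P ∧
      Integrable (fun ω => c.cycleArrivals (x ω) i) P ∧
      ∀ᵐ ω ∂P, Tendsto (fun t : ℝ => c.totalTime (x ω) t / ((x ω).arrivals t : ℝ)) atTop
        (𝓝 ((∫ ω, c.cycleTime (x ω) i ∂P) / (∫ ω, c.cycleArrivals (x ω) i ∂P)))) := by
  have : Fact (0 < lam) := ⟨hlam⟩
  have : Fact (0 < mu) := ⟨hmu⟩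
  have hc' : c.Proper := by
    subst hc
    exact ⟨hK, hLv.le, fun _ => hLv⟩
  have hcK : c.K = K := by rw [hc]
  have hv : (c.Nv : ℝ) * c.Lv = Nv * Lv := by rw [hc]
  have hp : (VacationQueue.noPolicy c.K).Proper := c.noPolicy_proper hc'.one_le_K
  have hxP : MeasurePreserving x P (VacationQueue.inputLaw lam mu) := by
    rw [hx]
    exact VacationQueue.measurePreserving_randomInput hX hS hXlaw hSlaw hindep
  have hgood := hxP.quasiMeasurePreserving.ae (VacationQueue.ae_good hc')
  have hW := VacationQueue.integral_cycleTime_div_noPolicy hne hK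
  subst hcK hA
  refine ⟨fun i => ?_, fun i => ?_, fun i => ?_, ?_, ?_, fun i => ?_⟩
  · rw [measure_congr (VacationQueue.noArrival_ae_eq hc' hxP i),
      (VacationQueue.measurePreserving_iterate hc' hxP i).measure_preimage
        (VacationQueue.measurableSet_noArrivalSet c).nullMeasurableSet,
      VacationQueue.measure_noArrivalSet hc', hv]
  · have hm := VacationQueue.measurable_activePath (VacationQueue.noPolicy c.K) 0
    have hz := VacationQueue.measurePreserving_cond_noArrival hc' hxP i
    refine IdentDistrib.trans (IdentDistrib.of_ae_eq
      ((VacationQueue.measurable_activePath c i).comp hxP.measurable).aemeasurable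
      ((VacationQueue.ae_cond_noArrival hc' hxP i).mono fun ω h => h.2.2)) ?_
    -- Both sides are now the same functional, the active path of the queue without policy, of
    -- inputs that have the law `inputLaw`: the input after the vacations under the conditional
    -- measure, and the original input under `P`.
    refine ⟨(hm.comp hz.measurable).aemeasurable, (hm.comp hxP.measurable).aemeasurable, ?_⟩
    exact (Measure.map_map hm hz.measurable).symm.trans
      ((congrArg (Measure.map _) (hz.map_eq.trans hxP.map_eq.symm)).trans
        (Measure.map_map hm hxP.measurable))
  · have hz := VacationQueue.measurePreserving_cond_noArrival hc' hxP i
    have hae := VacationQueue.ae_cond_noArrival hc' hxP i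
    have h1 := VacationQueue.integrable_comp_of_measurePreserving hz
      (VacationQueue.integrable_cycleTime hp) (hae.mono fun ω h => h.1)
    have h2 := VacationQueue.integrable_comp_of_measurePreserving hz
      (VacationQueue.integrable_cycleArrivals hp) (hae.mono fun ω h => h.2.1)
    refine ⟨h1.1, h2.1, ?_⟩
    rw [h1.2, h2.2, hW]
  · filter_upwards [hgood,
      hxP.quasiMeasurePreserving.ae (VacationQueue.ae_tendsto_sum_indicator_div hc')] with ω h1 h2
    rw [hW] at h2
    refine h2.congr fun n => ?_
    have hind : ∀ (f : VacationQueue.Input → ℕ → ℝ), (∀ i, f (x ω) i = f (c.nextCycle^[i] (x ω)) 0) →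
        ∀ i, c.noArrivalSet.indicator (fun y => f y 0) (c.nextCycle^[i] (x ω)) =
          {ω | c.NoArrival (x ω) i}.indicator (fun ω => f (x ω) i) ω := fun f hf i => by
      by_cases h : c.NoArrival (x ω) i
      · rw [Set.indicator_of_mem ((h1.noArrival_iff hc' i).1 h),
          Set.indicator_of_mem (s := {ω | c.NoArrival (x ω) i}) h, hf]
      · rw [Set.indicator_of_notMem fun h' => h ((h1.noArrival_iff hc' i).2 h'),
          Set.indicator_of_notMem (s := {ω | c.NoArrival (x ω) i}) h]
    simp only [hind c.cycleTime (h1.cycleTime_eq hc'),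
      hind c.cycleArrivals (h1.cycleArrivals_eq hc')]
  · rw [← hW]
    exact hxP.quasiMeasurePreserving.ae (VacationQueue.ae_tendsto_totalTime_div hp)
  · have hy := VacationQueue.measurePreserving_iterate hc' hxP i
    have h1 := VacationQueue.integrable_comp_of_measurePreserving hy
      (VacationQueue.integrable_cycleTime hc') (hgood.mono fun ω h => h.cycleTime_eq hc' i)
    have h2 := VacationQueue.integrable_comp_of_measurePreserving hy
      (VacationQueue.integrable_cycleArrivals hc') (hgood.mono fun ω h => h.cycleArrivals_eq hc' i)
    refine ⟨h1.1, h2.1, ?_⟩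
    rw [h1.2, h2.2]
    exact hxP.quasiMeasurePreserving.ae (VacationQueue.ae_tendsto_totalTime_div hc')
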